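/- Let $M$ be a finite-dimensional smooth Hausdorff manifold without boundary, let $\mathbb K\in\{\mathbb R,\mathbb C\}$, and let $\mathcal V\to M$ be a smooth $\mathbb K$-vector bundle of finite rank with a smooth connection $\nabla$ and a smooth section $A$ of $\mathrm{End}(\mathcal V)$. Let $X$ be a smooth vector field on $M$ with flow $\Phi_t$, and let $p\in M$ be a strictly positive source of $X$, i.e. $X(p)=0$ and all eigenvalues (complex roots of the characteristic polynomial) of the linearization of $X$ at $p$ have strictly positive real part. Let $U$ be an open neighbourhood of $p$ that is star-shaped around $p$ with respect to $X$: for every $q\in U$ the flow $\Phi_t(q)$ exists for all $t\le 0$, lies in $U$ for all $t\le 0$, and $\lim_{t\to-\infty}\Phi_t(q)=p$. A smooth section over $U$ is called flat at $p$ if its value and all its derivatives of all orders (in local coordinates and a local trivialization) vanish at $p$. Then for each section $v\in\Gamma^\infty(U,\mathcal V)$ that is flat at $p$ there is a unique section $u\in\Gamma^\infty(U,\mathcal V)$ that is flat at $p$ and satisfies $$(\nabla_X+A)u=v \quad\text{on } U .$$ It is given, for $y\in U$, by the absolutely convergent integral $$u(y)=\int_{-\infty}^0 E(s,y)^{-1}\,v(\Phi_s(y))\,ds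 ,$$ where $E(t,y):\mathcal V_y\to\mathcal V_{\Phi_t(y)}$, $t\le 0$, is the unique solution of $$\frac{\nabla}{dt}E(t,y)=-A(\Phi_t(y))\,E(t,y),\qquad E(0,y)=\mathrm{id},$$ $\frac{\nabla}{dt}$ being the covariant derivative along the curve $t\mapsto\Phi_t(y)$, and every $E(t,y)$ is invertible. (If $M$ is an open subset of $\mathbb R^n$, $\mathcal V$ is trivial and $\nabla$ is the trivial connection, then $\frac{\nabla}{dt}=\frac{\partial}{\partial t}$.) In particular, for every $\lambda\in\mathbb K$ the homogeneous equation $(\nabla_X+A)u=\lambda u$ has no non-trivial solution $u\in\Gamma^\infty(U,\mathcal V)$ that is flat at $p$. -/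

import Mathlib

open Bundle Set Filter Topology MeasureTheory
open scoped Manifold ContDiff

noncomputable section

namespace FlatSol

section Sections

variable {E : Type*} [NormedAddCommGroup E] [NormedSpace ℝ E]
  {M : Type*} [TopologicalSpace M] [ChartedSpace E M]
  (F : Type*) [NormedAddCommGroup F] [NormedSpace ℝ F]
  {V : M → Type*} [TopologicalSpace (TotalSpace F V)]
  [∀ x, TopologicalSpace (V x)] [FiberBundle F V]

/-- The section `σ` read in the preferred chart of `M` at `p` and the preferred local
trivialization of the bundle at `p`. -/
def localRep (p : M) (σ : Π x : M, V x) : E → F := fun z =>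
  (trivializationAt F V p
    (TotalSpace.mk' F ((extChartAt 𝓘(ℝ, E) p).symm z) (σ ((extChartAt 𝓘(ℝ, E) p).symm z)))).2

/-- `σ` is a smooth section of the bundle over `U`, i.e. `σ ∈ Γ^∞(U, V)`. Only the values of `σ` on
`U` matter. -/
def IsSmoothSectionOn (U : Set M) (σ : Π x : M, V x) : Prop :=
  ContMDiffOn 𝓘(ℝ, E) (𝓘(ℝ, E).prod 𝓘(ℝ, F)) ∞ (fun x => TotalSpace.mk' F x (σ x)) U

/-- A section (smooth near `p`) is flat at `p` if its value and all its partial derivatives of all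
orders vanish at `p`. The order `k = 0` is the condition `σ p = 0`. -/
def IsFlatAt (p : M) (σ : Π x : M, V x) : Prop :=
  ∀ k : ℕ, iteratedFDeriv ℝ k (localRep (E := E) F p σ) (extChartAt 𝓘(ℝ, E) p p) = 0

end Sections

section VectorFields

variable {E : Type*} [NormedAddCommGroup E] [NormedSpace ℝ E]
  {M : Type*} [TopologicalSpace M] [ChartedSpace E M]

/-- The linearization of `X` at a zero `p`: the Jacobian of `X` in the preferred chart at `p`
(through which Mathlib identifies `T_p M` with `E`). -/
def linearization [IsManifold 𝓘(ℝ, E) 1 M] (X : Π x : M, TangentSpace 𝓘(ℝ, E) x) (p : M) :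
    E →L[ℝ] E :=
  fderiv ℝ (localRep (E := E) E (V := fun x : M => TangentSpace 𝓘(ℝ, E) x) p X)
    (extChartAt 𝓘(ℝ, E) p p)

/-- `p` is a strictly positive source of `X`: `X p = 0`, and all eigenvalues (complex roots of the
characteristic polynomial) of the linearization at `p` have strictly positive real part. -/
def IsStrictlyPositiveSource [FiniteDimensional ℝ E] [IsManifold 𝓘(ℝ, E) 1 M]
    (X : Π x : M, TangentSpace 𝓘(ℝ, E) x) (p : M) : Prop :=
  X p = 0 ∧ ∀ μ : ℂ,
    ((linearization X p).toLinearMap.charpoly.map (algebraMap ℝ ℂ)).IsRoot μ → 0 < μ.re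

/-- `γ` restricted to `(-∞, 0]` is the backward orbit `t ↦ Φ_t (γ 0)` of the flow `Φ` of `X`. On a
Hausdorff manifold it is determined on `(-∞, 0]` by its end point `γ 0`. -/
def IsBackwardOrbit (X : Π x : M, TangentSpace 𝓘(ℝ, E) x) (γ : ℝ → M) : Prop :=
  IsMIntegralCurveOn γ X (Iic 0)

/-- `U` is an open neighbourhood of `p` that is star-shaped around `p` with respect to `X`: for all
`q ∈ U` the flow `Φ_t q` exists for all `t ≤ 0`, stays in `U`, and tends to `p` as `t → -∞`. -/
def IsStarShaped (X : Π x : M, TangentSpace 𝓘(ℝ, E) x) (p : M) (U : Set M) : Prop :=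
  IsOpen U ∧ p ∈ U ∧ ∀ q ∈ U, ∃ γ : ℝ → M, γ 0 = q ∧ IsBackwardOrbit X γ ∧
    Tendsto γ atBot (𝓝 p) ∧ ∀ t ≤ 0, γ t ∈ U

end VectorFields

section Connections

variable {E : Type*} [NormedAddCommGroup E] [NormedSpace ℝ E]
  {M : Type*} [TopologicalSpace M] [ChartedSpace E M]
  {F : Type*} [NormedAddCommGroup F] [NormedSpace ℝ F]
  {V : M → Type*} [TopologicalSpace (TotalSpace F V)]
  [∀ x, AddCommGroup (V x)] [∀ x, Module ℝ (V x)] [∀ x, TopologicalSpace (V x)]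
  [∀ x, IsTopologicalAddGroup (V x)] [∀ x, ContinuousSMul ℝ (V x)] [FiberBundle F V]

/-- The operator `∇_X + A`. -/
def nablaAdd (nabla : CovariantDerivative 𝓘(ℝ, E) F V) (X : Π x : M, TangentSpace 𝓘(ℝ, E) x)
    (A : Π x : M, V x →L[ℝ] V x) (σ : Π x : M, V x) : Π x : M, V x :=
  fun x => nabla σ x (X x) + A x (σ x)

/-- `w` is a section of `V` along the curve `γ`, `ξ` is the velocity of `γ` at `t₀`, and `w'` is the
covariant derivative of `w` along `γ` at `t₀` (everything relative to the parameter set `s`).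
In the local trivialization `e` at `γ t₀`, with `c` the fibre coordinate of `w`, this is the usual
formula `e (∇w/dt) = dc/dt + e (∇_ξ s)`, where `s` is the local section that is constant, equal
to `c t₀`, in the trivialization (so that the last term is the Christoffel term). -/
def HasCovDerivAlong (nabla : CovariantDerivative 𝓘(ℝ, E) F V) (γ : ℝ → M) (w : Π t : ℝ, V (γ t))
    (s : Set ℝ) (t₀ : ℝ) (ξ : TangentSpace 𝓘(ℝ, E) (γ t₀)) (w' : V (γ t₀)) : Prop :=
  let e := trivializationAt F V (γ t₀)
  let c : ℝ → F := fun t => (e (TotalSpace.mk' F (γ t) (w t))).2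
  HasMFDerivWithinAt 𝓘(ℝ, ℝ) 𝓘(ℝ, E) γ s t₀ ((1 : ℝ →L[ℝ] ℝ).smulRight ξ) ∧
  HasDerivWithinAt c
    ((e (TotalSpace.mk' F (γ t₀) w')).2 -
      (e (TotalSpace.mk' F (γ t₀) (nabla (fun x => e.symm x (c t₀)) (γ t₀) ξ))).2) s t₀

/-- `T t = E(t, γ 0) : V (γ 0) → V (γ t)`, `t ≤ 0`, is the solution of
`∇/dt E(t) = - A(γ t) E(t)`, `E(0) = id` along the backward orbit `γ` of `X`. -/
def IsFundamentalSolution (nabla : CovariantDerivative 𝓘(ℝ, E) F V)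
    (X : Π x : M, TangentSpace 𝓘(ℝ, E) x) (A : Π x : M, V x →L[ℝ] V x) (γ : ℝ → M)
    (T : Π t : ℝ, V (γ 0) →L[ℝ] V (γ t)) : Prop :=
  T 0 = ContinuousLinearMap.id ℝ (V (γ 0)) ∧
  ∀ a : V (γ 0), ∀ t ≤ 0,
    HasCovDerivAlong nabla γ (fun r => T r a) (Iic 0) t (X (γ t)) (-(A (γ t) (T t a)))

end Connections

/-- The integral of `f` over `(-∞, 0]` converges absolutely and equals `a`, for `f` with values in a
finite-dimensional topological vector space `W` without a distinguished norm: this is tested on all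
linear functionals, i.e. on all coordinates. -/
def HasIntegralIic {W : Type*} [AddCommGroup W] [Module ℝ W] [TopologicalSpace W]
    (f : ℝ → W) (a : W) : Prop :=
  ∀ l : W →L[ℝ] ℝ, IntegrableOn (fun s => l (f s)) (Iic 0) ∧ ∫ s in Iic (0 : ℝ), l (f s) = l a

end FlatSol

end

/-! Along an integral curve of `X` the equation becomes a linear ODE for `u` in the fibres, and two
rates compete as time tends to `-∞`. The spectral condition at `p` yields a quadratic form that
decreases exponentially along backward orbits (`exists_lyapunov`, `LocalModel.exists_trap`). Orbits
therefore converge to `p` exponentially, and a section flat at `p` decays along them faster than any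
exponential. The coefficients of the ODE are bounded near `p`, so homogeneous solutions change at a
bounded exponential rate. Decay wins. A flat solution of the homogeneous equation must vanish by
Grönwall (`eq_zero_of_decaying`, `eq_zero_of_flat`), also with `λ u` on the right-hand side. A flat
source has exactly one rapidly decaying solution on each orbit (`exists_decaying_linearODE`).

Near `p` the decaying solutions on the orbits fit together to a function `u`, by uniqueness.
Smoothness comes from a bootstrap: the pair `(u, Du)` formally solves a transport equation of the
same kind, with source `(v, Dv)`, which is again flat. That this decaying solution really contains
the derivative of `u` follows by approximating with solutions that start from zero at time `-n`;
their derivatives converge uniformly (`IsDecayingSolution.exists_derived`). Induction on the order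
gives smoothness, and since decaying solutions vanish at the fixed point, it gives flatness too.

Every backward orbit in `U` eventually enters the neighbourhood where `u` has been found, so `u`
extends to `U` by solving the ODE forward (`exists_solution_along_orbits`). Smoothness is carried
along by differentiable dependence on end points, proved for finite times in
`hasFDerivAt_of_solvesAlong` and propagated in `isSmoothSectionOn_of_solvesOn`.

The integral formula is variation of constants: `E(s)⁻¹ u` has derivative `E(s)⁻¹ v`
(`IsFundamentalSolution.hasDerivWithinAt_inverse`). It tends to zero at `-∞` and equals `u(y)` at
time zero. The passage between bundle and coordinates rests on the transformation law of Christoffel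
terms (`hasDerivWithinAt_coord_change`). -/

noncomputable section

namespace FlatSol

set_option linter.unusedSectionVars false

universe u w

/-! ### Grönwall estimates and linear ODEs on compact intervals -/

section LinearODE

variable {F : Type*} [NormedAddCommGroup F] [NormedSpace ℝ F]

theorem hasDerivWithinAt_Ici_of_Icc {f : ℝ → F} {f' : F} {a b t : ℝ} (ht : t ∈ Ico a b)
    (h : HasDerivWithinAt f f' (Icc a b) t) : HasDerivWithinAt f f' (Ici t) t :=
  h.mono_of_mem_nhdsWithin (Icc_mem_nhdsGE_of_mem ht)

/-- Forward Grönwall inequality with two-sided derivatives within `[a, b]`. -/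
theorem norm_le_gronwallBound_of_norm_deriv_le {f f' : ℝ → F} {a b K ε : ℝ}
    (hf : ∀ t ∈ Icc a b, HasDerivWithinAt f (f' t) (Icc a b) t)
    (hb : ∀ t ∈ Icc a b, ‖f' t‖ ≤ K * ‖f t‖ + ε) {δ : ℝ} (hδ : ‖f a‖ ≤ δ) :
    ∀ t ∈ Icc a b, ‖f t‖ ≤ gronwallBound δ K ε (t - a) :=
  norm_le_gronwallBound_of_norm_deriv_right_le (fun t ht => (hf t ht).continuousWithinAt)
    (fun t ht => hasDerivWithinAt_Ici_of_Icc ht (hf t (Ico_subset_Icc_self ht))) hδ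
    (fun t ht => hb t (Ico_subset_Icc_self ht))

theorem norm_right_le_mul_exp {f f' : ℝ → F} {a b K : ℝ} (hab : a ≤ b)
    (hf : ∀ t ∈ Icc a b, HasDerivWithinAt f (f' t) (Icc a b) t)
    (hb : ∀ t ∈ Icc a b, ‖f' t‖ ≤ K * ‖f t‖) : ‖f b‖ ≤ ‖f a‖ * Real.exp (K * (b - a)) := by
  have := norm_le_gronwallBound_of_norm_deriv_le (ε := 0) hf (by simpa using hb) le_rfl b
    (right_mem_Icc.2 hab)
  rwa [gronwallBound_ε0] at this

theorem hasDerivWithinAt_comp_neg {f : ℝ → F} {f' : F} {a b t : ℝ}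
    (h : HasDerivWithinAt f f' (Icc a b) (-t)) :
    HasDerivWithinAt (fun r => f (-r)) (-f') (Icc (-b) (-a)) t := by
  have := h.scomp t (hasDerivAt_neg t).hasDerivWithinAt
    (s := Icc (-b) (-a)) (fun r hr => ⟨by linarith [hr.2], by linarith [hr.1]⟩)
  rw [neg_one_smul] at this
  exact this

/-- Time reversal turns this into the forward estimate. -/
theorem norm_left_le_mul_exp {f f' : ℝ → F} {a b K : ℝ} (hab : a ≤ b)
    (hf : ∀ t ∈ Icc a b, HasDerivWithinAt f (f' t) (Icc a b) t)
    (hb : ∀ t ∈ Icc a b, ‖f' t‖ ≤ K * ‖f t‖) : ‖f a‖ ≤ ‖f b‖ * Real.exp (K * (b - a)) := by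
  have key := norm_right_le_mul_exp (f := fun r => f (-r)) (f' := fun r => -f' (-r))
    (a := -b) (b := -a) (K := K) (by linarith)
    (fun t ht => hasDerivWithinAt_comp_neg (hf (-t) ⟨by linarith [ht.2], by linarith [ht.1]⟩))
    (fun t ht => by simpa using hb (-t) ⟨by linarith [ht.2], by linarith [ht.1]⟩)
  simp only [neg_neg] at key
  convert key using 3
  ring

/-- Two-sided Grönwall estimate. -/
theorem norm_le_mul_exp_abs {f f' : ℝ → F} {a b K : ℝ}
    (hf : ∀ t ∈ Icc a b, HasDerivWithinAt f (f' t) (Icc a b) t)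
    (hb : ∀ t ∈ Icc a b, ‖f' t‖ ≤ K * ‖f t‖) {s t : ℝ} (hs : s ∈ Icc a b) (ht : t ∈ Icc a b) :
    ‖f t‖ ≤ ‖f s‖ * Real.exp (K * |t - s|) := by
  rcases le_total s t with h | h
  · rw [abs_of_nonneg (by linarith)]
    have hsub : Icc s t ⊆ Icc a b := Icc_subset_Icc hs.1 ht.2
    exact norm_right_le_mul_exp h (fun r hr => (hf r (hsub hr)).mono hsub)
      (fun r hr => hb r (hsub hr))
  · rw [abs_of_nonpos (by linarith), neg_sub]
    have hsub : Icc t s ⊆ Icc a b := Icc_subset_Icc ht.1 hs.2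
    exact norm_left_le_mul_exp h (fun r hr => (hf r (hsub hr)).mono hsub)
      (fun r hr => hb r (hsub hr))

/-- The radial retraction onto the closed ball of radius `R`. -/
def radialRetraction (R : ℝ) (x : F) : F := (R / max R ‖x‖) • x

theorem radialRetraction_of_norm_le {R : ℝ} (hR : 0 < R) {x : F} (hx : ‖x‖ ≤ R) :
    radialRetraction R x = x := by
  simp [radialRetraction, max_eq_left hx, hR.ne']

theorem norm_radialRetraction_le_norm {R : ℝ} (hR : 0 < R) (x : F) :
    ‖radialRetraction R x‖ ≤ ‖x‖ := by
  have hm : 0 < max R ‖x‖ := lt_max_of_lt_left hR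
  rw [radialRetraction, norm_smul, Real.norm_of_nonneg (by positivity)]
  refine mul_le_of_le_one_left (norm_nonneg _) ?_
  rw [div_le_one hm]
  exact le_max_left _ _

theorem norm_radialRetraction_le {R : ℝ} (hR : 0 < R) (x : F) : ‖radialRetraction R x‖ ≤ R := by
  have hm : 0 < max R ‖x‖ := lt_max_of_lt_left hR
  rw [radialRetraction, norm_smul, Real.norm_of_nonneg (by positivity), div_mul_eq_mul_div,
    div_le_iff₀ hm]
  exact mul_le_mul_of_nonneg_left (le_max_right _ _) hR.le

/-- The difference splits into `x - y` times a factor at most one, and the change of that factor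
applied to `y`. Each contributes at most `‖x - y‖`, hence the constant two. Composing with the
retraction makes a linear vector field bounded, so that Picard–Lindelöf works on the whole interval.
-/
theorem lipschitzWith_radialRetraction {R : ℝ} (hR : 0 < R) :
    LipschitzWith 2 (radialRetraction R : F → F) := by
  refine LipschitzWith.of_dist_le_mul fun x y => ?_
  rw [dist_eq_norm, dist_eq_norm]
  have hx : 0 < max R ‖x‖ := lt_max_of_lt_left hR
  have hy : 0 < max R ‖y‖ := lt_max_of_lt_left hR
  have e : radialRetraction R x - radialRetraction R y
      = (R / max R ‖x‖) • (x - y) + (R / max R ‖x‖ - R / max R ‖y‖) • y := by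
    simp only [radialRetraction, smul_sub, sub_smul]; abel
  have h1 : R / max R ‖x‖ ≤ 1 := by rw [div_le_one hx]; exact le_max_left _ _
  have h2 : ‖y‖ / max R ‖y‖ ≤ 1 := by rw [div_le_one hy]; exact le_max_right _ _
  have h3 : |max R ‖y‖ - max R ‖x‖| ≤ ‖x - y‖ := by
    calc |max R ‖y‖ - max R ‖x‖| ≤ |‖y‖ - ‖x‖| := by
          simpa using abs_max_sub_max_le_abs ‖y‖ ‖x‖ R |> (by simpa [max_comm] using ·)
      _ ≤ ‖y - x‖ := abs_norm_sub_norm_le _ _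
      _ = ‖x - y‖ := norm_sub_rev _ _
  have h4 : ‖(R / max R ‖x‖ - R / max R ‖y‖) • y‖ ≤ ‖x - y‖ := by
    have : R / max R ‖x‖ - R / max R ‖y‖
        = (max R ‖y‖ - max R ‖x‖) * (R / max R ‖x‖) / max R ‖y‖ := by
      field_simp
    rw [norm_smul, this, Real.norm_eq_abs, abs_div, abs_mul, abs_of_nonneg (by positivity :
      0 ≤ R / max R ‖x‖), abs_of_pos hy]
    calc |max R ‖y‖ - max R ‖x‖| * (R / max R ‖x‖) / max R ‖y‖ * ‖y‖
        = |max R ‖y‖ - max R ‖x‖| * (R / max R ‖x‖) * (‖y‖ / max R ‖y‖) := by ring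
      _ ≤ ‖x - y‖ * 1 * 1 := by gcongr
      _ = ‖x - y‖ := by ring
  calc ‖radialRetraction R x - radialRetraction R y‖
      ≤ ‖(R / max R ‖x‖) • (x - y)‖ + ‖(R / max R ‖x‖ - R / max R ‖y‖) • y‖ := by
        rw [e]; exact norm_add_le _ _
    _ ≤ 1 * ‖x - y‖ + ‖x - y‖ := by
        gcongr
        rw [norm_smul, Real.norm_of_nonneg (by positivity)]
        gcongr
    _ = ((2 : NNReal) : ℝ) * ‖x - y‖ := by push_cast; ring

/-- Global existence for affine linear ODEs on a compact interval, initial value on the left. -/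
theorem exists_linearODE_left [CompleteSpace F] {a b : ℝ} (hab : a ≤ b) {A : ℝ → F →L[ℝ] F}
    {g : ℝ → F} (hA : ContinuousOn A (Icc a b)) (hg : ContinuousOn g (Icc a b)) (x₀ : F) :
    ∃ x : ℝ → F, x a = x₀ ∧
      ∀ t ∈ Icc a b, HasDerivWithinAt x (A t (x t) + g t) (Icc a b) t := by
  obtain ⟨K, hK⟩ := isCompact_Icc.exists_bound_of_continuousOn hA
  obtain ⟨G, hG⟩ := isCompact_Icc.exists_bound_of_continuousOn hg
  have haI : a ∈ Icc a b := left_mem_Icc.2 hab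
  have hK0 : 0 ≤ K := (norm_nonneg _).trans (hK a haI)
  have hG0 : 0 ≤ G := (norm_nonneg _).trans (hG a haI)
  -- An a priori bound for the truncated equation: the retraction does not increase norms, so
  -- Grönwall applies as if it were absent. Its solution thus never leaves the ball of radius `R`,
  -- where the retraction is the identity.
  set R : ℝ := gronwallBound ‖x₀‖ K G (b - a) + 1 with hRdef
  have hmono := gronwallBound_mono (norm_nonneg x₀) hG0 hK0
  have hR : 0 < R := by
    have h0 : gronwallBound ‖x₀‖ K G 0 ≤ gronwallBound ‖x₀‖ K G (b - a) :=
      hmono (by linarith)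
    rw [gronwallBound_x0] at h0
    linarith [norm_nonneg x₀]
  let f : ℝ → F → F := fun t x => A t (radialRetraction R x) + g t
  have hfb : ∀ t ∈ Icc a b, ∀ x, ‖f t x‖ ≤ K * R + G := fun t ht x =>
    calc ‖f t x‖ ≤ ‖A t (radialRetraction R x)‖ + ‖g t‖ := norm_add_le _ _
      _ ≤ K * R + G := by
        gcongr
        · exact (A t).le_of_opNorm_le_of_le (hK t ht) (norm_radialRetraction_le hR x)
        · exact hG t ht
  -- The radius of the existence ball is the bound of the field times the length of the interval, so
  -- no restriction to short times arises.
  have hPL : IsPicardLindelof f (⟨a, haI⟩ : Icc a b) x₀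
      ((K * R + G) * (b - a)).toNNReal 0 (K * R + G).toNNReal (K.toNNReal * 2) := by
    refine ⟨fun t ht => ?_, fun x _ => ?_, fun t ht x _ => ?_, ?_⟩
    · have h1 : LipschitzWith K.toNNReal (A t) :=
        (A t).lipschitz.weaken (by
          rw [← norm_toNNReal]; exact Real.toNNReal_le_toNNReal (hK t ht))
      have h2 := (h1.comp (lipschitzWith_radialRetraction hR)).add (LipschitzWith.const (g t))
      simpa using h2.lipschitzOnWith
    · exact (hA.clm_apply continuousOn_const).add hg
    · rw [Real.coe_toNNReal _ (by positivity)]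
      exact hfb t ht x
    · have : 0 ≤ b - a := sub_nonneg.2 hab
      rw [Real.coe_toNNReal _ (by positivity), Real.coe_toNNReal _ (by positivity)]
      simp [hab]
  obtain ⟨x, hx0, hx⟩ := hPL.exists_eq_forall_mem_Icc_hasDerivWithinAt₀
  have hx0' : x a = x₀ := hx0
  refine ⟨x, hx0', fun t ht => ?_⟩
  have hbd : ‖x t‖ ≤ R := by
    have := norm_le_gronwallBound_of_norm_deriv_le (K := K) (ε := G) hx (fun s hs => by
      calc ‖f s (x s)‖ ≤ ‖A s (radialRetraction R (x s))‖ + ‖g s‖ := norm_add_le _ _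
        _ ≤ K * ‖x s‖ + G := by
          gcongr
          · exact (A s).le_of_opNorm_le_of_le (hK s hs) (norm_radialRetraction_le_norm hR _)
          · exact hG s hs) (by rw [hx0']) t ht
    have h2 : gronwallBound ‖x₀‖ K G (t - a) ≤ gronwallBound ‖x₀‖ K G (b - a) :=
      hmono (by linarith [ht.2])
    linarith
  have := hx t ht
  simp only [f, radialRetraction_of_norm_le hR hbd] at this
  exact this

/-- Global existence for affine linear ODEs on a compact interval, initial value on the right. -/
theorem exists_linearODE_right [CompleteSpace F] {a b : ℝ} (hab : a ≤ b) {A : ℝ → F →L[ℝ] F}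
    {g : ℝ → F} (hA : ContinuousOn A (Icc a b)) (hg : ContinuousOn g (Icc a b)) (x₀ : F) :
    ∃ x : ℝ → F, x b = x₀ ∧
      ∀ t ∈ Icc a b, HasDerivWithinAt x (A t (x t) + g t) (Icc a b) t := by
  have hm : MapsTo (fun t : ℝ => -t) (Icc (-b) (-a)) (Icc a b) :=
    fun t ht => ⟨by linarith [ht.2], by linarith [ht.1]⟩
  obtain ⟨y, hy0, hy⟩ := exists_linearODE_left (a := -b) (b := -a) (by linarith)
    (A := fun t => -A (-t)) (g := fun t => -g (-t))
    (hA.comp continuousOn_neg hm).neg (hg.comp continuousOn_neg hm).neg x₀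
  refine ⟨fun t => y (-t), hy0, fun t ht => ?_⟩
  have := hasDerivWithinAt_comp_neg (t := t)
    (hy (-t) ⟨by linarith [ht.2], by linarith [ht.1]⟩)
  simp only [neg_neg] at this
  convert this using 1
  simp only [neg_apply]
  abel

/-- Two solutions of the same affine linear ODE on `[a, b]` are compared at two times. -/
theorem norm_sub_le_of_linearODE {a b K : ℝ} {A : ℝ → F →L[ℝ] F} {g : ℝ → F}
    (hK : ∀ t ∈ Icc a b, ‖A t‖ ≤ K) {x y : ℝ → F}
    (hx : ∀ t ∈ Icc a b, HasDerivWithinAt x (A t (x t) + g t) (Icc a b) t)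
    (hy : ∀ t ∈ Icc a b, HasDerivWithinAt y (A t (y t) + g t) (Icc a b) t)
    {s t : ℝ} (hs : s ∈ Icc a b) (ht : t ∈ Icc a b) :
    ‖x t - y t‖ ≤ ‖x s - y s‖ * Real.exp (K * |t - s|) := by
  refine norm_le_mul_exp_abs (f := fun r => x r - y r) (f' := fun r => A r (x r - y r))
    (fun r hr => ?_) (fun r hr => (A r).le_of_opNorm_le (hK r hr) _) hs ht
  convert (hx r hr).fun_sub (hy r hr) using 1
  rw [map_sub]; abel

/-- A solution of `x' = A x + g` with zero initial value inherits exponential decay of rate larger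
than the bound on `A`. -/
theorem norm_le_mul_exp_of_linearODE {a b K G : ℝ} {A : ℝ → F →L[ℝ] F} {g : ℝ → F}
    (hK : ∀ t ∈ Icc a b, ‖A t‖ ≤ K) (hg : ∀ t ∈ Icc a b, ‖g t‖ ≤ G * Real.exp ((K + 1) * t))
    (hG : 0 ≤ G)
    {x : ℝ → F} (hx : ∀ t ∈ Icc a b, HasDerivWithinAt x (A t (x t) + g t) (Icc a b) t)
    (h0 : x a = 0) : ∀ t ∈ Icc a b, ‖x t‖ ≤ (G + 1) * Real.exp ((K + 1) * t) := by
  -- The barrier needs a strict inequality of derivatives: `K (G + 1) + G < (K + 1) (G + 1)`. This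
  -- is why `G` is enlarged by one.
  refine fun t ht => image_norm_le_of_norm_deriv_right_lt_deriv_boundary
    (f' := fun t => A t (x t) + g t) (B := fun t => (G + 1) * Real.exp ((K + 1) * t))
    (B' := fun t => (G + 1) * (Real.exp ((K + 1) * t) * (K + 1)))
    (fun t ht => (hx t ht).continuousWithinAt)
    (fun t ht => hasDerivWithinAt_Ici_of_Icc ht (hx t (Ico_subset_Icc_self ht)))
    (by rw [h0, norm_zero]; positivity) (fun t => ?_) (fun t ht h => ?_) ht
  · simpa using (((hasDerivAt_id t).const_mul (K + 1)).exp).const_mul (G + 1)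
  · have ht' := Ico_subset_Icc_self ht
    calc ‖A t (x t) + g t‖ ≤ K * ‖x t‖ + G * Real.exp ((K + 1) * t) :=
          (norm_add_le _ _).trans (add_le_add ((A t).le_of_opNorm_le (hK t ht') _) (hg t ht'))
      _ < _ := by
        rw [h]
        have := Real.exp_pos ((K + 1) * t)
        nlinarith

end LinearODE

/-! ### Uniform first and second order remainder estimates -/

section Remainder

variable {E : Type*} [NormedAddCommGroup E] [NormedSpace ℝ E]
  {G : Type*} [NormedAddCommGroup G] [NormedSpace ℝ G]

theorem exists_norm_sub_le_of_contDiff {f : E → G} (hf : ContDiff ℝ 1 f) {K : Set E}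
    (hK : IsCompact K) (hc : Convex ℝ K) :
    ∃ C, 0 ≤ C ∧ ∀ x ∈ K, ∀ y ∈ K, ‖f y - f x‖ ≤ C * ‖y - x‖ := by
  obtain ⟨C, hC⟩ := hK.exists_bound_of_continuousOn (hf.continuous_fderiv one_ne_zero).continuousOn
  refine ⟨max C 0, le_max_right _ _, fun x hx y hy => ?_⟩
  exact hc.norm_image_sub_le_of_norm_fderiv_le
    (fun z _ => (hf.differentiable one_ne_zero) z)
    (fun z hz => (hC z hz).trans (le_max_left _ _)) hx hy

/-- On the segment from `x` to `y` the derivative differs from its value at `x` by at most `C * ‖y -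
x‖`; the mean value inequality supplies the second factor. -/
theorem exists_norm_taylor_remainder_le {f : E → G} (hf : ContDiff ℝ 2 f) {K : Set E}
    (hK : IsCompact K) (hc : Convex ℝ K) :
    ∃ C, 0 ≤ C ∧ ∀ x ∈ K, ∀ y ∈ K, ‖f y - f x - fderiv ℝ f x (y - x)‖ ≤ C * ‖y - x‖ ^ 2 := by
  obtain ⟨C, hC0, hC⟩ := exists_norm_sub_le_of_contDiff
    (hf.fderiv_right (m := 1) (by norm_num)) hK hc
  refine ⟨C, hC0, fun x hx y hy => ?_⟩
  have hseg : segment ℝ x y ⊆ K := hc.segment_subset hx hy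
  have := (convex_segment x y).norm_image_sub_le_of_norm_hasFDerivWithin_le'
    (f := f) (f' := fderiv ℝ f) (φ := fderiv ℝ f x) (C := C * ‖y - x‖)
    (fun z _ => ((hf.differentiable two_ne_zero) z).hasFDerivAt.hasFDerivWithinAt)
    (fun z hz => (hC x hx z (hseg hz)).trans (by
      gcongr
      obtain ⟨a, b, ha, hb, hab, rfl⟩ := hz
      have : a • x + b • y - x = b • (y - x) := by
        rw [show a = 1 - b by linarith]; module
      rw [this, norm_smul, Real.norm_of_nonneg hb]
      exact mul_le_of_le_one_left (norm_nonneg _) (by linarith)))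
    (left_mem_segment ℝ x y) (right_mem_segment ℝ x y)
  calc _ ≤ C * ‖y - x‖ * ‖y - x‖ := this
    _ = _ := by ring

end Remainder

/-! ### The transport equation along a curve -/

section Solves

variable {E F : Type*} [NormedAddCommGroup F] [NormedSpace ℝ F]

/-- The curve `U` solves the linear equation `U' = -B U + v` along the curve `c`. -/
def SolvesAlong (B : E → F →L[ℝ] F) (v : E → F) (c : ℝ → E) (U : ℝ → F) (S : Set ℝ) : Prop :=
  ∀ t ∈ S, HasDerivWithinAt U (-(B (c t) (U t)) + v (c t)) S t

theorem SolvesAlong.mono {B : E → F →L[ℝ] F} {v : E → F} {c : ℝ → E} {U : ℝ → F} {S S' : Set ℝ}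
    (h : SolvesAlong B v c U S) (hS : S' ⊆ S) : SolvesAlong B v c U S' :=
  fun t ht => (h t (hS ht)).mono hS

end Solves

/-! ### The system satisfied by a solution and its derivative -/

section Derived

variable {E : Type*} [NormedAddCommGroup E] [NormedSpace ℝ E]
  {F : Type*} [NormedAddCommGroup F] [NormedSpace ℝ F]

/-- The coefficients of the linear system satisfied by a solution of `∂_X u + B u = v` together
with its derivative. -/
def derivedCoeff (X : E → E) (B : E → F →L[ℝ] F) (z : E) :
    (F × (E →L[ℝ] F)) →L[ℝ] (F × (E →L[ℝ] F)) :=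
  ((B z).comp (ContinuousLinearMap.fst ℝ F (E →L[ℝ] F))).prod
    (((ContinuousLinearMap.compL ℝ E F F (B z)).comp (ContinuousLinearMap.snd ℝ F (E →L[ℝ] F)) +
      ((ContinuousLinearMap.compL ℝ E E F).flip (fderiv ℝ X z)).comp
        (ContinuousLinearMap.snd ℝ F (E →L[ℝ] F))) +
      (fderiv ℝ B z).flip.comp (ContinuousLinearMap.fst ℝ F (E →L[ℝ] F)))

/-- Differentiating `∂_X u + B u = v` gives `∂_X (Du) + B ∘ Du + Du ∘ DX + (DB) u = Dv`. The second
component collects the zeroth order terms of this equation. -/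
theorem derivedCoeff_apply (X : E → E) (B : E → F →L[ℝ] F) (z : E) (a : F) (l : E →L[ℝ] F) :
    derivedCoeff X B z (a, l) =
      (B z a, (B z).comp l + l.comp (fderiv ℝ X z) + (fderiv ℝ B z).flip a) := rfl

/-- The source of the derived system. -/
def derivedSource (v : E → F) (z : E) : F × (E →L[ℝ] F) := (v z, fderiv ℝ v z)

theorem contDiff_derivedSource {v : E → F} (hv : ContDiff ℝ ∞ v) :
    ContDiff ℝ ∞ (derivedSource v) :=
  hv.prodMk (hv.fderiv_right (by simp))

theorem contDiff_derivedCoeff [FiniteDimensional ℝ E] [FiniteDimensional ℝ F] {X : E → E}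
    {B : E → F →L[ℝ] F} (hX : ContDiff ℝ ∞ X) (hB : ContDiff ℝ ∞ B) :
    ContDiff ℝ ∞ (derivedCoeff X B) := by
  rw [contDiff_clm_apply_iff]
  rintro ⟨a, l⟩
  simp only [derivedCoeff_apply]
  have hDX : ContDiff ℝ ∞ (fderiv ℝ X) := hX.fderiv_right (by simp)
  have hDB : ContDiff ℝ ∞ (fderiv ℝ B) := hB.fderiv_right (by simp)
  refine (hB.clm_apply contDiff_const).prodMk (((hB.clm_comp contDiff_const).add
    (contDiff_const.clm_comp hDX)).add ?_)
  rw [contDiff_clm_apply_iff]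
  intro e
  simp only [ContinuousLinearMap.flip_apply]
  exact (hDB.clm_apply contDiff_const).clm_apply contDiff_const

/-- A family of backward orbits of `X` on `[-T, 0]`, inside `K`, indexed by their end points. -/
def IsOrbitFamily (X : E → E) (K D : Set E) (T : ℝ) (γ : E → ℝ → E) : Prop :=
  ∀ y ∈ D, γ y 0 = y ∧ ∀ t ∈ Icc (-T) 0, γ y t ∈ K ∧
    HasDerivWithinAt (γ y) (X (γ y t)) (Icc (-T) 0) t

/-- The vector field on `E × F` describing simultaneously orbits and solutions along them. -/
def transportField (X : E → E) (B : E → F →L[ℝ] F) (v : E → F) (x : E × F) : E × F :=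
  (X x.1, -(B x.1 x.2) + v x.1)

theorem contDiff_transportField {X : E → E} {B : E → F →L[ℝ] F} {v : E → F}
    (hX : ContDiff ℝ ∞ X) (hB : ContDiff ℝ ∞ B) (hv : ContDiff ℝ ∞ v) :
    ContDiff ℝ ∞ (transportField X B v) :=
  (hX.comp contDiff_fst).prodMk
    ((((hB.comp contDiff_fst).clm_apply contDiff_snd).neg).add (hv.comp contDiff_fst))

theorem fderiv_transportField {X : E → E} {B : E → F →L[ℝ] F} {v : E → F}
    (hX : ContDiff ℝ ∞ X) (hB : ContDiff ℝ ∞ B) (hv : ContDiff ℝ ∞ v) (x h : E × F) :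
    fderiv ℝ (transportField X B v) x h =
      (fderiv ℝ X x.1 h.1, -(B x.1 h.2 + fderiv ℝ B x.1 h.1 x.2) + fderiv ℝ v x.1 h.1) := by
  have h1 := ((hX.differentiable (by simp)) x.1).hasFDerivAt.comp x (hasFDerivAt_fst (𝕜 := ℝ))
  have h2 := ((hB.differentiable (by simp)) x.1).hasFDerivAt.comp x (hasFDerivAt_fst (𝕜 := ℝ))
  have h3 := ((hv.differentiable (by simp)) x.1).hasFDerivAt.comp x (hasFDerivAt_fst (𝕜 := ℝ))
  have h4 := h1.prodMk ((h2.clm_apply (hasFDerivAt_snd (𝕜 := ℝ))).fun_neg.fun_add h3)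
  have : HasFDerivAt (transportField X B v) _ x := h4
  rw [this.fderiv]
  simp

end Derived

/-! ### Differentiable dependence on the end point in finite time -/

section FiniteTime

variable {E : Type*} [NormedAddCommGroup E] [NormedSpace ℝ E]
  {F : Type*} [NormedAddCommGroup F] [NormedSpace ℝ F]

/-- Grönwall with the Lipschitz constant of `X` on the convex compact `K`; the constant is the same
for all orbits. -/
theorem IsOrbitFamily.exists_dist_le {X : E → E} {K D : Set E} {T : ℝ} {γ : E → ℝ → E}
    (hX : ContDiff ℝ ∞ X) (hK : IsCompact K) (hKc : Convex ℝ K) (hT : 0 ≤ T)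
    (hγ : IsOrbitFamily X K D T γ) :
    ∃ C, 0 ≤ C ∧ ∀ y ∈ D, ∀ y' ∈ D, ∀ t ∈ Icc (-T) 0, ‖γ y' t - γ y t‖ ≤ C * ‖y' - y‖ := by
  obtain ⟨L, hL0, hL⟩ := exists_norm_sub_le_of_contDiff (hX.of_le (by simp)) hK hKc
  refine ⟨Real.exp (L * T), (Real.exp_pos _).le, fun y hy y' hy' t ht => ?_⟩
  have h0 : (0 : ℝ) ∈ Icc (-T) 0 := ⟨by linarith, le_rfl⟩
  have := norm_le_mul_exp_abs (f := fun t => γ y' t - γ y t) (K := L)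
    (f' := fun t => X (γ y' t) - X (γ y t))
    (fun t ht => ((hγ y' hy').2 t ht).2.fun_sub ((hγ y hy).2 t ht).2)
    (fun t ht => hL _ ((hγ y hy).2 t ht).1 _ ((hγ y' hy').2 t ht).1) h0 ht
  simp only [(hγ y hy).1, (hγ y' hy').1] at this
  calc _ ≤ ‖y' - y‖ * Real.exp (L * |t - 0|) := this
    _ ≤ ‖y' - y‖ * Real.exp (L * T) := by
      gcongr
      rw [sub_zero, abs_of_nonpos ht.2]
      linarith [ht.1]
    _ = _ := mul_comm _ _

/-- Linearity in `δ` and `ε` keeps the little-o initial error and the quadratic source apart in the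
next proof. -/
theorem gronwallBound_eq_linear {δ K ε x : ℝ} (hK : K ≠ 0) :
    gronwallBound δ K ε x = δ * Real.exp (K * x) + ε * ((Real.exp (K * x) - 1) / K) := by
  rw [gronwallBound_of_K_ne_0 hK]; ring

/-- Differentiability of the solution operator with respect to the end point of the orbit. -/
theorem hasFDerivAt_of_solvesAlong {X : E → E} {B : E → F →L[ℝ] F} {v : E → F}
    (hX : ContDiff ℝ ∞ X) (hB : ContDiff ℝ ∞ B) (hv : ContDiff ℝ ∞ v) [FiniteDimensional ℝ F]
    {K D : Set E} (hK : IsCompact K) (hKc : Convex ℝ K) (hD : IsOpen D) {T : ℝ} (hT : 0 ≤ T)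
    {γ : E → ℝ → E} (hγ : IsOrbitFamily X K D T γ) {U : E → ℝ → F}
    (hU : ∀ y ∈ D, SolvesAlong B v (γ y) (U y) (Icc (-T) 0)) {u₀ : E → F}
    (hU0 : ∀ y ∈ D, U y (-T) = u₀ (γ y (-T))) {y : E} (hy : y ∈ D)
    (hu₀ : DifferentiableAt ℝ u₀ (γ y (-T))) {W : ℝ → E →L[ℝ] F}
    (hW : SolvesAlong (derivedCoeff X B) (derivedSource v) (γ y) (fun t => (U y t, W t))
      (Icc (-T) 0))
    (hW0 : W (-T) = fderiv ℝ u₀ (γ y (-T))) :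
    HasFDerivAt (fun y => U y 0) (W 0) y := by
  have hT0 : (0 : ℝ) ∈ Icc (-T) 0 := ⟨by linarith, le_rfl⟩
  have hTT : -T ∈ Icc (-T) 0 := ⟨le_rfl, by linarith⟩
  obtain ⟨Cd, hCd0, hCd⟩ := hγ.exists_dist_le hX hK hKc hT
  obtain ⟨Kb', hKb'⟩ := hK.exists_bound_of_continuousOn hB.continuous.continuousOn
  obtain ⟨Gv, hGv⟩ := hK.exists_bound_of_continuousOn hv.continuous.continuousOn
  -- The maximum with one keeps the Grönwall rate away from zero, as `gronwallBound_eq_linear`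
  -- requires.
  set Kb : ℝ := max Kb' 1 with hKbdef
  have hKb1 : 1 ≤ Kb := le_max_right _ _
  have hKb : ∀ z ∈ K, ‖B z‖ ≤ Kb := fun z hz => (hKb' z hz).trans (le_max_left _ _)
  have hGv0 : 0 ≤ Gv := (norm_nonneg _).trans (hGv _ ((hγ y hy).2 0 hT0).1)
  -- The slack of one admits the initial values of all nearby orbits, so that `R` bounds their
  -- solutions uniformly.
  set δ₀ : ℝ := ‖u₀ (γ y (-T))‖ + 1
  set R : ℝ := gronwallBound δ₀ Kb Gv T
  have hUR : ∀ y' ∈ D, ‖u₀ (γ y' (-T))‖ ≤ δ₀ → ∀ t ∈ Icc (-T) 0, ‖U y' t‖ ≤ R := by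
    intro y' hy' hle t ht
    have := norm_le_gronwallBound_of_norm_deriv_le (f := U y') (K := Kb) (ε := Gv) (δ := δ₀)
      (hU y' hy') (fun s hs => by
        have hs' := ((hγ y' hy').2 s hs).1
        calc _ ≤ ‖B (γ y' s) (U y' s)‖ + ‖v (γ y' s)‖ := by
              simpa only [norm_neg] using norm_add_le (-(B (γ y' s) (U y' s))) (v (γ y' s))
          _ ≤ Kb * ‖U y' s‖ + Gv :=
              add_le_add ((B _).le_of_opNorm_le (hKb _ hs') _) (hGv _ hs'))
      (by rw [hU0 y' hy']; exact hle) t ht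
    refine this.trans (gronwallBound_mono (by positivity) hGv0 (by linarith) ?_)
    linarith [ht.2]
  -- Orbit and solution are treated as one curve of `transportField`. All relevant pairs lie in this
  -- convex compact set, where the Taylor remainder is uniformly quadratic.
  set K' : Set (E × F) := K ×ˢ Metric.closedBall (0 : F) R
  have hK' : IsCompact K' := hK.prod (isCompact_closedBall _ _)
  have hK'c : Convex ℝ K' := hKc.prod (convex_closedBall _ _)
  have hY := contDiff_transportField hX hB hv
  obtain ⟨L, hL0, hL⟩ := exists_norm_sub_le_of_contDiff (hY.of_le (by simp)) hK' hK'c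
  obtain ⟨Cq, hCq0, hCq⟩ := exists_norm_taylor_remainder_le
    (by exact_mod_cast contDiff_infty.1 hY 2) hK' hK'c
  obtain ⟨MW', hMW'⟩ := isCompact_Icc.exists_bound_of_continuousOn
    (fun t ht => (hW t ht).continuousWithinAt.snd : ContinuousOn W (Icc (-T) 0))
  set MW : ℝ := max MW' 0
  have hMW0 : 0 ≤ MW := le_max_right _ _
  have hMW : ∀ t ∈ Icc (-T) 0, ‖W t‖ ≤ MW := fun t ht => (hMW' t ht).trans (le_max_left _ _)
  -- behaviour at the initial time
  have hD' : ∀ᶠ y' in 𝓝 y, y' ∈ D := hD.mem_nhds hy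
  have hO : (fun y' => γ y' (-T) - γ y (-T)) =O[𝓝 y] fun y' => y' - y :=
    Asymptotics.IsBigO.of_bound Cd (by
      filter_upwards [hD'] with y' hy' using hCd y hy y' hy' _ hTT)
  have hcont : Tendsto (fun y' => γ y' (-T)) (𝓝 y) (𝓝 (γ y (-T))) := by
    have h1 : Tendsto (fun y' : E => y' - y) (𝓝 y) (𝓝 0) := tendsto_sub_nhds_zero_iff.2 tendsto_id
    have := (hO.trans_tendsto h1).add_const (γ y (-T))
    simpa using this
  have hr0 : (fun y' => u₀ (γ y' (-T)) - u₀ (γ y (-T)) -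
      fderiv ℝ u₀ (γ y (-T)) (γ y' (-T) - γ y (-T))) =o[𝓝 y] fun y' => y' - y :=
    (hu₀.hasFDerivAt.isLittleO.comp_tendsto hcont).trans_isBigO hO
  have hu0O : (fun y' => u₀ (γ y' (-T)) - u₀ (γ y (-T))) =O[𝓝 y] fun y' => y' - y :=
    (hu₀.hasFDerivAt.isBigO_sub.comp_tendsto hcont).trans hO
  obtain ⟨Cu, hCu0, hCu⟩ := hu0O.exists_nonneg
  have hnear : ∀ᶠ y' in 𝓝 y, ‖u₀ (γ y' (-T))‖ ≤ δ₀ := by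
    have := (hu₀.continuousAt.tendsto.comp hcont).norm
    filter_upwards [this.eventually_lt_const (lt_add_one _)] with y' h using h.le
  have hyR : ‖u₀ (γ y (-T))‖ ≤ δ₀ := by simp [δ₀]
  set c₁ : ℝ := Real.exp (Kb * T)
  set c₂ : ℝ := (1 + MW) * Cq * ((Cd + Cu) * Real.exp (L * T)) ^ 2 *
    ((Real.exp (Kb * T) - 1) / Kb)
  -- the main estimate
  have main : ∀ᶠ y' in 𝓝 y, ‖U y' 0 - U y 0 - W 0 (y' - y)‖ ≤
      ‖u₀ (γ y' (-T)) - u₀ (γ y (-T)) - fderiv ℝ u₀ (γ y (-T)) (γ y' (-T) - γ y (-T))‖ * c₁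
        + ‖y' - y‖ ^ 2 * c₂ := by
    filter_upwards [hD', hnear, hCu.bound] with y' hy' hn hCu'
    have hmem : ∀ t ∈ Icc (-T) 0, (γ y t, U y t) ∈ K' := fun t ht =>
      ⟨((hγ y hy).2 t ht).1, by simpa using hUR y hy hyR t ht⟩
    have hmem' : ∀ t ∈ Icc (-T) 0, (γ y' t, U y' t) ∈ K' := fun t ht =>
      ⟨((hγ y' hy').2 t ht).1, by simpa using hUR y' hy' hn t ht⟩
    have hδ : ∀ t ∈ Icc (-T) 0, ‖(γ y' t, U y' t) - (γ y t, U y t)‖ ≤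
        (Cd + Cu) * Real.exp (L * T) * ‖y' - y‖ := by
      intro t ht
      have := norm_le_mul_exp_abs (f := fun t => (γ y' t, U y' t) - (γ y t, U y t)) (K := L)
        (f' := fun t => transportField X B v (γ y' t, U y' t) -
          transportField X B v (γ y t, U y t))
        (fun t ht => (((hγ y' hy').2 t ht).2.prodMk (hU y' hy' t ht)).fun_sub
          (((hγ y hy).2 t ht).2.prodMk (hU y hy t ht)))
        (fun t ht => hL _ (hmem t ht) _ (hmem' t ht)) hTT ht
      have h1 : ‖(γ y' (-T), U y' (-T)) - (γ y (-T), U y (-T))‖ ≤ (Cd + Cu) * ‖y' - y‖ := by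
        rw [Prod.mk_sub_mk, hU0 y' hy', hU0 y hy, Prod.norm_mk]
        have h2 := hCd y hy y' hy' _ hTT
        have hn := norm_nonneg (y' - y)
        refine max_le ?_ ?_ <;> nlinarith
      have h3 : |t - -T| ≤ T := by
        rw [abs_of_nonneg (by linarith [ht.1])]; linarith [ht.2]
      calc _ ≤ _ := this
        _ ≤ (Cd + Cu) * ‖y' - y‖ * Real.exp (L * T) := by gcongr
        _ = _ := by ring
    -- The error of the linear approximation at time `t`. The derived system for `W` cancels all
    -- first order terms, so `r` solves the homogeneous equation up to the Taylor remainder `q`.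
    set r : ℝ → F := fun t => U y' t - U y t - W t (γ y' t - γ y t) with hr
    set q : ℝ → E × F := fun t => transportField X B v (γ y' t, U y' t) -
      transportField X B v (γ y t, U y t) - fderiv ℝ (transportField X B v) (γ y t, U y t)
        ((γ y' t, U y' t) - (γ y t, U y t)) with hq
    have hrd : ∀ t ∈ Icc (-T) 0, HasDerivWithinAt r
        (-(B (γ y t) (r t)) + ((q t).2 - W t (q t).1)) (Icc (-T) 0) t := by
      intro t ht
      have hWt : HasDerivWithinAt W _ (Icc (-T) 0) t := (hW t ht).snd
      have hd := ((hγ y' hy').2 t ht).2.fun_sub ((hγ y hy).2 t ht).2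
      have h1 := ((hU y' hy' t ht).fun_sub (hU y hy t ht)).fun_sub (hWt.clm_apply hd)
      convert h1 using 1
      simp only [hr, hq, fderiv_transportField hX hB hv, derivedCoeff_apply, derivedSource,
        transportField, Prod.fst_sub, Prod.snd_sub, Prod.neg_mk, Prod.mk_add_mk, map_sub,
        add_apply, neg_apply, sub_apply,
        ContinuousLinearMap.comp_apply,
        ContinuousLinearMap.flip_apply]
      abel
    have hqb : ∀ t ∈ Icc (-T) 0, ‖q t‖ ≤ Cq * ((Cd + Cu) * Real.exp (L * T) * ‖y' - y‖) ^ 2 :=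
      fun t ht => (hCq _ (hmem t ht) _ (hmem' t ht)).trans (by gcongr; exact hδ t ht)
    have hgr := norm_le_gronwallBound_of_norm_deriv_le (K := Kb)
      (ε := (1 + MW) * (Cq * ((Cd + Cu) * Real.exp (L * T) * ‖y' - y‖) ^ 2)) hrd
      (fun t ht => by
        have h1 : ‖B (γ y t) (r t)‖ ≤ Kb * ‖r t‖ :=
          (B _).le_of_opNorm_le (hKb _ ((hγ y hy).2 t ht).1) _
        have h2 : ‖W t (q t).1‖ ≤ MW * ‖q t‖ :=
          ((W t).le_of_opNorm_le (hMW t ht) _).trans (by gcongr; exact norm_fst_le _)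
        have h3 : ‖(q t).2‖ ≤ ‖q t‖ := norm_snd_le _
        calc _ ≤ ‖B (γ y t) (r t)‖ + (‖(q t).2‖ + ‖W t (q t).1‖) := by
              refine (norm_add_le _ _).trans ?_
              rw [norm_neg]
              gcongr
              exact norm_sub_le _ _
          _ ≤ Kb * ‖r t‖ + (1 + MW) * ‖q t‖ := by linarith
          _ ≤ _ := by
              gcongr
              exact hqb t ht) le_rfl 0 hT0
    have e0 : r 0 = U y' 0 - U y 0 - W 0 (y' - y) := by simp [hr, (hγ y hy).1, (hγ y' hy').1]
    have eT : r (-T) = u₀ (γ y' (-T)) - u₀ (γ y (-T)) -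
        fderiv ℝ u₀ (γ y (-T)) (γ y' (-T) - γ y (-T)) := by
      simp [hr, hU0 y hy, hU0 y' hy', hW0]
    rw [gronwallBound_eq_linear (by linarith), e0, eT, zero_sub, neg_neg] at hgr
    refine hgr.trans (le_of_eq ?_)
    simp only [c₁, c₂]
    ring
  rw [hasFDerivAt_iff_isLittleO]
  have hs : (fun y' => ‖y' - y‖ ^ 2 * c₂) =o[𝓝 y] fun y' => y' - y := by
    have h1 : (fun y' => ‖y' - y‖ ^ 2) =o[𝓝 y] fun y' => y' - y := by
      have := Asymptotics.isLittleO_norm_pow_id (E' := E) one_lt_two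
      have ht : Tendsto (fun y' : E => y' - y) (𝓝 y) (𝓝 0) :=
        tendsto_sub_nhds_zero_iff.2 tendsto_id
      exact this.comp_tendsto ht
    simpa [mul_comm] using h1.const_mul_left c₂
  have hf : (fun y' => ‖u₀ (γ y' (-T)) - u₀ (γ y (-T)) -
      fderiv ℝ u₀ (γ y (-T)) (γ y' (-T) - γ y (-T))‖ * c₁) =o[𝓝 y] fun y' => y' - y := by
    simpa [mul_comm] using hr0.norm_left.const_mul_left c₁
  refine Asymptotics.IsBigO.trans_isLittleO (Asymptotics.IsBigO.of_bound 1 ?_) (hf.add hs)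
  filter_upwards [main] with y' h
  rw [one_mul]
  exact h.trans (le_abs_self _)

end FiniteTime

/-! ### Solvability and uniqueness along a given curve -/

section Existence

variable {E : Type*} [NormedAddCommGroup E] {F : Type*} [NormedAddCommGroup F] [NormedSpace ℝ F]

theorem exists_solvesAlong_left [CompleteSpace F] {B : E → F →L[ℝ] F} {v : E → F}
    (hB : Continuous B) (hv : Continuous v)
    {a b : ℝ} (hab : a ≤ b) {c : ℝ → E} (hc : ContinuousOn c (Icc a b)) (x₀ : F) :
    ∃ U, U a = x₀ ∧ SolvesAlong B v c U (Icc a b) :=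
  exists_linearODE_left hab (A := fun t => -B (c t)) (g := fun t => v (c t))
    (hB.comp_continuousOn hc).neg (hv.comp_continuousOn hc) x₀

theorem SolvesAlong.eqOn_of_mem {B : E → F →L[ℝ] F} {v : E → F} (hB : Continuous B)
    {a b : ℝ} {c : ℝ → E} (hc : ContinuousOn c (Icc a b)) {U U' : ℝ → F}
    (hU : SolvesAlong B v c U (Icc a b)) (hU' : SolvesAlong B v c U' (Icc a b))
    {s : ℝ} (hs : s ∈ Icc a b) (h : U s = U' s) : EqOn U U' (Icc a b) := by
  intro t ht
  obtain ⟨K, hK⟩ := isCompact_Icc.exists_bound_of_continuousOn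
    ((hB.comp_continuousOn hc).neg : ContinuousOn (fun t => -B (c t)) (Icc a b))
  have := norm_sub_le_of_linearODE hK hU hU' hs ht
  simpa [h, sub_eq_zero] using this

end Existence

/-! ### Smooth dependence on the end point in finite time -/

section FiniteSmooth

theorem IsOrbitFamily.continuousOn {E : Type*} [NormedAddCommGroup E] [NormedSpace ℝ E]
    {X : E → E} {K D : Set E} {T : ℝ} {γ : E → ℝ → E}
    (hγ : IsOrbitFamily X K D T γ) {y : E} (hy : y ∈ D) : ContinuousOn (γ y) (Icc (-T) 0) :=
  fun t ht => ((hγ y hy).2 t ht).2.continuousWithinAt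

variable {E : Type u} [NormedAddCommGroup E] [NormedSpace ℝ E] [FiniteDimensional ℝ E]

/-- The derived system is solved from the value and derivative of `u₀`. By uniqueness its first
component is `U`, so its second component is the `W` that `hasFDerivAt_of_solvesAlong` asks for. -/
theorem exists_solvesAlong_derived {F : Type*} [NormedAddCommGroup F]
    [NormedSpace ℝ F] [FiniteDimensional ℝ F] {X : E → E} {B : E → F →L[ℝ] F} {v : E → F}
    (hX : ContDiff ℝ ∞ X) (hB : ContDiff ℝ ∞ B) (hv : ContDiff ℝ ∞ v)
    {K D : Set E} (hK : IsCompact K) (hKc : Convex ℝ K) (hD : IsOpen D) {T : ℝ} (hT : 0 ≤ T)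
    {γ : E → ℝ → E} (hγ : IsOrbitFamily X K D T γ) {U : E → ℝ → F}
    (hU : ∀ y ∈ D, SolvesAlong B v (γ y) (U y) (Icc (-T) 0)) {u₀ : E → F}
    (hu₀ : ∀ y ∈ D, DifferentiableAt ℝ u₀ (γ y (-T)))
    (hU0 : ∀ y ∈ D, U y (-T) = u₀ (γ y (-T))) :
    ∃ W : E → ℝ → F × (E →L[ℝ] F), ∀ y ∈ D,
      W y (-T) = (u₀ (γ y (-T)), fderiv ℝ u₀ (γ y (-T))) ∧
      SolvesAlong (derivedCoeff X B) (derivedSource v) (γ y) (W y) (Icc (-T) 0) ∧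
      HasFDerivAt (fun y => U y 0) (W y 0).2 y := by
  have : ∀ y, ∃ W : ℝ → F × (E →L[ℝ] F), y ∈ D →
      W (-T) = (u₀ (γ y (-T)), fderiv ℝ u₀ (γ y (-T))) ∧
      SolvesAlong (derivedCoeff X B) (derivedSource v) (γ y) W (Icc (-T) 0) := by
    intro y
    by_cases hy : y ∈ D
    · obtain ⟨W, h⟩ := exists_solvesAlong_left (contDiff_derivedCoeff hX hB).continuous
        (contDiff_derivedSource hv).continuous (by linarith : -T ≤ 0) (hγ.continuousOn hy)
        (u₀ (γ y (-T)), fderiv ℝ u₀ (γ y (-T)))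
      exact ⟨W, fun _ => h⟩
    · exact ⟨0, fun h => absurd h hy⟩
  choose W hW using this
  refine ⟨W, fun y hy => ⟨(hW y hy).1, (hW y hy).2, ?_⟩⟩
  have h1 : EqOn (fun t => (W y t).1) (U y) (Icc (-T) 0) :=
    SolvesAlong.eqOn_of_mem hB.continuous (hγ.continuousOn hy)
      (fun t ht => ((hW y hy).2 t ht).fst) (hU y hy) (left_mem_Icc.2 (by linarith))
      (by simp [(hW y hy).1, hU0 y hy])
  have h2 : EqOn (fun t => (U y t, (W y t).2)) (W y) (Icc (-T) 0) :=
    fun s hs => by simp [← h1 hs]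
  refine hasFDerivAt_of_solvesAlong hX hB hv hK hKc hD hT hγ hU hU0 hy (hu₀ y hy)
    (W := fun t => (W y t).2) (fun t ht => ?_) (by simp [(hW y hy).1])
  rw [h2 ht]
  exact ((hW y hy).2 t ht).congr_of_mem h2 ht

/-- The derivative is a component of a solution of the derived system, which is a problem of the
same type with fibre `F × (E →L[ℝ] F)`. The induction therefore varies `F`, and the universe `max u
w` is chosen so that the new fibre stays inside it. -/
theorem contDiffOn_nat_of_solvesAlong (k : ℕ) : ∀ {F : Type (max u w)} [NormedAddCommGroup F]
    [NormedSpace ℝ F] [FiniteDimensional ℝ F] {X : E → E} {B : E → F →L[ℝ] F} {v : E → F}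
    (_ : ContDiff ℝ ∞ X) (_ : ContDiff ℝ ∞ B) (_ : ContDiff ℝ ∞ v)
    {K D O : Set E} (_ : IsCompact K) (_ : Convex ℝ K) (_ : IsOpen D) {T : ℝ} (_ : 0 ≤ T)
    {γ : E → ℝ → E} (_ : IsOrbitFamily X K D T γ) {U : E → ℝ → F}
    (_ : ∀ y ∈ D, SolvesAlong B v (γ y) (U y) (Icc (-T) 0)) {u₀ : E → F}
    (_ : IsOpen O) (_ : ContDiffOn ℝ ∞ u₀ O) (_ : ∀ y ∈ D, γ y (-T) ∈ O)
    (_ : ∀ y ∈ D, U y (-T) = u₀ (γ y (-T))),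
    ContDiffOn ℝ k (fun y => U y 0) D := by
  induction k with
  | zero =>
    intro F _ _ _ X B v hX hB hv K D O hK hKc hD T hT γ hγ U hU u₀ hO hu₀ hγO hU0
    obtain ⟨W, hW⟩ := exists_solvesAlong_derived hX hB hv hK hKc hD hT hγ hU (fun y hy =>
      (hu₀.contDiffAt (hO.mem_nhds (hγO y hy))).differentiableAt (by simp)) hU0
    exact contDiffOn_zero.2 fun y hy => (hW y hy).2.2.continuousAt.continuousWithinAt
  | succ k ih =>
    intro F _ _ _ X B v hX hB hv K D O hK hKc hD T hT γ hγ U hU u₀ hO hu₀ hγO hU0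
    obtain ⟨W, hW⟩ := exists_solvesAlong_derived hX hB hv hK hKc hD hT hγ hU (fun y hy =>
      (hu₀.contDiffAt (hO.mem_nhds (hγO y hy))).differentiableAt (by simp)) hU0
    have hs := ih (F := F × (E →L[ℝ] F)) hX (contDiff_derivedCoeff hX hB)
      (contDiff_derivedSource hv) hK hKc hD hT hγ (U := W) (fun y hy => (hW y hy).2.1) hO
      (u₀ := fun z => (u₀ z, fderiv ℝ u₀ z))
      (hu₀.prodMk (hu₀.fderiv_of_isOpen hO (by simp))) hγO (fun y hy => (hW y hy).1)
    rw [Nat.cast_add, Nat.cast_one, contDiffOn_succ_iff_fderiv_of_isOpen hD]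
    refine ⟨fun y hy => (hW y hy).2.2.differentiableAt.differentiableWithinAt, by simp, ?_⟩
    exact hs.snd.congr fun y hy => (hW y hy).2.2.fderiv

/-- Smooth dependence of solutions of linear transport equations on the end point of the orbit. -/
theorem contDiffOn_of_solvesAlong {F : Type (max u w)} [NormedAddCommGroup F]
    [NormedSpace ℝ F] [FiniteDimensional ℝ F] {X : E → E} {B : E → F →L[ℝ] F} {v : E → F}
    (hX : ContDiff ℝ ∞ X) (hB : ContDiff ℝ ∞ B) (hv : ContDiff ℝ ∞ v)
    {K D O : Set E} (hK : IsCompact K) (hKc : Convex ℝ K) (hD : IsOpen D) {T : ℝ} (hT : 0 ≤ T)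
    {γ : E → ℝ → E} (hγ : IsOrbitFamily X K D T γ) {U : E → ℝ → F}
    (hU : ∀ y ∈ D, SolvesAlong B v (γ y) (U y) (Icc (-T) 0)) {u₀ : E → F}
    (hO : IsOpen O) (hu₀ : ContDiffOn ℝ ∞ u₀ O) (hγO : ∀ y ∈ D, γ y (-T) ∈ O)
    (hU0 : ∀ y ∈ D, U y (-T) = u₀ (γ y (-T))) :
    ContDiffOn ℝ ∞ (fun y => U y 0) D :=
  contDiffOn_infty.2 fun k =>
    contDiffOn_nat_of_solvesAlong k hX hB hv hK hKc hD hT hγ hU hO hu₀ hγO hU0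

end FiniteSmooth

/-! ### Flat functions and powers of the distance -/

section Flat

variable {E : Type*} [NormedAddCommGroup E] [NormedSpace ℝ E]
  {F : Type*} [NormedAddCommGroup F] [NormedSpace ℝ F]

/-- A smooth function all of whose derivatives vanish at `z₀` is bounded by all powers of the
distance to `z₀`, together with its derivatives. -/
theorem exists_norm_iteratedFDeriv_le_pow [FiniteDimensional ℝ E] {v : E → F}
    (hv : ContDiff ℝ ∞ v) {z₀ : E} (hflat : ∀ k, iteratedFDeriv ℝ k v z₀ = 0) (R : ℝ) (N : ℕ) :
    ∀ k : ℕ, ∃ C, 0 ≤ C ∧ ∀ z ∈ Metric.closedBall z₀ R,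
      ‖iteratedFDeriv ℝ k v z‖ ≤ C * ‖z - z₀‖ ^ N := by
  induction N with
  | zero =>
    intro k
    obtain ⟨C, hC⟩ := (isCompact_closedBall z₀ R).exists_bound_of_continuousOn
      (hv.continuous_iteratedFDeriv (m := k) (by exact_mod_cast le_top)).continuousOn
    refine ⟨max C 0, le_max_right _ _, fun z hz => ?_⟩
    rw [pow_zero, mul_one]
    exact (hC z hz).trans (le_max_left _ _)
  | succ N ih =>
    intro k
    -- The derivative of order `k` vanishes at `z₀`, so the mean value inequality on the ball of
    -- radius `‖z - z₀‖` trades one more derivative for one more power. This forces the induction on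
    -- `N` to treat all `k` together.
    obtain ⟨C, hC0, hC⟩ := ih (k + 1)
    refine ⟨C, hC0, fun z hz => ?_⟩
    have hsub : Metric.closedBall z₀ ‖z - z₀‖ ⊆ Metric.closedBall z₀ R :=
      Metric.closedBall_subset_closedBall (by simpa [dist_eq_norm] using hz)
    have := (convex_closedBall z₀ ‖z - z₀‖).norm_image_sub_le_of_norm_fderiv_le
      (f := iteratedFDeriv ℝ k v) (C := C * ‖z - z₀‖ ^ N)
      (fun x _ => hv.differentiable_iteratedFDeriv (by exact_mod_cast ENat.natCast_lt_top k) x)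
      (fun x hx => by
        rw [norm_fderiv_iteratedFDeriv]
        refine (hC x (hsub hx)).trans ?_
        gcongr
        simpa [dist_eq_norm] using hx)
      (Metric.mem_closedBall_self (norm_nonneg _)) (y := z) (by simp [dist_eq_norm])
    rw [hflat k, sub_zero] at this
    rwa [pow_succ, ← mul_assoc]

theorem exists_norm_le_pow_of_flat [FiniteDimensional ℝ E] {v : E → F}
    (hv : ContDiff ℝ ∞ v) {z₀ : E} (hflat : ∀ k, iteratedFDeriv ℝ k v z₀ = 0) (R : ℝ) (N : ℕ) :
    ∃ C, 0 ≤ C ∧ ∀ z ∈ Metric.closedBall z₀ R, ‖v z‖ ≤ C * ‖z - z₀‖ ^ N := by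
  obtain ⟨C, hC0, hC⟩ := exists_norm_iteratedFDeriv_le_pow hv hflat R N 0
  exact ⟨C, hC0, fun z hz => by simpa using hC z hz⟩

/-- Flatness survives passage to the derived system; this keeps the regularity bootstrap going. -/
theorem iteratedFDeriv_derivedSource_eq_zero {v : E → F} (hv : ContDiff ℝ ∞ v) {z₀ : E}
    (hflat : ∀ k, iteratedFDeriv ℝ k v z₀ = 0) (k : ℕ) :
    iteratedFDeriv ℝ k (derivedSource v) z₀ = 0 := by
  have hDv : ContDiff ℝ ∞ (fderiv ℝ v) := hv.fderiv_right (by simp)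
  have h1 : iteratedFDeriv ℝ k (fderiv ℝ v) z₀ = 0 := by
    rw [← norm_eq_zero, norm_iteratedFDeriv_fderiv, hflat, norm_zero]
  have h2 := iteratedFDeriv_prodMk (i := k) hv.contDiffAt (x := z₀) hDv.contDiffAt
    (by exact_mod_cast le_top)
  change iteratedFDeriv ℝ k (fun z => (v z, fderiv ℝ v z)) z₀ = 0
  rw [h2, hflat, h1]
  rfl

end Flat

/-! ### Decaying solutions on a half-line -/

section DecayingCurve

variable {F : Type*} [NormedAddCommGroup F] [NormedSpace ℝ F]

theorem hasDerivWithinAt_Iic_shift {f : ℝ → F} {f' : F} {s t : ℝ} (ht : t ≤ 0)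
    (h : HasDerivWithinAt f f' (Iic 0) (t + s)) :
    HasDerivWithinAt (fun r => f (t + r)) f' (Iic 0) s := by
  have := h.scomp s ((hasDerivAt_id s).const_add t).hasDerivWithinAt (s := Iic 0)
    (fun r (hr : r ≤ 0) => by simp; linarith)
  rw [one_smul] at this
  exact this

/-- Existence for affine linear ODEs on `(-∞, 0]`. -/
theorem exists_linearODE_Iic [CompleteSpace F] {A : ℝ → F →L[ℝ] F} {g : ℝ → F}
    (hA : ContinuousOn A (Iic 0)) (hg : ContinuousOn g (Iic 0)) (x₀ : F) :
    ∃ x : ℝ → F, x 0 = x₀ ∧ ∀ t ≤ 0, HasDerivWithinAt x (A t (x t) + g t) (Iic 0) t := by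
  have hsub : ∀ n : ℕ, Icc (-(n : ℝ)) 0 ⊆ Iic 0 := fun n => Icc_subset_Iic_self
  choose V hV0 hV using fun n : ℕ => exists_linearODE_right (a := -(n : ℝ)) (b := 0) (by simp)
    (hA.mono (hsub n)) (hg.mono (hsub n)) x₀
  have agree : ∀ n m : ℕ, n ≤ m → ∀ t ∈ Icc (-(n : ℝ)) 0, V n t = V m t := by
    intro n m hnm t ht
    have hnm' : Icc (-(n : ℝ)) 0 ⊆ Icc (-(m : ℝ)) 0 :=
      Icc_subset_Icc_left (by simpa using hnm)
    obtain ⟨K, hK⟩ := isCompact_Icc.exists_bound_of_continuousOn (hA.mono (hsub n))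
    have := norm_sub_le_of_linearODE hK (hV n) (fun s hs => (hV m s (hnm' hs)).mono hnm')
      (right_mem_Icc.2 (by simp)) ht
    simpa [hV0, sub_eq_zero] using this
  -- The index is the least natural number `n` with `-n ≤ t`; agreement on overlaps makes the choice
  -- harmless.
  let V' : ℝ → F := fun t => V ⌈-t⌉₊ t
  have hV' : ∀ m : ℕ, EqOn V' (V m) (Icc (-(m : ℝ)) 0) := by
    intro m t ht
    refine agree _ _ (Nat.ceil_le.2 (by linarith [ht.1])) t ⟨?_, ht.2⟩
    linarith [Nat.le_ceil (-t)]
  refine ⟨V', by simp [V', hV0], fun t ht => ?_⟩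
  obtain ⟨m, hm⟩ := exists_nat_gt (-t)
  have htm : t ∈ Icc (-(m : ℝ)) 0 := ⟨by linarith, ht⟩
  have hmem : Icc (-(m : ℝ)) 0 ∈ 𝓝[Iic 0] t := by
    rw [← Ici_inter_Iic]
    exact inter_mem (mem_nhdsWithin_of_mem_nhds (Ici_mem_nhds (by linarith))) self_mem_nhdsWithin
  rw [hV' m htm]
  exact ((hV m t htm).congr_of_mem (hV' m) htm).mono_of_mem_nhdsWithin hmem

theorem exp_neg_nat_tendsto (C : ℝ) :
    Tendsto (fun n : ℕ => C * Real.exp (-(n : ℝ))) atTop (𝓝 0) := by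
  have := (Real.tendsto_exp_neg_atTop_nhds_zero.comp tendsto_natCast_atTop_atTop).const_mul C
  simpa using this

/-- Existence of a decaying solution of an affine linear ODE on `(-∞, 0]`. -/
theorem exists_decaying_linearODE [CompleteSpace F] {A : ℝ → F →L[ℝ] F} {g : ℝ → F}
    (hA : ContinuousOn A (Iic 0)) (hg : ContinuousOn g (Iic 0)) {K G : ℝ} (hG : 0 ≤ G)
    (hK : ∀ t ≤ 0, ‖A t‖ ≤ K) (hgG : ∀ t ≤ 0, ‖g t‖ ≤ G * Real.exp ((K + 1) * t)) :
    ∃ x : ℝ → F, (∀ t ≤ 0, HasDerivWithinAt x (A t (x t) + g t) (Iic 0) t) ∧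
      ∀ t ≤ 0, ‖x t‖ ≤ (G + 1) * Real.exp ((K + 1) * t) := by
  have hsub : ∀ n : ℕ, Icc (-(n : ℝ)) 0 ⊆ Iic 0 := fun n => Icc_subset_Iic_self
  choose U hU0 hU using fun n : ℕ => exists_linearODE_left (a := -(n : ℝ)) (b := 0) (by simp)
    (hA.mono (hsub n)) (hg.mono (hsub n)) 0
  have hUb : ∀ n : ℕ, ∀ t ∈ Icc (-(n : ℝ)) 0, ‖U n t‖ ≤ (G + 1) * Real.exp ((K + 1) * t) :=
    fun n => norm_le_mul_exp_of_linearODE (fun t ht => hK t ht.2) (fun t ht => hgG t ht.2) hG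
      (hU n) (hU0 n)
  -- The solutions starting from zero at `-n` and at `-m` differ at time `-n` by at most `(G + 1) *
  -- exp (-(K + 1) n)`. Growth up to time zero costs `exp (K n)`, which leaves `exp (-n)`.
  have hcauchy : CauchySeq fun n => U n 0 := by
    refine cauchySeq_of_le_tendsto_0' (fun n : ℕ => (G + 1) * Real.exp (-(n : ℝ)))
      (fun n m hnm => ?_) (exp_neg_nat_tendsto _)
    have hnm' : Icc (-(n : ℝ)) 0 ⊆ Icc (-(m : ℝ)) 0 :=
      Icc_subset_Icc_left (by simpa using hnm)
    have hn : -(n : ℝ) ∈ Icc (-(n : ℝ)) 0 := left_mem_Icc.2 (by simp)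
    have := norm_sub_le_of_linearODE (fun t ht => hK t ht.2) (hU n)
      (fun s hs => (hU m s (hnm' hs)).mono hnm') hn (right_mem_Icc.2 (by simp))
    rw [dist_eq_norm]
    refine this.trans ?_
    rw [hU0, zero_sub, norm_neg, zero_sub, neg_neg, abs_of_nonneg (Nat.cast_nonneg n)]
    calc _ ≤ (G + 1) * Real.exp ((K + 1) * (-(n : ℝ))) * Real.exp (K * n) := by
          gcongr
          exact hUb m _ (hnm' hn)
      _ = _ := by rw [mul_assoc, ← Real.exp_add]; ring_nf
  obtain ⟨a, ha⟩ := cauchySeq_tendsto_of_complete hcauchy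
  -- The limit of the values at time zero is used as final value. At each fixed time the decay bound
  -- then passes to the limit.
  obtain ⟨x, hx0, hx⟩ := exists_linearODE_Iic hA hg a
  refine ⟨x, hx, fun t ht => ?_⟩
  have hlim : Tendsto (fun n => ‖x 0 - U n 0‖ * Real.exp (K * |t - 0|) +
      (G + 1) * Real.exp ((K + 1) * t)) atTop (𝓝 ((G + 1) * Real.exp ((K + 1) * t))) := by
    have h1 : Tendsto (fun n => ‖x 0 - U n 0‖) atTop (𝓝 0) := by
      have := (tendsto_const_nhds (x := x 0)).sub ha
      rw [hx0, sub_self] at this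
      simpa [hx0] using this.norm
    simpa using (h1.mul_const _).add_const ((G + 1) * Real.exp ((K + 1) * t))
  refine ge_of_tendsto hlim ?_
  obtain ⟨m, hm⟩ := exists_nat_gt (-t)
  filter_upwards [eventually_ge_atTop m] with n hn
  have hnm : (m : ℝ) ≤ n := by exact_mod_cast hn
  have htn : t ∈ Icc (-(n : ℝ)) 0 := ⟨by linarith, ht⟩
  have h1 := norm_sub_le_of_linearODE (fun t ht => hK t ht.2)
    (fun s hs => (hx s hs.2).mono (hsub n)) (hU n) (right_mem_Icc.2 (by simp)) htn
  have h2 := hUb n t htn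
  calc ‖x t‖ = ‖(x t - U n t) + U n t‖ := by rw [sub_add_cancel]
    _ ≤ _ := (norm_add_le _ _).trans (add_le_add h1 h2)

/-- A solution of a linear differential inequality decaying faster than the coefficients grow
vanishes. -/
theorem eq_zero_of_decaying {f f' : ℝ → F} {K C b : ℝ}
    (hf : ∀ t ≤ b, HasDerivWithinAt f (f' t) (Iic b) t)
    (hK : ∀ t ≤ b, ‖f' t‖ ≤ K * ‖f t‖)
    (hC : ∀ t ≤ b, ‖f t‖ ≤ C * Real.exp ((K + 1) * t)) {t : ℝ} (ht : t ≤ b) : f t = 0 := by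
  rw [← norm_le_zero_iff]
  have hlim : Tendsto (fun n : ℕ => C * Real.exp ((K + 1) * t) * Real.exp (-(n : ℝ))) atTop (𝓝 0) :=
    exp_neg_nat_tendsto _
  refine ge_of_tendsto' hlim fun n => ?_
  have hn : t - n ≤ t := by simp
  have hsub : Icc (t - n) t ⊆ Iic b := Icc_subset_Iic_self.trans (Iic_subset_Iic.2 ht)
  -- Propagation from `t - n` to `t` costs `exp (K n)`, while the decay there gains `exp (-(K + 1)
  -- n)`.
  have := norm_right_le_mul_exp hn (fun s hs => (hf s (hsub hs)).mono hsub)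
    (fun s hs => hK s (hsub hs))
  calc ‖f t‖ ≤ _ := this
    _ ≤ C * Real.exp ((K + 1) * (t - n)) * Real.exp (K * (t - (t - n))) := by
      gcongr
      exact hC _ (hn.trans ht)
    _ = _ := by rw [mul_assoc, mul_assoc, ← Real.exp_add, ← Real.exp_add]; ring_nf

/-- The two solutions may carry different bounds for `B`. The smaller one still bounds `B`, and both
decay estimates weaken to the rate it prescribes because time is nonpositive. -/
theorem eqOn_of_decaying {E : Type*} {B : E → F →L[ℝ] F} {v : E → F} {c : ℝ → E} {K : Set E} (hcK : ∀ t ≤ 0, c t ∈ K)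
    {x x' : ℝ → F} (hx : SolvesAlong B v c x (Iic 0))
    (hx' : SolvesAlong B v c x' (Iic 0)) {k k' C C' : ℝ} (hk : ∀ z ∈ K, ‖B z‖ ≤ k)
    (hk' : ∀ z ∈ K, ‖B z‖ ≤ k') (hC : ∀ t ≤ 0, ‖x t‖ ≤ C * Real.exp ((k + 1) * t))
    (hC' : ∀ t ≤ 0, ‖x' t‖ ≤ C' * Real.exp ((k' + 1) * t)) {t : ℝ} (ht : t ≤ 0) : x t = x' t := by
  have hC0 : 0 ≤ C := nonneg_of_mul_nonneg_left ((norm_nonneg _).trans (hC t ht)) (Real.exp_pos _)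
  have hC0' : 0 ≤ C' :=
    nonneg_of_mul_nonneg_left ((norm_nonneg _).trans (hC' t ht)) (Real.exp_pos _)
  rw [← sub_eq_zero]
  refine eq_zero_of_decaying (f := fun t => x t - x' t)
    (f' := fun t => -(B (c t) (x t - x' t))) (K := min k k') (C := C + C') (b := 0)
    (fun s hs => ?_) (fun s hs => ?_) (fun s hs => ?_) ht
  · convert (hx s hs).fun_sub (hx' s hs) using 1
    rw [map_sub]; abel
  · rw [norm_neg]
    exact (B _).le_of_opNorm_le (le_min (hk _ (hcK s hs)) (hk' _ (hcK s hs))) _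
  · rw [add_mul]
    refine (norm_sub_le _ _).trans (add_le_add ((hC s hs).trans ?_) ((hC' s hs).trans ?_))
    · gcongr _ * Real.exp ?_
      nlinarith [min_le_left k k']
    · gcongr _ * Real.exp ?_
      nlinarith [min_le_right k k']

end DecayingCurve

/-! ### Smooth flat solutions for a contracted family of orbits -/

section InfiniteTime

variable {E : Type u} [NormedAddCommGroup E] [NormedSpace ℝ E]

/-- A family of backward orbits of `X` in the open set `D`, indexed by their end points and
exponentially contracted to `z₀`. -/
structure IsContractedFamily (X : E → E) (K D : Set E) (z₀ : E) (γ : E → ℝ → E) : Prop where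
  isOpen : IsOpen D
  mem : z₀ ∈ D
  subset : D ⊆ K
  isCompact : IsCompact K
  convex : Convex ℝ K
  apply_zero : ∀ y ∈ D, γ y 0 = y
  mapsTo : ∀ y ∈ D, ∀ t ≤ 0, γ y t ∈ D
  hasDeriv : ∀ y ∈ D, ∀ t ≤ 0, HasDerivWithinAt (γ y) (X (γ y t)) (Iic 0) t
  semigroup : ∀ y ∈ D, ∀ t ≤ 0, ∀ s ≤ 0, γ (γ y t) s = γ y (t + s)
  contract : ∃ C ε, 0 ≤ C ∧ 0 < ε ∧ ∀ y ∈ D, ∀ t ≤ 0,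
    ‖γ y t - z₀‖ ≤ C * ‖y - z₀‖ * Real.exp (ε * t)

variable {X : E → E} {K D : Set E} {z₀ : E} {γ : E → ℝ → E}

theorem IsContractedFamily.isOrbitFamily (h : IsContractedFamily X K D z₀ γ) (T : ℝ) :
    IsOrbitFamily X K D T γ := fun y hy => ⟨h.apply_zero y hy, fun t ht =>
  ⟨h.subset (h.mapsTo y hy t ht.2), (h.hasDeriv y hy t ht.2).mono Icc_subset_Iic_self⟩⟩

theorem IsContractedFamily.continuousOn (h : IsContractedFamily X K D z₀ γ) {y : E} (hy : y ∈ D) :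
    ContinuousOn (γ y) (Iic 0) := fun t ht => (h.hasDeriv y hy t ht).continuousWithinAt

theorem IsContractedFamily.apply_center (h : IsContractedFamily X K D z₀ γ) {t : ℝ} (ht : t ≤ 0) :
    γ z₀ t = z₀ := by
  obtain ⟨C, ε, -, -, hC⟩ := h.contract
  have := hC z₀ h.mem t ht
  rw [sub_self, norm_zero, mul_zero, zero_mul, norm_le_zero_iff, sub_eq_zero] at this
  exact this

theorem exp_pow_decay {C x a ε κ t : ℝ} (hx : x ≤ C * Real.exp (ε * t)) (hx0 : 0 ≤ x) {N : ℕ}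
    (hN : κ ≤ N * ε) (ht : t ≤ 0) (ha : 0 ≤ a) (hC : 0 ≤ C) :
    a * x ^ N ≤ a * C ^ N * Real.exp (κ * t) := by
  calc a * x ^ N ≤ a * (C * Real.exp (ε * t)) ^ N := by gcongr
    _ = a * C ^ N * Real.exp (N * ε * t) := by
      rw [mul_pow, ← Real.exp_nat_mul]; ring_nf
    _ ≤ _ := by
      gcongr ?_ * Real.exp ?_
      exact mul_le_mul_of_nonpos_right hN ht

/-- Flatness bounds `v` by the `N`-th power of the distance to `z₀`, which contracts at rate `ε`.
Any `N ≥ κ / ε` gives the rate `κ`. -/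
theorem IsContractedFamily.exists_norm_le_exp [FiniteDimensional ℝ E]
    (h : IsContractedFamily X K D z₀ γ)
    {F : Type*} [NormedAddCommGroup F] [NormedSpace ℝ F] {v : E → F} (hv : ContDiff ℝ ∞ v)
    (hflat : ∀ k, iteratedFDeriv ℝ k v z₀ = 0) (κ : ℝ) :
    ∃ G, 0 ≤ G ∧ ∀ y ∈ D, ∀ t ≤ 0, ‖v (γ y t)‖ ≤ G * Real.exp (κ * t) := by
  obtain ⟨C, ε, hC0, hε, hC⟩ := h.contract
  obtain ⟨R, hR⟩ := h.isCompact.isBounded.subset_closedBall z₀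
  obtain ⟨N, hN⟩ := exists_nat_ge (κ / ε)
  obtain ⟨a, ha0, ha⟩ := exists_norm_le_pow_of_flat hv hflat R N
  have hR0 : 0 ≤ R := by simpa using (hR (h.subset h.mem))
  refine ⟨a * (C * R) ^ N, by positivity, fun y hy t ht => ?_⟩
  refine (ha _ (hR (h.subset (h.mapsTo y hy t ht)))).trans ?_
  refine exp_pow_decay ((hC y hy t ht).trans ?_) (norm_nonneg _) ((div_le_iff₀ hε).1 hN) ht ha0
    (by positivity)
  gcongr
  simpa [dist_eq_norm] using hR (h.subset hy)

/-- `u` is a solution of `∂_X u + B u = v` along the orbits, decaying along the orbits faster than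
the coefficient `B` can make it grow. -/
structure IsDecayingSolution {F : Type*} [NormedAddCommGroup F] [NormedSpace ℝ F]
    (B : E → F →L[ℝ] F) (v : E → F) (K D : Set E) (γ : E → ℝ → E) (u : E → F) : Prop where
  solves : ∀ y ∈ D, SolvesAlong B v (γ y) (fun t => u (γ y t)) (Iic 0)
  decay : ∃ k C, (∀ z ∈ K, ‖B z‖ ≤ k) ∧
    ∀ y ∈ D, ∀ t ≤ 0, ‖u (γ y t)‖ ≤ C * Real.exp ((k + 1) * t)

/-- Let `u y` be the value at time zero of the decaying solution along the orbit of `y`. By the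
semigroup property, shifting that solution gives a decaying solution along the orbit of `γ y t`;
uniqueness identifies the two, so `u` restricts to the chosen solution on every orbit. -/
theorem IsContractedFamily.exists_isDecayingSolution [FiniteDimensional ℝ E]
    (h : IsContractedFamily X K D z₀ γ) {F : Type*} [NormedAddCommGroup F] [NormedSpace ℝ F]
    [CompleteSpace F] {B : E → F →L[ℝ] F} {v : E → F} (hB : ContDiff ℝ ∞ B) (hv : ContDiff ℝ ∞ v)
    (hflat : ∀ k, iteratedFDeriv ℝ k v z₀ = 0) :
    ∃ u, IsDecayingSolution B v K D γ u := by
  obtain ⟨k, hk⟩ := h.isCompact.exists_bound_of_continuousOn hB.continuous.continuousOn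
  obtain ⟨G, hG0, hG⟩ := h.exists_norm_le_exp hv hflat (k + 1)
  have : ∀ y, ∃ x : ℝ → F, y ∈ D → SolvesAlong B v (γ y) x (Iic 0) ∧
      ∀ t ≤ 0, ‖x t‖ ≤ (G + 1) * Real.exp ((k + 1) * t) := by
    intro y
    by_cases hy : y ∈ D
    · obtain ⟨x, hx, hx'⟩ := exists_decaying_linearODE
        (A := fun t => -B (γ y t)) (g := fun t => v (γ y t))
        (hB.continuous.comp_continuousOn (h.continuousOn hy)).neg
        (hv.continuous.comp_continuousOn (h.continuousOn hy)) hG0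
        (fun t ht => by rw [norm_neg]; exact hk _ (h.subset (h.mapsTo y hy t ht)))
        (hG y hy)
      exact ⟨x, fun _ => ⟨hx, hx'⟩⟩
    · exact ⟨0, fun h => absurd h hy⟩
  choose x hx using this
  have key : ∀ y ∈ D, ∀ t ≤ 0, x (γ y t) 0 = x y t := by
    intro y hy t ht
    have hy' := h.mapsTo y hy t ht
    have hsh : ∀ s ≤ 0, γ (γ y t) s = γ y (t + s) := h.semigroup y hy t ht
    have h1 : SolvesAlong B v (γ (γ y t)) (fun s => x y (t + s)) (Iic 0) := by
      intro s hs
      have hs0 : s ≤ 0 := hs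
      rw [hsh s hs]
      exact hasDerivWithinAt_Iic_shift ht ((hx y hy).1 (t + s) (by simp; linarith))
    have := eqOn_of_decaying (fun t ht => h.subset (h.mapsTo _ hy' t ht)) (hx _ hy').1 h1 hk hk
      (hx _ hy').2 (C' := (G + 1) * Real.exp ((k + 1) * t)) (fun s hs => by
        refine ((hx y hy).2 (t + s) (by linarith)).trans (le_of_eq ?_)
        rw [mul_assoc, ← Real.exp_add]; ring_nf) le_rfl
    simpa using this
  refine ⟨fun y => x y 0, fun y hy t ht => ?_, k, G + 1, hk, fun y hy t ht => ?_⟩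
  · simp only [key y hy t ht]
    exact ((hx y hy).1 t ht).congr_of_mem (fun s hs => key y hy s hs) ht
  · simp only [key y hy t ht]
    exact (hx y hy).2 t ht

theorem IsDecayingSolution.eqOn (h : IsContractedFamily X K D z₀ γ) {F : Type*}
    [NormedAddCommGroup F] [NormedSpace ℝ F] {B : E → F →L[ℝ] F} {v u u' : E → F}
    (hu : IsDecayingSolution B v K D γ u) (hu' : IsDecayingSolution B v K D γ u') :
    EqOn u u' D := by
  intro y hy
  obtain ⟨k, C, hk, hC⟩ := hu.decay
  obtain ⟨k', C', hk', hC'⟩ := hu'.decay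
  have := eqOn_of_decaying (fun t ht => h.subset (h.mapsTo y hy t ht)) (hu.solves y hy)
    (hu'.solves y hy) hk hk' (hC y hy) (hC' y hy) le_rfl
  simpa [h.apply_zero y hy] using this

/-- The orbit of `z₀` is constant, so the decay bound for the value there can be taken at
arbitrarily early times. -/
theorem IsDecayingSolution.apply_center (h : IsContractedFamily X K D z₀ γ) {F : Type*}
    [NormedAddCommGroup F] [NormedSpace ℝ F] {B : E → F →L[ℝ] F} {v u : E → F}
    (hu : IsDecayingSolution B v K D γ u) : u z₀ = 0 := by
  obtain ⟨k, C, hk, hC⟩ := hu.decay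
  have hk0 : 0 ≤ k := (norm_nonneg _).trans (hk _ (h.subset h.mem))
  have hC0 : 0 ≤ C := nonneg_of_mul_nonneg_left
    ((norm_nonneg _).trans (hC z₀ h.mem 0 le_rfl)) (Real.exp_pos _)
  rw [← norm_le_zero_iff]
  refine ge_of_tendsto' (exp_neg_nat_tendsto C) fun n => ?_
  have hn : -(n : ℝ) ≤ 0 := by simp
  have := hC z₀ h.mem (-n) hn
  rw [h.apply_center hn] at this
  refine this.trans ?_
  gcongr
  nlinarith [(Nat.cast_nonneg n : (0 : ℝ) ≤ n)]

/-- `B` is a diagonal block of the derived coefficient. Decay at the rate suited to the derived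
system is therefore also fast enough for the original equation. -/
theorem norm_le_norm_derivedCoeff {F : Type*} [NormedAddCommGroup F] [NormedSpace ℝ F]
    (X : E → E) (B : E → F →L[ℝ] F) (z : E) : ‖B z‖ ≤ ‖derivedCoeff X B z‖ := by
  refine (B z).opNorm_le_bound (derivedCoeff X B z).opNorm_nonneg fun a => ?_
  have h1 := (derivedCoeff X B z).le_opNorm (a, 0)
  have h2 : ‖B z a‖ ≤ ‖derivedCoeff X B z (a, 0)‖ := norm_fst_le (derivedCoeff X B z (a, 0))
  simpa [Prod.norm_mk] using h2.trans h1

/-- The decaying solution is differentiable, and together with its derivative it is the decaying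
solution of the derived system. -/
theorem IsDecayingSolution.exists_derived [FiniteDimensional ℝ E]
    (h : IsContractedFamily X K D z₀ γ) {F : Type*}
    [NormedAddCommGroup F] [NormedSpace ℝ F] [FiniteDimensional ℝ F]
    {B : E → F →L[ℝ] F} {v u : E → F} (hX : ContDiff ℝ ∞ X)
    (hB : ContDiff ℝ ∞ B) (hv : ContDiff ℝ ∞ v) (hflat : ∀ k, iteratedFDeriv ℝ k v z₀ = 0)
    (hu : IsDecayingSolution B v K D γ u) :
    ∃ w, IsDecayingSolution (derivedCoeff X B) (derivedSource v) K D γ w ∧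
      ∀ y ∈ D, HasFDerivAt u (w y).2 y := by
  have hB' := contDiff_derivedCoeff hX hB
  have hv' := contDiff_derivedSource hv
  obtain ⟨w, hw⟩ := h.exists_isDecayingSolution hB' hv' (iteratedFDeriv_derivedSource_eq_zero hv hflat)
  refine ⟨w, hw, ?_⟩
  obtain ⟨k, C, hk, hC⟩ := hw.decay
  have hw1 : IsDecayingSolution B v K D γ (fun z => (w z).1) := by
    refine ⟨fun y hy t ht => (hw.solves y hy t ht).fst, k, C, fun z hz =>
      (norm_le_norm_derivedCoeff X B z).trans (hk z hz), fun y hy t ht =>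
      (norm_fst_le _).trans (hC y hy t ht)⟩
  have huw : EqOn u (fun z => (w z).1) D := hu.eqOn h hw1
  -- Approximation by solutions that vanish at time `-n`. Finite-time theory shows that their values
  -- at time zero are differentiable in `y`.
  have hU : ∀ n : ℕ, ∀ y, ∃ x : ℝ → F, y ∈ D → x (-(n : ℝ)) = 0 ∧
      SolvesAlong B v (γ y) x (Icc (-(n : ℝ)) 0) := by
    intro n y
    by_cases hy : y ∈ D
    · obtain ⟨x, hx⟩ := exists_solvesAlong_left hB.continuous hv.continuous
        (by simp : -(n : ℝ) ≤ 0) ((h.continuousOn hy).mono Icc_subset_Iic_self) 0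
      exact ⟨x, fun _ => hx⟩
    · exact ⟨0, fun h => absurd h hy⟩
  choose U hU using hU
  have hW := fun n : ℕ => exists_solvesAlong_derived hX hB hv h.isCompact h.convex h.isOpen
    (Nat.cast_nonneg n) (h.isOrbitFamily n) (U := U n) (fun y hy => (hU n y hy).2)
    (u₀ := fun _ => 0) (fun y _ => differentiableAt_const _) (fun y hy => (hU n y hy).1)
  choose W hW using hW
  -- Both solve the derived system, and at time `-n` they differ by the value of `w`. The rate `k +
  -- 1` against `k` leaves `exp (-n)`, uniformly on `D`, so values and derivatives both converge.
  have hest : ∀ n : ℕ, ∀ y ∈ D, ‖W n y 0 - w y‖ ≤ C * Real.exp (-(n : ℝ)) := by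
    intro n y hy
    have hsub : Icc (-(n : ℝ)) 0 ⊆ Iic 0 := Icc_subset_Iic_self
    have hn : -(n : ℝ) ≤ 0 := by simp
    have := norm_sub_le_of_linearODE (A := fun t => -derivedCoeff X B (γ y t))
      (g := fun t => derivedSource v (γ y t)) (K := k)
      (fun t ht => by rw [norm_neg]; exact hk _ (h.subset (h.mapsTo y hy t ht.2)))
      (hW n y hy).2.1 ((hw.solves y hy).mono hsub) (left_mem_Icc.2 hn) (right_mem_Icc.2 hn)
    rw [(hW n y hy).1, h.apply_zero y hy] at this
    refine this.trans ?_
    have h0 : ((0 : F), fderiv ℝ (fun _ : E => (0 : F)) (γ y (-(n : ℝ)))) = 0 := by simp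
    rw [h0, zero_sub, norm_neg, zero_sub, neg_neg, abs_of_nonneg (Nat.cast_nonneg n)]
    calc _ ≤ C * Real.exp ((k + 1) * (-(n : ℝ))) * Real.exp (k * n) := by
          gcongr
          exact hC y hy _ hn
      _ = _ := by rw [mul_assoc, ← Real.exp_add]; ring_nf
  have hfst : ∀ n, ∀ y ∈ D, (W n y 0).1 = U n y 0 := fun n y hy =>
    SolvesAlong.eqOn_of_mem hB.continuous ((h.continuousOn hy).mono Icc_subset_Iic_self)
      (fun t ht => ((hW n y hy).2.1 t ht).fst) (hU n y hy).2 (left_mem_Icc.2 (by simp))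
      (by simp [(hW n y hy).1, (hU n y hy).1]) (right_mem_Icc.2 (by simp))
  intro y hy
  refine hasFDerivAt_of_tendstoUniformlyOn (f := fun n y => U n y 0) (f' := fun n y => (W n y 0).2)
    (g' := fun y => (w y).2) (l := atTop) h.isOpen ?_ (fun n y hy => (hW n y hy).2.2) ?_ hy
  · rw [Metric.tendstoUniformlyOn_iff]
    intro ε hε
    filter_upwards [(exp_neg_nat_tendsto C).eventually_lt_const hε] with n hn y hy
    rw [dist_comm, dist_eq_norm]
    exact ((norm_snd_le (W n y 0 - w y)).trans (hest n y hy)).trans_lt hn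
  · intro y hy
    rw [tendsto_iff_norm_sub_tendsto_zero]
    refine squeeze_zero (fun _ => norm_nonneg _) (fun n => ?_) (exp_neg_nat_tendsto C)
    rw [huw hy, ← hfst n y hy]
    exact (norm_fst_le (W n y 0 - w y)).trans (hest n y hy)

/-- Bootstrap through `IsDecayingSolution.exists_derived`: each derivative is a component of a
decaying solution of an iterated derived system. Such solutions vanish at `z₀`, which yields
flatness along with smoothness. -/
theorem IsDecayingSolution.contDiffOn_nat [FiniteDimensional ℝ E]
    (h : IsContractedFamily X K D z₀ γ) (hX : ContDiff ℝ ∞ X) (n : ℕ) : ∀ {F : Type (max u w)}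
    [NormedAddCommGroup F] [NormedSpace ℝ F] [FiniteDimensional ℝ F]
    {B : E → F →L[ℝ] F} {v u : E → F}
    (_ : ContDiff ℝ ∞ B) (_ : ContDiff ℝ ∞ v) (_ : ∀ k, iteratedFDeriv ℝ k v z₀ = 0)
    (_ : IsDecayingSolution B v K D γ u),
    ContDiffOn ℝ n u D ∧ ∀ j ≤ n, iteratedFDeriv ℝ j u z₀ = 0 := by
  have hzero : ∀ {F : Type (max u w)} [NormedAddCommGroup F] [NormedSpace ℝ F] {u : E → F},
      u z₀ = 0 → iteratedFDeriv ℝ 0 u z₀ = 0 := by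
    intro F _ _ u hu
    rw [← norm_eq_zero, norm_iteratedFDeriv_zero, hu, norm_zero]
  induction n with
  | zero =>
    intro F _ _ _ B v u hB hv hflat hu
    obtain ⟨w, hw, hd⟩ := hu.exists_derived h hX hB hv hflat
    refine ⟨contDiffOn_zero.2 fun y hy => (hd y hy).continuousAt.continuousWithinAt,
      fun j hj => ?_⟩
    obtain rfl : j = 0 := by omega
    exact hzero (hu.apply_center h)
  | succ n ih =>
    intro F _ _ _ B v u hB hv hflat hu
    obtain ⟨w, hw, hd⟩ := hu.exists_derived h hX hB hv hflat
    obtain ⟨hs, hj⟩ := ih (F := F × (E →L[ℝ] F)) (contDiff_derivedCoeff hX hB)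
      (contDiff_derivedSource hv) (iteratedFDeriv_derivedSource_eq_zero hv hflat) hw
    constructor
    · rw [Nat.cast_add, Nat.cast_one, contDiffOn_succ_iff_fderiv_of_isOpen h.isOpen]
      refine ⟨fun y hy => (hd y hy).differentiableAt.differentiableWithinAt, by simp, ?_⟩
      exact hs.snd.congr fun y hy => (hd y hy).fderiv
    · rintro (_ | j) hjn
      · exact hzero (hu.apply_center h)
      · rw [← norm_eq_zero, ← norm_iteratedFDeriv_fderiv, norm_eq_zero]
        have he : fderiv ℝ u =ᶠ[𝓝 z₀] (ContinuousLinearMap.snd ℝ F (E →L[ℝ] F)) ∘ w := by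
          filter_upwards [h.isOpen.mem_nhds h.mem] with y hy using (hd y hy).fderiv
        rw [(Filter.EventuallyEq.iteratedFDeriv ℝ he j).self_of_nhds, ContinuousLinearMap.iteratedFDeriv_comp_left _
          (hs.contDiffAt (h.isOpen.mem_nhds h.mem)) (by exact_mod_cast Nat.le_of_succ_le_succ hjn),
          hj j (Nat.le_of_succ_le_succ hjn)]
        ext
        simp

/-- The decaying solution of a smooth transport equation with flat source is smooth and flat. -/
theorem IsContractedFamily.exists_smooth_flat_solution [FiniteDimensional ℝ E]
    (h : IsContractedFamily X K D z₀ γ) (hX : ContDiff ℝ ∞ X) {F : Type (max u w)}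
    [NormedAddCommGroup F] [NormedSpace ℝ F] [FiniteDimensional ℝ F]
    {B : E → F →L[ℝ] F} {v : E → F}
    (hB : ContDiff ℝ ∞ B) (hv : ContDiff ℝ ∞ v) (hflat : ∀ k, iteratedFDeriv ℝ k v z₀ = 0) :
    ∃ u : E → F, ContDiffOn ℝ ∞ u D ∧ (∀ k, iteratedFDeriv ℝ k u z₀ = 0) ∧
      ∀ y ∈ D, SolvesAlong B v (γ y) (fun t => u (γ y t)) (Iic 0) := by
  obtain ⟨u, hu⟩ := h.exists_isDecayingSolution hB hv hflat
  have key := fun n => hu.contDiffOn_nat h hX n hB hv hflat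
  exact ⟨u, contDiffOn_infty.2 fun n => (key n).1, fun k => (key k).2 k le_rfl, hu.solves⟩

end InfiniteTime

/-! ### A Lyapunov form from the spectral condition -/

section Lyapunov

/-- Gelfand's formula, with `ρ` chosen between the spectral radius and one. -/
theorem eventually_norm_pow_le_of_spectrum {A : Type*} [NormedRing A] [NormedAlgebra ℂ A]
    [CompleteSpace A] [Nontrivial A] {a : A} (h : ∀ z ∈ spectrum ℂ a, ‖z‖ < 1) :
    ∃ ρ : ℝ, 0 < ρ ∧ ρ < 1 ∧ ∀ᶠ n : ℕ in atTop, ‖a ^ n‖ ≤ ρ ^ n := by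
  have h1 : spectralRadius ℂ a < ((1 : NNReal) : ENNReal) :=
    spectrum.spectralRadius_lt_of_forall_lt a (fun z hz => by exact_mod_cast h z hz)
  obtain ⟨ρ, hρ1, hρ2⟩ := ENNReal.lt_iff_exists_nnreal_btwn.1 h1
  have hρ0 : 0 < ρ := pos_iff_ne_zero.2 (by rintro rfl; simp at hρ1)
  refine ⟨ρ, by exact_mod_cast hρ0, by exact_mod_cast hρ2, ?_⟩
  have := (spectrum.pow_nnnorm_pow_one_div_tendsto_nhds_spectralRadius a).eventually_lt_const hρ1
  filter_upwards [this, eventually_gt_atTop 0] with n hn hn0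
  have hn' : (0 : ℝ) < n := by exact_mod_cast hn0
  have h2 := ENNReal.rpow_le_rpow hn.le hn'.le
  rw [← ENNReal.rpow_mul, one_div, inv_mul_cancel₀ hn'.ne', ENNReal.rpow_one,
    ENNReal.rpow_natCast] at h2
  exact_mod_cast h2

theorem spectrum_one_sub_smul {A : Type*} [Ring A] [Algebra ℂ A] {m : A} {c : ℂ} (hc : c ≠ 0)
    {z : ℂ} (hz : z ∈ spectrum ℂ (1 - c • m)) : (1 - z) / c ∈ spectrum ℂ m := by
  rw [spectrum.mem_iff] at hz ⊢
  intro hu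
  apply hz
  have h1 : IsUnit (algebraMap ℂ A (-c)) := (IsUnit.mk0 (-c) (neg_ne_zero.2 hc)).map _
  have h2 := h1.mul hu
  convert h2 using 1
  rw [mul_sub, ← map_mul, show -c * ((1 - z) / c) = z - 1 by field_simp; ring, map_sub, map_one,
    ← Algebra.smul_def, neg_smul]
  abel

theorem exists_norm_apply_le_of_finiteDimensional {A G : Type*} [NormedAddCommGroup A]
    [NormedSpace ℝ A] [FiniteDimensional ℝ A] [NormedAddCommGroup G] [NormedSpace ℝ G]
    (P : A →ₗ[ℝ] G) : ∃ C, 0 ≤ C ∧ ∀ x, ‖P x‖ ≤ C * ‖x‖ :=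
  ⟨‖LinearMap.toContinuousLinearMap P‖, norm_nonneg _,
    (LinearMap.toContinuousLinearMap P).le_opNorm⟩

theorem exists_norm_one_sub_div_lt_one {s : Set ℂ} (hs : s.Finite) (h : ∀ μ ∈ s, 0 < μ.re) :
    ∃ R : ℝ, 0 < R ∧ ∀ μ ∈ s, ‖1 - (R : ℂ)⁻¹ * μ‖ < 1 := by
  obtain ⟨R, hR⟩ := (hs.image fun μ : ℂ => ‖μ‖ ^ 2 / (2 * μ.re)).bddAbove
  refine ⟨max R 0 + 1, by positivity, fun μ hμ => ?_⟩
  have hR1 : 0 < max R 0 + 1 := by positivity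
  have h1 : ‖μ‖ ^ 2 / (2 * μ.re) < max R 0 + 1 :=
    (hR (mem_image_of_mem _ hμ)).trans_lt ((le_max_left _ _).trans_lt (lt_add_one _))
  rw [div_lt_iff₀ (by linarith [h μ hμ])] at h1
  generalize max R 0 + 1 = r at *
  have h2 : ‖1 - (r : ℂ)⁻¹ * μ‖ ^ 2 < 1 := by
    rw [← Complex.normSq_eq_norm_sq, Complex.normSq_apply, ← Complex.ofReal_inv]
    simp only [Complex.sub_re, Complex.one_re, Complex.re_ofReal_mul, Complex.sub_im,
      Complex.one_im, Complex.im_ofReal_mul]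
    rw [← Complex.normSq_eq_norm_sq, Complex.normSq_apply] at h1
    have e : (1 - r⁻¹ * μ.re) * (1 - r⁻¹ * μ.re) + (0 - r⁻¹ * μ.im) * (0 - r⁻¹ * μ.im)
        = 1 + r⁻¹ ^ 2 * ((μ.re * μ.re + μ.im * μ.im) - r * (2 * μ.re)) := by
      field_simp; ring
    rw [e]
    have : 0 < r⁻¹ ^ 2 := by positivity
    nlinarith
  nlinarith [norm_nonneg (1 - (r : ℂ)⁻¹ * μ)]

variable {E : Type*} [NormedAddCommGroup E] [NormedSpace ℝ E] [FiniteDimensional ℝ E]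

open scoped Matrix.Norms.Operator in
-- The spectrum of the complexified matrix consists of the roots of the characteristic polynomial,
-- so Gelfand's formula applies to it. The bound returns to `E` through the real-linear map taking
-- real parts, which sends powers of the complex matrix to powers of the operator; its norm is the
-- constant `C`.
theorem exists_norm_pow_one_sub_smul_le [Nontrivial E] {L : E →L[ℝ] E}
    (h : ∀ μ : ℂ, (L.toLinearMap.charpoly.map (algebraMap ℝ ℂ)).IsRoot μ → 0 < μ.re) :
    ∃ R ρ C : ℝ, 0 < R ∧ 0 < ρ ∧ ρ < 1 ∧
      ∀ᶠ n : ℕ in atTop, ‖((1 : E →L[ℝ] E) - R⁻¹ • L) ^ n‖ ≤ C * ρ ^ n := by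
  classical
  let bE := Module.finBasis ℝ E
  let d := Module.finrank ℝ E
  have : Nonempty (Fin d) := ⟨⟨0, Module.finrank_pos⟩⟩
  let m : Matrix (Fin d) (Fin d) ℝ := LinearMap.toMatrix bE bE L.toLinearMap
  let mC : Matrix (Fin d) (Fin d) ℂ := m.map (algebraMap ℝ ℂ)
  have hm : mC.charpoly = L.toLinearMap.charpoly.map (algebraMap ℝ ℂ) := by
    rw [Matrix.charpoly_map, LinearMap.charpoly_toMatrix]
  have hspec : ∀ μ ∈ spectrum ℂ mC, 0 < μ.re := fun μ hμ => h μ (by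
    rw [← hm]; exact Matrix.mem_spectrum_iff_isRoot_charpoly.1 hμ)
  have hfin : (spectrum ℂ mC).Finite := by
    refine (Polynomial.finite_setOfPred_isRoot (Matrix.charpoly_monic mC).ne_zero).subset fun μ hμ => ?_
    exact Matrix.mem_spectrum_iff_isRoot_charpoly.1 hμ
  obtain ⟨R, hR0, hR⟩ := exists_norm_one_sub_div_lt_one hfin hspec
  have hRC : ((R : ℂ)⁻¹) ≠ 0 := inv_ne_zero (by exact_mod_cast hR0.ne')
  have hQ : ∀ z ∈ spectrum ℂ (1 - (R : ℂ)⁻¹ • mC), ‖z‖ < 1 := by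
    intro z hz
    have := hR _ (spectrum_one_sub_smul hRC hz)
    rwa [mul_div_cancel₀ _ hRC, sub_sub_cancel] at this
  have : CompleteSpace (Matrix (Fin d) (Fin d) ℂ) := FiniteDimensional.complete ℂ _
  obtain ⟨ρ, hρ0, hρ1, hρ⟩ := eventually_norm_pow_le_of_spectrum hQ
  -- the real part of a complex matrix, as an operator on `E`
  let P : Matrix (Fin d) (Fin d) ℂ →ₗ[ℝ] (E →L[ℝ] E) :=
    (LinearMap.toContinuousLinearMap : (E →ₗ[ℝ] E) ≃ₗ[ℝ] (E →L[ℝ] E)).toLinearMap ∘ₗ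
      (Matrix.toLin bE bE).toLinearMap ∘ₗ Complex.reLm.mapMatrix
  have hfd : FiniteDimensional ℝ (Matrix (Fin d) (Fin d) ℂ) := inferInstance
  obtain ⟨C, hC0, hC⟩ := exists_norm_apply_le_of_finiteDimensional P
  refine ⟨R, ρ, C, hR0, hρ0, hρ1, ?_⟩
  have key : ∀ n : ℕ, P ((1 - (R : ℂ)⁻¹ • mC) ^ n) = ((1 : E →L[ℝ] E) - R⁻¹ • L) ^ n := by
    intro n
    have e1 : (1 - (R : ℂ)⁻¹ • mC) ^ n = ((1 - R⁻¹ • m) ^ n).map (algebraMap ℝ ℂ) := by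
      have : (1 - (R : ℂ)⁻¹ • mC) = (1 - R⁻¹ • m).map (algebraMap ℝ ℂ) := by
        ext i j
        simp [mC, Matrix.one_apply, apply_ite Complex.ofReal]
      rw [this, ← RingHom.mapMatrix_apply, ← map_pow, RingHom.mapMatrix_apply]
    have e2 : Complex.reLm.mapMatrix (((1 - R⁻¹ • m) ^ n).map (algebraMap ℝ ℂ))
        = (1 - R⁻¹ • m) ^ n := by
      ext i j; simp
    have e3 : Matrix.toLin bE bE ((1 - R⁻¹ • m) ^ n)
        = ((1 : E →ₗ[ℝ] E) - R⁻¹ • L.toLinearMap) ^ n := by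
      have : (1 - R⁻¹ • m) = LinearMap.toMatrix bE bE ((1 : E →ₗ[ℝ] E) - R⁻¹ • L.toLinearMap) := by
        simp [m, map_sub]
      rw [this, LinearMap.toMatrix_pow, Matrix.toLin_toMatrix]
    change LinearMap.toContinuousLinearMap (Matrix.toLin bE bE (Complex.reLm.mapMatrix _)) = _
    rw [e1, e2, e3]
    ext x
    rw [LinearMap.coe_toContinuousLinearMap', Module.End.pow_apply,
      FunLike.coe_pow_eq_iterate]
    rfl
  filter_upwards [hρ] with n hn
  rw [← key n]
  exact (hC _).trans (by gcongr)

/-- A Lyapunov form for a linear operator all of whose eigenvalues have positive real part. -/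
theorem exists_lyapunov (L : E →L[ℝ] E)
    (h : ∀ μ : ℂ, (L.toLinearMap.charpoly.map (algebraMap ℝ ℂ)).IsRoot μ → 0 < μ.re) :
    ∃ b : E →L[ℝ] E →L[ℝ] ℝ, (∀ x y, b x y = b y x) ∧
      (∃ c > 0, ∀ z, c * ‖z‖ ^ 2 ≤ b z z) ∧ ∃ ε > 0, ∀ z, ε * b z z ≤ b (L z) z := by
  rcases subsingleton_or_nontrivial E with hE | hE
  · refine ⟨0, fun _ _ => rfl, ⟨1, one_pos, fun z => ?_⟩, 1, one_pos, fun z => by simp⟩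
    simp [Subsingleton.elim z 0]
  obtain ⟨R, ρ₀, C, hR, hρ₀, hρ₀1, hC⟩ := exists_norm_pow_one_sub_smul_le h
  set Q : E →L[ℝ] E := 1 - R⁻¹ • L with hQ
  -- The gap between `ρ₀` and `ρ` absorbs the constant and the change to the Euclidean norm once the
  -- exponent `N` is large.
  obtain ⟨ρ, hρ₀ρ, hρ1⟩ := exists_between hρ₀1
  have hρ : 0 < ρ := hρ₀.trans hρ₀ρ
  let ι : E ≃L[ℝ] EuclideanSpace ℝ (Fin (Module.finrank ℝ E)) := toEuclidean
  let ιL : E →L[ℝ] EuclideanSpace ℝ (Fin (Module.finrank ℝ E)) := ι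
  let ιS : EuclideanSpace ℝ (Fin (Module.finrank ℝ E)) →L[ℝ] E := ι.symm
  have hlim : Tendsto (fun n : ℕ => ‖ιL‖ * C * ‖ιS‖ * (ρ₀ / ρ) ^ n) atTop (𝓝 0) := by
    simpa using (tendsto_pow_atTop_nhds_zero_of_lt_one (by positivity)
      ((div_lt_one hρ).2 hρ₀ρ)).const_mul (‖ιL‖ * C * ‖ιS‖)
  obtain ⟨N, ⟨hN1, hN2⟩, hN⟩ := ((hC.and (hlim.eventually_lt_const one_pos)).and
    (eventually_ge_atTop 1)).exists
  have hNN : ∀ z, ‖ι ((Q ^ N) z)‖ ≤ ρ ^ N * ‖ι z‖ := by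
    intro z
    have e : z = ιS (ι z) := (ι.symm_apply_apply z).symm
    have h0 : ‖z‖ ≤ ‖ιS‖ * ‖ι z‖ := by
      conv_lhs => rw [e]
      exact ιS.le_opNorm _
    calc ‖ι ((Q ^ N) z)‖ ≤ ‖ιL‖ * ‖(Q ^ N) z‖ := ιL.le_opNorm _
      _ ≤ ‖ιL‖ * (C * ρ₀ ^ N * (‖ιS‖ * ‖ι z‖)) := by
        gcongr
        exact ((Q ^ N).le_of_opNorm_le_of_le hN1 h0)
      _ = (‖ιL‖ * C * ‖ιS‖ * (ρ₀ / ρ) ^ N) * (ρ ^ N * ‖ι z‖) := by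
        rw [div_pow]; field_simp
      _ ≤ 1 * (ρ ^ N * ‖ι z‖) := by gcongr
      _ = _ := one_mul _
  -- An adapted inner product, summing the Euclidean one over powers of `Q` with weights `ρ⁻²ᵏ`.
  -- Applying `Q` shifts the sum; by the estimate for `Q ^ N` the new last term is at most the lost
  -- first one, so `Q` contracts by `ρ`.
  let b : E →L[ℝ] E →L[ℝ] ℝ := ∑ k ∈ Finset.range N, (ρ⁻¹ ^ (2 * k)) •
    (innerSL ℝ).bilinearComp (ιL.comp (Q ^ k)) (ιL.comp (Q ^ k))
  have hb : ∀ x y, b x y =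
      ∑ k ∈ Finset.range N, ρ⁻¹ ^ (2 * k) * inner ℝ (ι ((Q ^ k) x)) (ι ((Q ^ k) y)) := by
    intro x y
    simp only [b, sum_apply, smul_apply,
      ContinuousLinearMap.bilinearComp_apply, smul_eq_mul]
    rfl
  have hbz : ∀ z, b z z = ∑ k ∈ Finset.range N, ρ⁻¹ ^ (2 * k) * ‖ι ((Q ^ k) z)‖ ^ 2 := by
    intro z
    rw [hb]
    simp only [real_inner_self_eq_norm_sq]
  have hsymm : ∀ x y, b x y = b y x := by
    intro x y
    rw [hb, hb]
    simp only [real_inner_comm]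
  have hnn : ∀ z, 0 ≤ b z z := fun z => by rw [hbz]; positivity
  have hlow : ∀ z, ‖ι z‖ ^ 2 ≤ b z z := by
    intro z
    rw [hbz]
    have := Finset.single_le_sum (f := fun k => ρ⁻¹ ^ (2 * k) * ‖ι ((Q ^ k) z)‖ ^ 2)
      (fun k _ => by positivity) (Finset.mem_range.2 hN)
    simpa using this
  have hQb : ∀ z, b (Q z) (Q z) ≤ ρ ^ 2 * b z z := by
    intro z
    set a : ℕ → ℝ := fun k => ρ⁻¹ ^ (2 * k) * ‖ι ((Q ^ k) z)‖ ^ 2 with ha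
    have e1 : b (Q z) (Q z) = ρ ^ 2 * ∑ k ∈ Finset.range N, a (k + 1) := by
      rw [hbz, Finset.mul_sum]
      refine Finset.sum_congr rfl fun k _ => ?_
      rw [ha]
      simp only [pow_succ Q k, mul_apply_eq_comp]
      have e : ρ ^ 2 * ρ⁻¹ ^ (2 * (k + 1)) = ρ⁻¹ ^ (2 * k) := by
        rw [mul_add, pow_add, mul_one, mul_comm, mul_assoc, ← mul_pow, inv_mul_cancel₀ hρ.ne',
          one_pow, mul_one]
      rw [← mul_assoc, e]
    have e2 : ∑ k ∈ Finset.range N, a (k + 1) + a 0 = ∑ k ∈ Finset.range N, a k + a N := by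
      rw [← Finset.sum_range_succ', ← Finset.sum_range_succ]
    have e3 : a N ≤ a 0 := by
      have h1 : ‖ι ((Q ^ N) z)‖ ^ 2 ≤ (ρ ^ N * ‖ι z‖) ^ 2 := by
        gcongr
        exact hNN z
      calc a N ≤ ρ⁻¹ ^ (2 * N) * (ρ ^ N * ‖ι z‖) ^ 2 := by
            simp only [ha]; gcongr
        _ = a 0 := by
            simp only [ha, mul_pow, ← pow_mul, inv_pow, mul_comm 2 N]
            field_simp
            simp
    rw [e1]
    have : b z z = ∑ k ∈ Finset.range N, a k := hbz z
    gcongr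
    linarith
  -- Cauchy–Schwarz in the form `b (Q z - ρ z) (Q z - ρ z) ≥ 0`.
  have hQz : ∀ z, b (Q z) z ≤ ρ * b z z := by
    intro z
    have h1 := hnn (Q z - ρ • z)
    have h2 : b (Q z - ρ • z) (Q z - ρ • z) = b (Q z) (Q z) - 2 * ρ * b (Q z) z + ρ ^ 2 * b z z := by
      simp only [map_sub, map_smul, sub_apply, smul_apply, smul_eq_mul]
      rw [hsymm z (Q z)]
      ring
    have h3 := hQb z
    have h4 : 2 * ρ * (b (Q z) z) ≤ 2 * ρ * (ρ * b z z) := by nlinarith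
    exact le_of_mul_le_mul_left h4 (by positivity)
  have hι : 0 < ‖ιS‖ ^ 2 + 1 := by positivity
  refine ⟨b, hsymm, ⟨(‖ιS‖ ^ 2 + 1)⁻¹, by positivity, fun z => ?_⟩, R * (1 - ρ),
    mul_pos hR (by linarith), fun z => ?_⟩
  · have e : ‖z‖ ≤ ‖ιS‖ * ‖ι z‖ := by
      have := ιS.le_opNorm (ι z)
      rwa [show ιS (ι z) = z from ι.symm_apply_apply z] at this
    rw [inv_mul_le_iff₀ hι]
    calc ‖z‖ ^ 2 ≤ (‖ιS‖ * ‖ι z‖) ^ 2 := by gcongr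
      _ = ‖ιS‖ ^ 2 * ‖ι z‖ ^ 2 := by ring
      _ ≤ (‖ιS‖ ^ 2 + 1) * b z z := by
        gcongr
        · linarith
        · exact hlow z
  -- Contraction of `Q` turns into positivity of `L = R (1 - Q)`, with rate `R (1 - ρ)`.
  · have e : L z = R • (z - Q z) := by
      simp [hQ, smul_smul, hR.ne']
    rw [e, map_smul, map_sub, smul_apply, sub_apply, smul_eq_mul]
    have := hQz z
    nlinarith

end Lyapunov

/-! ### Connections in local trivializations -/

section Christoffel

variable {E : Type*} [NormedAddCommGroup E] [NormedSpace ℝ E]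
  {M : Type*} [TopologicalSpace M] [ChartedSpace E M] [IsManifold 𝓘(ℝ, E) ∞ M]
  {F : Type*} [NormedAddCommGroup F] [NormedSpace ℝ F]
  {V : M → Type*} [TopologicalSpace (TotalSpace F V)]
  [∀ x, AddCommGroup (V x)] [∀ x, Module ℝ (V x)] [∀ x, TopologicalSpace (V x)]
  [∀ x, IsTopologicalAddGroup (V x)] [∀ x, ContinuousSMul ℝ (V x)] [FiberBundle F V]
  [VectorBundle ℝ F V] [ContMDiffVectorBundle ∞ F V 𝓘(ℝ, E)]

/-- A section which is constant in a trivialization is smooth over the base set. -/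
theorem contMDiffOn_symmL (e : Trivialization F (π F V)) [MemTrivializationAtlas e] (f : F) :
    ContMDiffOn 𝓘(ℝ, E) (𝓘(ℝ, E).prod 𝓘(ℝ, F)) ∞
      (fun y => TotalSpace.mk' F y (e.symmL ℝ y f)) e.baseSet := by
  rw [e.contMDiffOn_section_baseSet_iff]
  refine (contMDiffOn_const (c := f)).congr fun y hy => ?_
  have := e.continuousLinearMapAt_symmL (R := ℝ) hy f
  rwa [e.continuousLinearMapAt_apply_of_mem _ hy] at this

theorem mdifferentiableAt_symmL (e : Trivialization F (π F V)) [MemTrivializationAtlas e] (f : F)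
    {x : M} (hx : x ∈ e.baseSet) :
    MDifferentiableAt 𝓘(ℝ, E) (𝓘(ℝ, E).prod 𝓘(ℝ, F))
      (fun y => TotalSpace.mk' F y (e.symmL ℝ y f)) x :=
  ((contMDiffOn_symmL e f).contMDiffAt (e.open_baseSet.mem_nhds hx)).mdifferentiableAt (by simp)

theorem cov_sum (nabla : CovariantDerivative 𝓘(ℝ, E) F V) {ι : Type*} (s : Finset ι)
    (σ : ι → Π x : M, V x) {x : M}
    (h : ∀ i ∈ s, MDifferentiableAt 𝓘(ℝ, E) (𝓘(ℝ, E).prod 𝓘(ℝ, F))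
      (fun y => TotalSpace.mk' F y (σ i y)) x) :
    nabla (fun y => ∑ i ∈ s, σ i y) x = ∑ i ∈ s, nabla (σ i) x := by
  classical
  have : ContMDiffVectorBundle 1 F V 𝓘(ℝ, E) := ContMDiffVectorBundle.of_le (n := ∞) (by simp)
  induction s using Finset.induction_on with
  | empty =>
    simp only [Finset.sum_empty]
    exact nabla.isCovariantDerivativeOnUniv.zero
  | insert i s hi ih =>
    simp only [Finset.sum_insert hi]
    rw [← ih fun j hj => h j (Finset.mem_insert_of_mem hj)]
    exact nabla.isCovariantDerivativeOnUniv.add (σ := σ i) (σ' := fun y => ∑ j ∈ s, σ j y)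
      (h i (Finset.mem_insert_self _ _))
      (MDifferentiableAt.sum_section fun j hj => h j (Finset.mem_insert_of_mem hj))

/-- The Christoffel term of a connection in a local trivialization. -/
def christoffel (nabla : CovariantDerivative 𝓘(ℝ, E) F V) (e : Trivialization F (π F V))
    [MemTrivializationAtlas e] (x : M) (ξ : TangentSpace 𝓘(ℝ, E) x) (f : F) : F :=
  e.continuousLinearMapAt ℝ x (nabla (fun y => e.symmL ℝ y f) x ξ)

theorem christoffel_add (nabla : CovariantDerivative 𝓘(ℝ, E) F V) (e : Trivialization F (π F V))
    [MemTrivializationAtlas e] {x : M} (hx : x ∈ e.baseSet) (ξ : TangentSpace 𝓘(ℝ, E) x)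
    (f g : F) :
    christoffel nabla e x ξ (f + g) = christoffel nabla e x ξ f + christoffel nabla e x ξ g := by
  unfold christoffel
  rw [← map_add, ← add_apply, ← nabla.isCovariantDerivativeOnUniv.add
    (mdifferentiableAt_symmL e f hx) (mdifferentiableAt_symmL e g hx)]
  simp only [map_add]
  rfl

theorem christoffel_smul (nabla : CovariantDerivative 𝓘(ℝ, E) F V) (e : Trivialization F (π F V))
    [MemTrivializationAtlas e] {x : M} (hx : x ∈ e.baseSet) (ξ : TangentSpace 𝓘(ℝ, E) x)
    (c : ℝ) (f : F) :
    christoffel nabla e x ξ (c • f) = c • christoffel nabla e x ξ f := by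
  unfold christoffel
  rw [← map_smul, ← smul_apply, ← nabla.isCovariantDerivativeOnUniv.smul_const c
    (mdifferentiableAt_symmL e f hx)]
  simp only [map_smul]
  rfl

theorem christoffel_sum (nabla : CovariantDerivative 𝓘(ℝ, E) F V) (e : Trivialization F (π F V))
    [MemTrivializationAtlas e] {x : M} (hx : x ∈ e.baseSet) (ξ : TangentSpace 𝓘(ℝ, E) x)
    {ι : Type*} (s : Finset ι) (c : ι → ℝ) (f : ι → F) :
    christoffel nabla e x ξ (∑ i ∈ s, c i • f i) = ∑ i ∈ s, c i • christoffel nabla e x ξ (f i) := by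
  let L : F →ₗ[ℝ] F := ⟨⟨christoffel nabla e x ξ, christoffel_add nabla e hx ξ⟩,
    christoffel_smul nabla e hx ξ⟩
  change L _ = ∑ i ∈ s, c i • L (f i)
  simp [map_sum]

theorem cov_congr (nabla : CovariantDerivative 𝓘(ℝ, E) F V) {σ τ : Π x : M, V x} {x : M}
    (hσ : MDifferentiableAt 𝓘(ℝ, E) (𝓘(ℝ, E).prod 𝓘(ℝ, F)) (fun y => TotalSpace.mk' F y (σ y)) x)
    (h : ∀ᶠ y in 𝓝 x, σ y = τ y) : nabla σ x = nabla τ x := by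
  refine nabla.isCovariantDerivativeOnUniv.congr_of_eventuallyEq hσ ?_ univ_mem h
  exact hσ.congr_of_eventuallyEq (h.mono fun y hy => by simp only [hy])

/-- `HasCovDerivAlong` uses `e.symm` and `christoffel` the linear `e.symmL`; they agree on the base
set, and the connection is local. -/
theorem cov_symm_eq_christoffel (nabla : CovariantDerivative 𝓘(ℝ, E) F V)
    (e : Trivialization F (π F V)) [MemTrivializationAtlas e] {x : M} (hx : x ∈ e.baseSet)
    (ξ : TangentSpace 𝓘(ℝ, E) x) (f : F) :
    (e (TotalSpace.mk' F x (nabla (fun y => e.symm y f) x ξ))).2 = christoffel nabla e x ξ f := by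
  rw [christoffel, e.continuousLinearMapAt_apply_of_mem _ hx,
    cov_congr nabla (mdifferentiableAt_symmL e f hx) (τ := fun y => e.symm y f)]
  filter_upwards [e.open_baseSet.mem_nhds hx] with y hy
  exact e.symmL_apply hy f

/-- The local formula for the covariant derivative of a section. -/
theorem cov_eq_mfderiv_add_christoffel [FiniteDimensional ℝ F]
    (nabla : CovariantDerivative 𝓘(ℝ, E) F V) (e : Trivialization F (π F V))
    [MemTrivializationAtlas e] {x : M} (hx : x ∈ e.baseSet) (ξ : TangentSpace 𝓘(ℝ, E) x)
    {σ : Π x : M, V x}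
    (hσ : MDifferentiableAt 𝓘(ℝ, E) (𝓘(ℝ, E).prod 𝓘(ℝ, F)) (fun y => TotalSpace.mk' F y (σ y)) x) :
    e.continuousLinearMapAt ℝ x (nabla σ x ξ) =
      mvfderiv 𝓘(ℝ, E) (fun y => (e (TotalSpace.mk' F y (σ y))).2) x ξ +
        christoffel nabla e x ξ (e (TotalSpace.mk' F x (σ x))).2 := by
  have : ContMDiffVectorBundle 1 F V 𝓘(ℝ, E) := ContMDiffVectorBundle.of_le (n := ∞) (by simp)
  let b := Module.finBasis ℝ F
  set σe : M → F := fun y => (e (TotalSpace.mk' F y (σ y))).2 with hσe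
  have hσe' : MDifferentiableAt 𝓘(ℝ, E) 𝓘(ℝ, F) σe x :=
    (e.mdifferentiableAt_section_iff 𝓘(ℝ, E) σ hx).1 hσ
  let l : Fin (Module.finrank ℝ F) → F →L[ℝ] ℝ := fun i =>
    LinearMap.toContinuousLinearMap (b.coord i)
  have hl : ∀ f : F, ∑ i, l i f • b i = f := fun f => b.sum_repr f
  let g : Fin (Module.finrank ℝ F) → M → ℝ := fun i y => l i (σe y)
  have hg : ∀ i, HasMFDerivAt 𝓘(ℝ, E) 𝓘(ℝ, ℝ) (g i) x ((l i).comp (mvfderiv 𝓘(ℝ, E) σe x)) :=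
    fun i => HasMFDerivAt.comp x (l i).hasMFDerivAt hσe'.hasMFDerivAt
  have hs : ∀ i, MDifferentiableAt 𝓘(ℝ, E) (𝓘(ℝ, E).prod 𝓘(ℝ, F))
      (fun y => TotalSpace.mk' F y (e.symmL ℝ y (b i))) x :=
    fun i => mdifferentiableAt_symmL e (b i) hx
  have hgs : ∀ i, MDifferentiableAt 𝓘(ℝ, E) (𝓘(ℝ, E).prod 𝓘(ℝ, F))
      (fun y => TotalSpace.mk' F y (g i y • e.symmL ℝ y (b i))) x :=
    fun i => MDifferentiableAt.smul_section (hg i).mdifferentiableAt (hs i)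
  -- The section is expanded in the frame that is constant in `e`. The Leibniz rule then separates
  -- the derivatives of the coefficients from the Christoffel terms.
  have h1 : nabla σ x = nabla (fun y => ∑ i, g i y • e.symmL ℝ y (b i)) x := by
    refine cov_congr nabla hσ ?_
    filter_upwards [e.open_baseSet.mem_nhds hx] with y hy
    simp only [← map_smul, ← map_sum, g, hl]
    have := e.symmL_continuousLinearMapAt (R := ℝ) hy (σ y)
    rw [e.continuousLinearMapAt_apply_of_mem _ hy] at this
    exact this.symm
  have h2 : ∀ i, nabla (fun y => g i y • e.symmL ℝ y (b i)) x ξ =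
      g i x • nabla (fun y => e.symmL ℝ y (b i)) x ξ +
        l i (mvfderiv 𝓘(ℝ, E) σe x ξ) • e.symmL ℝ x (b i) := by
    intro i
    have := nabla.isCovariantDerivativeOnUniv.leibniz (hs i) (hg i).mdifferentiableAt
    have h3 : mvfderiv 𝓘(ℝ, E) (g i) x = (l i).comp (mvfderiv 𝓘(ℝ, E) σe x) := (hg i).mfderiv
    rw [h3] at this
    exact congrArg (fun T => T ξ) this
  rw [h1, cov_sum nabla _ _ fun i _ => hgs i, sum_apply, map_sum]
  simp only [h2, map_add, map_smul, e.continuousLinearMapAt_symmL hx]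
  rw [Finset.sum_add_distrib, hl, add_comm]
  congr 1
  conv_rhs => rw [← hl (e (TotalSpace.mk' F x (σ x))).2, christoffel_sum nabla e hx]
  rfl

theorem HasMFDerivWithinAt.comp_curve {G : Type*} [NormedAddCommGroup G] [NormedSpace ℝ G]
    {γ : ℝ → M} {s : Set ℝ} {t : ℝ} {ξ : TangentSpace 𝓘(ℝ, E) (γ t)}
    (hγ : HasMFDerivWithinAt 𝓘(ℝ, ℝ) 𝓘(ℝ, E) γ s t ((1 : ℝ →L[ℝ] ℝ).smulRight ξ)) {g : M → G}
    (hg : MDifferentiableAt 𝓘(ℝ, E) 𝓘(ℝ, G) g (γ t)) :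
    HasDerivWithinAt (fun r => g (γ r)) (mvfderiv 𝓘(ℝ, E) g (γ t) ξ) s t := by
  let D : E →L[ℝ] G := mvfderiv 𝓘(ℝ, E) g (γ t)
  let ξ' : E := ξ
  have h : HasFDerivWithinAt (fun r => g (γ r)) (D.comp ((1 : ℝ →L[ℝ] ℝ).smulRight ξ')) s t :=
    (HasMFDerivAt.comp_hasMFDerivWithinAt t hg.hasMFDerivAt hγ).hasFDerivWithinAt
  refine h.hasDerivWithinAt.congr_deriv ?_
  change D ((1 : ℝ) • ξ') = D ξ'
  rw [one_smul]

/-- The local formula for the covariant derivative along a curve does not depend on the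
trivialization. -/
theorem hasDerivWithinAt_coord_change [FiniteDimensional ℝ F]
    (nabla : CovariantDerivative 𝓘(ℝ, E) F V) (e₁ e₂ : Trivialization F (π F V))
    [MemTrivializationAtlas e₁] [MemTrivializationAtlas e₂] {γ : ℝ → M} {w : Π t, V (γ t)}
    {s : Set ℝ} {t : ℝ} {ξ : TangentSpace 𝓘(ℝ, E) (γ t)}
    (hγ : HasMFDerivWithinAt 𝓘(ℝ, ℝ) 𝓘(ℝ, E) γ s t ((1 : ℝ →L[ℝ] ℝ).smulRight ξ))
    (h₁ : γ t ∈ e₁.baseSet) (h₂ : γ t ∈ e₂.baseSet) {η : V (γ t)}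
    (h : HasDerivWithinAt (fun r => (e₁ (TotalSpace.mk' F (γ r) (w r))).2)
      (e₁.continuousLinearMapAt ℝ (γ t) η -
        christoffel nabla e₁ (γ t) ξ (e₁ (TotalSpace.mk' F (γ t) (w t))).2) s t) :
    HasDerivWithinAt (fun r => (e₂ (TotalSpace.mk' F (γ r) (w r))).2)
      (e₂.continuousLinearMapAt ℝ (γ t) η -
        christoffel nabla e₂ (γ t) ξ (e₂ (TotalSpace.mk' F (γ t) (w t))).2) s t := by
  let H : M → F →L[ℝ] F := fun x => (e₁.coordChangeL ℝ e₂ x : F →L[ℝ] F)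
  have hH : MDifferentiableAt 𝓘(ℝ, E) 𝓘(ℝ, F →L[ℝ] F) H (γ t) :=
    (contMDiffAt_coordChangeL (n := ∞) (IB := 𝓘(ℝ, E)) (e := e₁) (e' := e₂) h₁ h₂).mdifferentiableAt
      (by simp)
  have hHe : ∀ x, x ∈ e₁.baseSet → x ∈ e₂.baseSet → ∀ f : F,
      H x f = (e₂ (TotalSpace.mk' F x (e₁.symmL ℝ x f))).2 := by
    intro x hx₁ hx₂ f
    have := e₁.coordChangeL_apply (R := ℝ) e₂ ⟨hx₁, hx₂⟩ f
    rw [e₁.symmL_apply hx₁]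
    exact this
  have hHw : ∀ x, x ∈ e₁.baseSet → x ∈ e₂.baseSet → ∀ a : V x,
      H x (e₁ (TotalSpace.mk' F x a)).2 = (e₂ (TotalSpace.mk' F x a)).2 := by
    intro x hx₁ hx₂ a
    have := e₁.symmL_continuousLinearMapAt (R := ℝ) hx₁ a
    rw [e₁.continuousLinearMapAt_apply_of_mem _ hx₁] at this
    rw [hHe x hx₁ hx₂]
    exact congrArg (fun a => (e₂ (TotalSpace.mk' F x a)).2) this
  set c₁ : F := (e₁ (TotalSpace.mk' F (γ t) (w t))).2 with hc₁
  -- The product rule produces the derivative of the transition map `H`. It is cancelled by the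
  -- inhomogeneous term in the transformation law of the Christoffel terms.
  have hd := (HasMFDerivWithinAt.comp_curve hγ hH).clm_apply h
  have hev : ∀ᶠ r in 𝓝[s] t, γ r ∈ e₁.baseSet ∧ γ r ∈ e₂.baseSet :=
    hγ.continuousWithinAt.eventually
      (inter_mem (e₁.open_baseSet.mem_nhds h₁) (e₂.open_baseSet.mem_nhds h₂))
  have hd2 : HasDerivWithinAt (fun r => (e₂ (TotalSpace.mk' F (γ r) (w r))).2) _ s t :=
    hd.congr_of_eventuallyEq (hev.mono fun r hr => (hHw _ hr.1 hr.2 _).symm) (hHw _ h₁ h₂ _).symm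
  refine hd2.congr_deriv ?_
  -- the section which is constant in the first trivialization, read in the second one
  have hσ := mdifferentiableAt_symmL (E := E) e₁ c₁ h₁
  have key := cov_eq_mfderiv_add_christoffel nabla e₂ h₂ ξ hσ
  have hder : mvfderiv 𝓘(ℝ, E) (fun y => (e₂ (TotalSpace.mk' F y (e₁.symmL ℝ y c₁))).2) (γ t) ξ =
      mvfderiv 𝓘(ℝ, E) H (γ t) ξ c₁ := by
    have e1 : (fun y => (e₂ (TotalSpace.mk' F y (e₁.symmL ℝ y c₁))).2) =ᶠ[𝓝 (γ t)]
        fun y => H y c₁ := by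
      filter_upwards [e₁.open_baseSet.mem_nhds h₁, e₂.open_baseSet.mem_nhds h₂] with y hy₁ hy₂
      exact (hHe y hy₁ hy₂ c₁).symm
    have e2 : HasMFDerivAt 𝓘(ℝ, E) 𝓘(ℝ, F) (fun y => H y c₁) (γ t)
        ((ContinuousLinearMap.apply ℝ F c₁).comp (mvfderiv 𝓘(ℝ, E) H (γ t))) :=
      HasMFDerivAt.comp (γ t) (ContinuousLinearMap.apply ℝ F c₁).hasMFDerivAt hH.hasMFDerivAt
    have e3 := (e2.congr_of_eventuallyEq e1).mfderiv
    exact congrArg (fun T : E →L[ℝ] F => T ξ) e3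
  have hw2 : (e₂ (TotalSpace.mk' F (γ t) (e₁.symmL ℝ (γ t) c₁))).2 =
      (e₂ (TotalSpace.mk' F (γ t) (w t))).2 := by
    rw [← hHe _ h₁ h₂, hHw _ h₁ h₂]
  have hη : ∀ a : V (γ t), H (γ t) (e₁.continuousLinearMapAt ℝ (γ t) a) =
      e₂.continuousLinearMapAt ℝ (γ t) a := by
    intro a
    rw [e₁.continuousLinearMapAt_apply_of_mem _ h₁, e₂.continuousLinearMapAt_apply_of_mem _ h₂]
    exact hHw _ h₁ h₂ a
  rw [hder, hw2] at key
  rw [map_sub, hη, christoffel, hη, key]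
  abel

end Christoffel

/-! ### Local coordinates with globally defined coefficients -/

section LocalModel

/-- Multiplication by a bump function. Coefficients on the whole model space free the ODE theory
above from domain conditions. -/
theorem exists_contDiff_eqOn_nhds {E G : Type*} [NormedAddCommGroup E] [NormedSpace ℝ E]
    [FiniteDimensional ℝ E] [NormedAddCommGroup G] [NormedSpace ℝ G] {f : E → G} {O : Set E}
    (hO : IsOpen O) (hf : ContDiffOn ℝ ∞ f O) {z : E} (hz : z ∈ O) :
    ∃ g : E → G, ContDiff ℝ ∞ g ∧ ∃ O' ⊆ O, IsOpen O' ∧ z ∈ O' ∧ EqOn g f O' := by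
  obtain ⟨r, hr, hrO⟩ := Metric.isOpen_iff.1 hO z hz
  let ψ : ContDiffBump z := ⟨r / 4, r / 2, by positivity, by linarith⟩
  have hψ : ContDiff ℝ ∞ ψ := ψ.contDiff
  have hsub : tsupport ψ ⊆ O := by
    rw [ψ.tsupport_eq]
    exact (Metric.closedBall_subset_ball (by change r / 2 < r; linarith)).trans hrO
  refine ⟨fun y => ψ y • f y, ?_, Metric.ball z (r / 4),
    (Metric.ball_subset_ball (by linarith)).trans hrO, Metric.isOpen_ball,
    Metric.mem_ball_self (by positivity), fun y hy => ?_⟩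
  · rw [contDiff_iff_contDiffAt]
    intro y
    by_cases hy : y ∈ O
    · exact hψ.contDiffAt.smul (hf.contDiffAt (hO.mem_nhds hy))
    · refine (contDiffAt_const (c := (0 : G))).congr_of_eventuallyEq ?_
      have : y ∈ (tsupport ψ)ᶜ := fun h => hy (hsub h)
      filter_upwards [(isClosed_tsupport ψ).isOpen_compl.mem_nhds this] with y' hy'
      rw [image_eq_zero_of_notMem_tsupport hy', zero_smul]
  · have : ψ y = 1 := ψ.one_of_mem_closedBall (Metric.ball_subset_closedBall hy)
    simp only [this, one_smul]

variable {E : Type*} [NormedAddCommGroup E] [NormedSpace ℝ E] [FiniteDimensional ℝ E]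
  {M : Type*} [TopologicalSpace M] [ChartedSpace E M] [IsManifold 𝓘(ℝ, E) ∞ M]

theorem contDiffOn_comp_extChartAt_symm {G : Type*} [NormedAddCommGroup G] [NormedSpace ℝ G]
    {h : M → G} {S : Set M} (hh : ContMDiffOn 𝓘(ℝ, E) 𝓘(ℝ, G) ∞ h S) (x₀ : M) :
    ContDiffOn ℝ ∞ (fun z => h ((extChartAt 𝓘(ℝ, E) x₀).symm z))
      ((extChartAt 𝓘(ℝ, E) x₀).target ∩ (extChartAt 𝓘(ℝ, E) x₀).symm ⁻¹' S) := by
  have h1 := contMDiffOn_extChartAt_symm (I := 𝓘(ℝ, E)) (n := ∞) x₀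
  exact (hh.comp (h1.mono inter_subset_left) fun z hz => hz.2).contDiffOn

theorem isOpen_extChartAt_target_inter {S : Set M} (hS : IsOpen S) (x₀ : M) :
    IsOpen ((extChartAt 𝓘(ℝ, E) x₀).target ∩ (extChartAt 𝓘(ℝ, E) x₀).symm ⁻¹' S) :=
  (continuousOn_extChartAt_symm x₀).isOpen_inter_preimage (isOpen_extChartAt_target x₀) hS

theorem isOpen_extChartAt_source_inter {O : Set E} (hO : IsOpen O) (x₀ : M) :
    IsOpen ((extChartAt 𝓘(ℝ, E) x₀).source ∩ extChartAt 𝓘(ℝ, E) x₀ ⁻¹' O) :=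
  (continuousOn_extChartAt x₀).isOpen_inter_preimage (isOpen_extChartAt_source x₀) hO

/-- A smooth function near `x₀` agrees near `x₀`, in the chart, with a smooth function on the whole
model space. -/
theorem exists_contDiff_extChartAt_eq {G : Type*} [NormedAddCommGroup G] [NormedSpace ℝ G]
    {h : M → G} {S : Set M} (hS : IsOpen S) (hh : ContMDiffOn 𝓘(ℝ, E) 𝓘(ℝ, G) ∞ h S) {x₀ : M}
    (hx₀ : x₀ ∈ S) :
    ∃ g : E → G, ContDiff ℝ ∞ g ∧ ∃ N ⊆ S ∩ (extChartAt 𝓘(ℝ, E) x₀).source, IsOpen N ∧ x₀ ∈ N ∧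
      ∀ x ∈ N, g (extChartAt 𝓘(ℝ, E) x₀ x) = h x := by
  have hmem : extChartAt 𝓘(ℝ, E) x₀ x₀ ∈
      (extChartAt 𝓘(ℝ, E) x₀).target ∩ (extChartAt 𝓘(ℝ, E) x₀).symm ⁻¹' S :=
    ⟨mem_extChartAt_target x₀, by simpa using hx₀⟩
  obtain ⟨g, hg, O, hO, hOo, hzO, hgO⟩ := exists_contDiff_eqOn_nhds
    (isOpen_extChartAt_target_inter hS x₀) (contDiffOn_comp_extChartAt_symm hh x₀) hmem
  refine ⟨g, hg, _, fun x hx => ⟨?_, hx.1⟩, isOpen_extChartAt_source_inter hOo x₀,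
    ⟨mem_extChartAt_source x₀, hzO⟩, fun x hx => ?_⟩
  · have := (hO hx.2).2
    rwa [mem_preimage, (extChartAt 𝓘(ℝ, E) x₀).left_inv hx.1] at this
  · exact (hgO hx.2).trans (congrArg h ((extChartAt 𝓘(ℝ, E) x₀).left_inv hx.1))

/-- The derivative of the chart is the tangent trivialization, and composing with the inverse chart
gives the converse. Continuity is listed separately because the chart reading alone does not keep
the curve inside the chart domain. -/
theorem hasMFDerivWithinAt_curve_iff {γ : ℝ → M} {s : Set ℝ} {t : ℝ}
    {ξ : TangentSpace 𝓘(ℝ, E) (γ t)} {x₀ : M} (hx : γ t ∈ (extChartAt 𝓘(ℝ, E) x₀).source) :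
    HasMFDerivWithinAt 𝓘(ℝ, ℝ) 𝓘(ℝ, E) γ s t ((1 : ℝ →L[ℝ] ℝ).smulRight ξ) ↔
      ContinuousWithinAt γ s t ∧ HasDerivWithinAt (fun r => extChartAt 𝓘(ℝ, E) x₀ (γ r))
        (trivializationAt E (TangentSpace 𝓘(ℝ, E)) x₀ (TotalSpace.mk' E (γ t) ξ)).2 s t := by
  have hb : γ t ∈ (trivializationAt E (TangentSpace 𝓘(ℝ, E) : M → Type _) x₀).baseSet := by
    rw [TangentBundle.trivializationAt_baseSet]; rwa [extChartAt_source] at hx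
  have hx' : γ t ∈ (chartAt E x₀).source := by rwa [extChartAt_source] at hx
  have e1 : (trivializationAt E (TangentSpace 𝓘(ℝ, E)) x₀ (TotalSpace.mk' E (γ t) ξ)).2 =
      mvfderiv 𝓘(ℝ, E) (extChartAt 𝓘(ℝ, E) x₀) (γ t) ξ := by
    have := TangentBundle.continuousLinearMapAt_trivializationAt (I := 𝓘(ℝ, E)) hx'
    have h2 := Trivialization.continuousLinearMapAt_apply_of_mem (R := ℝ)
      (trivializationAt E (TangentSpace 𝓘(ℝ, E) : M → Type _) x₀) hb ξ
    rw [this] at h2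
    exact h2.symm
  constructor
  · intro h
    refine ⟨h.continuousWithinAt, ?_⟩
    rw [e1]
    exact HasMFDerivWithinAt.comp_curve h (mdifferentiableAt_extChartAt hx')
  · rintro ⟨hc, h⟩
    let φ := extChartAt 𝓘(ℝ, E) x₀
    have hd : HasMFDerivAt 𝓘(ℝ, E) 𝓘(ℝ, E) φ.symm (φ (γ t))
        (mfderivWithin 𝓘(ℝ, E) 𝓘(ℝ, E) φ.symm (range 𝓘(ℝ, E)) (φ (γ t))) := by
      have := (mdifferentiableWithinAt_extChartAt_symm (I := 𝓘(ℝ, E))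
        (φ.map_source hx)).hasMFDerivWithinAt
      rw [ModelWithCorners.Boundaryless.range_eq_univ] at this ⊢
      exact this.hasMFDerivAt univ_mem
    have h' : HasMFDerivWithinAt 𝓘(ℝ, ℝ) 𝓘(ℝ, E) (fun r => φ (γ r)) s t _ :=
      h.hasFDerivWithinAt.hasMFDerivWithinAt
    have h2 := HasMFDerivAt.comp_hasMFDerivWithinAt t hd h'
    have hev : γ =ᶠ[𝓝[s] t] φ.symm ∘ fun r => φ (γ r) := by
      filter_upwards [hc.preimage_mem_nhdsWithin ((isOpen_extChartAt_source x₀).mem_nhds hx)]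
        with r hr
      exact (φ.left_inv hr).symm
    have h3 := h2.congr_of_eventuallyEq hev (φ.left_inv hx).symm
    have e2 : mfderivWithin 𝓘(ℝ, E) 𝓘(ℝ, E) φ.symm (range 𝓘(ℝ, E)) (φ (γ t))
        (trivializationAt E (TangentSpace 𝓘(ℝ, E)) x₀ (TotalSpace.mk' E (γ t) ξ)).2 = ξ := by
      rw [← TangentBundle.symmL_trivializationAt (I := 𝓘(ℝ, E)) hx']
      have := Trivialization.symmL_continuousLinearMapAt (R := ℝ)
        (trivializationAt E (TangentSpace 𝓘(ℝ, E) : M → Type _) x₀) hb ξ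
      rwa [Trivialization.continuousLinearMapAt_apply_of_mem _ _ hb] at this
    refine h3.congr_mfderiv (ContinuousLinearMap.ext fun a => ?_)
    let D : E →L[ℝ] E := mfderivWithin 𝓘(ℝ, E) 𝓘(ℝ, E) φ.symm (range 𝓘(ℝ, E)) (φ (γ t))
    let ζ : E := (trivializationAt E (TangentSpace 𝓘(ℝ, E)) x₀ (TotalSpace.mk' E (γ t) ξ)).2
    let a' : ℝ := a
    let ξ' : E := ξ
    change D (a' • ζ) = a' • ξ'
    rw [map_smul]
    exact congrArg (fun y : E => a' • y) e2

variable
  {F : Type*} [NormedAddCommGroup F] [NormedSpace ℝ F] [FiniteDimensional ℝ F]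
  {V : M → Type*} [TopologicalSpace (TotalSpace F V)]
  [∀ x, AddCommGroup (V x)] [∀ x, Module ℝ (V x)] [∀ x, TopologicalSpace (V x)]
  [∀ x, IsTopologicalAddGroup (V x)] [∀ x, ContinuousSMul ℝ (V x)] [FiberBundle F V]
  [VectorBundle ℝ F V] [ContMDiffVectorBundle ∞ F V 𝓘(ℝ, E)]

/-- Coordinates near `x₀` in which a vector field and the operator `∇_X + A` are given by smooth
coefficients on the whole model space. -/
structure LocalModel (nabla : CovariantDerivative 𝓘(ℝ, E) F V)
    (X : Π x : M, TangentSpace 𝓘(ℝ, E) x) (A : Π x : M, V x →L[ℝ] V x) (x₀ : M) where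
  nhd : Set M
  field : E → E
  coeff : E → F →L[ℝ] F
  isOpen_nhd : IsOpen nhd
  mem_nhd : x₀ ∈ nhd
  subset_source : nhd ⊆ (extChartAt 𝓘(ℝ, E) x₀).source
  subset_baseSet : nhd ⊆ (trivializationAt F V x₀).baseSet
  contDiff_field : ContDiff ℝ ∞ field
  contDiff_coeff : ContDiff ℝ ∞ coeff
  field_eq : ∀ x ∈ nhd, field (extChartAt 𝓘(ℝ, E) x₀ x) =
    (trivializationAt E (TangentSpace 𝓘(ℝ, E)) x₀ (TotalSpace.mk' E x (X x))).2
  coeff_eq : ∀ x ∈ nhd, ∀ f, coeff (extChartAt 𝓘(ℝ, E) x₀ x) f =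
    christoffel nabla (trivializationAt F V x₀) x (X x) f +
      (trivializationAt F V x₀).continuousLinearMapAt ℝ x
        (A x ((trivializationAt F V x₀).symmL ℝ x f))

theorem contMDiffOn_coord {σ : Π x : M, V x} {S : Set M} (x₀ : M)
    (hσ : IsSmoothSectionOn (E := E) F S σ) (hS : IsOpen S) :
    ContMDiffOn 𝓘(ℝ, E) 𝓘(ℝ, F) ∞ (fun x => (trivializationAt F V x₀ (TotalSpace.mk' F x (σ x))).2)
      (S ∩ (trivializationAt F V x₀).baseSet) :=
  ((trivializationAt F V x₀).contMDiffOn_section_iff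
    (hS.inter (trivializationAt F V x₀).open_baseSet) inter_subset_right).1
    (hσ.mono inter_subset_left)

theorem nonempty_localModel [T2Space M] {nabla : CovariantDerivative 𝓘(ℝ, E) F V}
    (hnabla : nabla.ContMDiffCovariantDerivative ∞)
    {A : Π x : M, V x →L[ℝ] V x}
    (hA : ContMDiff 𝓘(ℝ, E) (𝓘(ℝ, E).prod 𝓘(ℝ, F →L[ℝ] F)) ∞
      (fun x => TotalSpace.mk' (F →L[ℝ] F) (E := fun x => V x →L[ℝ] V x) x (A x)))
    {X : Π x : M, TangentSpace 𝓘(ℝ, E) x}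
    (hX : ContMDiff 𝓘(ℝ, E) (𝓘(ℝ, E).prod 𝓘(ℝ, E)) ∞
      (fun x => (TotalSpace.mk' E x (X x) : TangentBundle 𝓘(ℝ, E) M))) (x₀ : M) :
    Nonempty (LocalModel nabla X A x₀) := by
  classical
  have hMan : IsManifold 𝓘(ℝ, E) (∞ + 1) M := by simpa using (inferInstance : IsManifold 𝓘(ℝ, E) ∞ M)
  have hTM : ContMDiffVectorBundle ∞ E (TangentSpace 𝓘(ℝ, E) : M → Type _) 𝓘(ℝ, E) :=
    TangentBundle.contMDiffVectorBundle
  set e := trivializationAt F V x₀ with he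
  have hx₀e : x₀ ∈ e.baseSet := mem_baseSet_trivializationAt F V x₀
  set eT := trivializationAt E (TangentSpace 𝓘(ℝ, E) : M → Type _) x₀ with heT
  have hXc : ContMDiffOn 𝓘(ℝ, E) 𝓘(ℝ, E) ∞ (fun x => (eT (TotalSpace.mk' E x (X x))).2)
      eT.baseSet := eT.contMDiffOn_section_baseSet_iff.1 hX.contMDiffOn
  obtain ⟨Xh, hXh, N₁, hN₁, hN₁o, hx₀N₁, hXN₁⟩ := exists_contDiff_extChartAt_eq eT.open_baseSet hXc
    (mem_baseSet_trivializationAt E (TangentSpace 𝓘(ℝ, E)) x₀)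
  obtain ⟨ψ, -, hψ⟩ := (SmoothBumpFunction.nhds_basis_tsupport (I := 𝓘(ℝ, E)) x₀).mem_iff.1
    (e.open_baseSet.mem_nhds hx₀e)
  obtain ⟨N₂, hN₂, hN₂o, hx₀N₂⟩ := mem_nhds_iff.1 ψ.eventuallyEq_one
  -- Smoothness of the connection is used through global sections, so the local frame is cut off.
  -- Where the bump function equals one, locality removes the cutoff again.
  let cut : F → Π x : M, V x := fun f y => ψ y • e.symmL ℝ y f
  have hcut : ∀ f, ContMDiff 𝓘(ℝ, E) (𝓘(ℝ, E).prod 𝓘(ℝ, F)) ∞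
      (fun y => TotalSpace.mk' F y (cut f y)) := fun f =>
    ContMDiffOn.smul_section_of_tsupport ψ.contMDiff.contMDiffOn e.open_baseSet hψ
      (contMDiffOn_symmL e f)
  have hcov : ∀ f, ContMDiff 𝓘(ℝ, E) (𝓘(ℝ, E).prod 𝓘(ℝ, F)) ∞
      (fun y => TotalSpace.mk' F y (nabla (cut f) y (X y))) := by
    intro f
    have h1 := hnabla.contMDiff.contMDiff (σ := cut f) (by simpa using (hcut f).contMDiffOn)
    rw [contMDiffOn_univ] at h1
    exact ContMDiff.clm_bundle_apply h1 hX
  let K : M → F →L[ℝ] F := fun x => if hx : x ∈ e.baseSet then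
    LinearMap.toContinuousLinearMap ⟨⟨christoffel nabla e x (X x), christoffel_add nabla e hx (X x)⟩,
      christoffel_smul nabla e hx (X x)⟩ +
    (e.continuousLinearMapAt ℝ x).comp ((A x).comp (e.symmL ℝ x)) else 0
  have hK : ∀ x ∈ e.baseSet, ∀ f, K x f = christoffel nabla e x (X x) f +
      e.continuousLinearMapAt ℝ x (A x (e.symmL ℝ x f)) := by
    intro x hx f
    simp only [K, dif_pos hx]
    rfl
  have hKf : ∀ f, ContMDiffOn 𝓘(ℝ, E) 𝓘(ℝ, F) ∞ (fun x => K x f) (N₂ ∩ e.baseSet) := by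
    intro f
    have h1 := e.contMDiffOn_section_baseSet_iff.1 (hcov f).contMDiffOn
    have h2 := e.contMDiffOn_section_baseSet_iff.1
      (ContMDiffOn.clm_bundle_apply hA.contMDiffOn (contMDiffOn_symmL e f))
    refine ((h1.mono inter_subset_right).add (h2.mono inter_subset_right)).congr fun x hx => ?_
    rw [hK x hx.2, christoffel, e.continuousLinearMapAt_apply_of_mem _ hx.2,
      e.continuousLinearMapAt_apply_of_mem _ hx.2]
    congr 1
    rw [cov_congr nabla (mdifferentiableAt_symmL e f hx.2) (τ := cut f)]
    filter_upwards [hN₂o.mem_nhds hx.1] with y hy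
    have : ψ y = 1 := hN₂ hy
    simp only [cut, this, one_smul]
  have hKs : ContDiffOn ℝ ∞ (fun z => K ((extChartAt 𝓘(ℝ, E) x₀).symm z))
      ((extChartAt 𝓘(ℝ, E) x₀).target ∩ (extChartAt 𝓘(ℝ, E) x₀).symm ⁻¹' (N₂ ∩ e.baseSet)) :=
    contDiffOn_clm_apply.2 fun f => contDiffOn_comp_extChartAt_symm (hKf f) x₀
  have hmem : extChartAt 𝓘(ℝ, E) x₀ x₀ ∈ (extChartAt 𝓘(ℝ, E) x₀).target ∩
      (extChartAt 𝓘(ℝ, E) x₀).symm ⁻¹' (N₂ ∩ e.baseSet) :=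
    ⟨mem_extChartAt_target x₀, by simpa using ⟨hx₀N₂, hx₀e⟩⟩
  obtain ⟨Bh, hBh, O, hO, hOo, hzO, hBO⟩ := exists_contDiff_eqOn_nhds
    (isOpen_extChartAt_target_inter (hN₂o.inter e.open_baseSet) x₀) hKs hmem
  exact ⟨{
    nhd := N₁ ∩ e.baseSet ∩ ((extChartAt 𝓘(ℝ, E) x₀).source ∩ extChartAt 𝓘(ℝ, E) x₀ ⁻¹' O)
    field := Xh
    coeff := Bh
    isOpen_nhd := (hN₁o.inter e.open_baseSet).inter (isOpen_extChartAt_source_inter hOo x₀)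
    mem_nhd := ⟨⟨hx₀N₁, hx₀e⟩, mem_extChartAt_source x₀, hzO⟩
    subset_source := fun x hx => hx.2.1
    subset_baseSet := fun x hx => hx.1.2
    contDiff_field := hXh
    contDiff_coeff := hBh
    field_eq := fun x hx => hXN₁ x hx.1.1
    coeff_eq := fun x hx f => by
      have h1 : Bh (extChartAt 𝓘(ℝ, E) x₀ x) = K x :=
        (hBO hx.2.2).trans (congrArg K ((extChartAt 𝓘(ℝ, E) x₀).left_inv hx.2.1))
      rw [h1, hK x hx.1.2] }⟩

/-- The local formula for `∇_X σ` and the chain rule. The derivative is written as a source minus `A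
σ` so that it matches the shape of the equation along a curve. -/
theorem hasCovDerivAlong_section {nabla : CovariantDerivative 𝓘(ℝ, E) F V}
    {X : Π x : M, TangentSpace 𝓘(ℝ, E) x} (A : Π x : M, V x →L[ℝ] V x) {σ : Π x : M, V x}
    {γ : ℝ → M} {s : Set ℝ} {t : ℝ}
    (hσ : MDifferentiableAt 𝓘(ℝ, E) (𝓘(ℝ, E).prod 𝓘(ℝ, F)) (fun y => TotalSpace.mk' F y (σ y))
      (γ t))
    (hγ : HasMFDerivWithinAt 𝓘(ℝ, ℝ) 𝓘(ℝ, E) γ s t ((1 : ℝ →L[ℝ] ℝ).smulRight (X (γ t)))) :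
    HasCovDerivAlong nabla γ (fun r => σ (γ r)) s t (X (γ t))
      (nablaAdd nabla X A σ (γ t) - A (γ t) (σ (γ t))) := by
  have : ContMDiffVectorBundle 1 F V 𝓘(ℝ, E) := ContMDiffVectorBundle.of_le (n := ∞) (by simp)
  have hx : γ t ∈ (trivializationAt F V (γ t)).baseSet := mem_baseSet_trivializationAt F V (γ t)
  refine ⟨hγ, ?_⟩
  have h1 := HasMFDerivWithinAt.comp_curve hγ
    (((trivializationAt F V (γ t)).mdifferentiableAt_section_iff 𝓘(ℝ, E) σ hx).1 hσ)
  refine h1.congr_deriv ?_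
  have h2 := cov_eq_mfderiv_add_christoffel nabla (trivializationAt F V (γ t)) hx (X (γ t)) hσ
  rw [Trivialization.continuousLinearMapAt_apply_of_mem ℝ _ hx] at h2
  rw [nablaAdd, add_sub_cancel_right, cov_symm_eq_christoffel nabla _ hx]
  exact eq_sub_of_add_eq h2.symm

/-- In the coordinates of a local model, the equation for sections along integral curves becomes an
ordinary differential equation. -/
theorem LocalModel.hasCovDerivAlong_iff {nabla : CovariantDerivative 𝓘(ℝ, E) F V}
    {X : Π x : M, TangentSpace 𝓘(ℝ, E) x} {A : Π x : M, V x →L[ℝ] V x} {x₀ : M}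
    (m : LocalModel nabla X A x₀) {γ : ℝ → M} {w : Π t, V (γ t)} {s : Set ℝ} {t : ℝ}
    (ht : γ t ∈ m.nhd) {η : V (γ t)} :
    HasCovDerivAlong nabla γ w s t (X (γ t)) (η - A (γ t) (w t)) ↔
      ContinuousWithinAt γ s t ∧
      HasDerivWithinAt (fun r => extChartAt 𝓘(ℝ, E) x₀ (γ r))
        (m.field (extChartAt 𝓘(ℝ, E) x₀ (γ t))) s t ∧
      HasDerivWithinAt (fun r => (trivializationAt F V x₀ (TotalSpace.mk' F (γ r) (w r))).2)
        ((trivializationAt F V x₀ (TotalSpace.mk' F (γ t) η)).2 -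
          m.coeff (extChartAt 𝓘(ℝ, E) x₀ (γ t))
            (trivializationAt F V x₀ (TotalSpace.mk' F (γ t) (w t))).2) s t := by
  have hx : γ t ∈ (trivializationAt F V (γ t)).baseSet := mem_baseSet_trivializationAt F V (γ t)
  have hx₀ := m.subset_baseSet ht
  have e1 : (trivializationAt F V x₀ (TotalSpace.mk' F (γ t) η)).2 -
          m.coeff (extChartAt 𝓘(ℝ, E) x₀ (γ t))
            (trivializationAt F V x₀ (TotalSpace.mk' F (γ t) (w t))).2 =
      (trivializationAt F V x₀).continuousLinearMapAt ℝ (γ t) (η - A (γ t) (w t)) -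
        christoffel nabla (trivializationAt F V x₀) (γ t) (X (γ t))
          (trivializationAt F V x₀ (TotalSpace.mk' F (γ t) (w t))).2 := by
    have h1 := (trivializationAt F V x₀).symmL_continuousLinearMapAt (R := ℝ) hx₀ (w t)
    rw [Trivialization.continuousLinearMapAt_apply_of_mem ℝ _ hx₀] at h1
    have h2 := congrArg (fun a => (trivializationAt F V x₀).continuousLinearMapAt ℝ (γ t)
      (A (γ t) a)) h1
    rw [m.coeff_eq _ ht, map_sub, ← h2, Trivialization.continuousLinearMapAt_apply_of_mem ℝ _ hx₀ η]
    abel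
  have e2 : HasCovDerivAlong nabla γ w s t (X (γ t)) (η - A (γ t) (w t)) ↔
      HasMFDerivWithinAt 𝓘(ℝ, ℝ) 𝓘(ℝ, E) γ s t ((1 : ℝ →L[ℝ] ℝ).smulRight (X (γ t))) ∧
      HasDerivWithinAt (fun r => (trivializationAt F V (γ t) (TotalSpace.mk' F (γ r) (w r))).2)
        ((trivializationAt F V (γ t)).continuousLinearMapAt ℝ (γ t) (η - A (γ t) (w t)) -
        christoffel nabla (trivializationAt F V (γ t)) (γ t) (X (γ t))
          (trivializationAt F V (γ t) (TotalSpace.mk' F (γ t) (w t))).2) s t := by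
    rw [HasCovDerivAlong, Trivialization.continuousLinearMapAt_apply_of_mem ℝ _ hx,
      ← cov_symm_eq_christoffel nabla _ hx]
  rw [e2, e1, ← and_assoc, m.field_eq _ ht, ← hasMFDerivWithinAt_curve_iff (m.subset_source ht)]
  refine and_congr_right fun hγ => ⟨fun h => ?_, fun h => ?_⟩
  · exact hasDerivWithinAt_coord_change nabla _ _ hγ hx hx₀ h
  · exact hasDerivWithinAt_coord_change nabla _ _ hγ hx₀ hx h

end LocalModel

/-! ### Linear equations for sections along integral curves -/

section BundleODE

/-- Compactness gives a finite subdivision each piece of which lies in one good ball; transitivity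
joins the pieces. This passes from one chart to a whole interval. -/
theorem Icc_chain_induction {P : ℝ → ℝ → Prop} {a b : ℝ} (hab : a ≤ b) (hrefl : P a a)
    (htrans : ∀ x y z, x ∈ Icc a b → z ∈ Icc a b → x ≤ y → y ≤ z → P x y → P y z → P x z)
    (hloc : ∀ x ∈ Icc a b, ∃ ε > 0, ∀ s ∈ Icc a b, ∀ t ∈ Icc a b, s ≤ t → |s - x| < ε →
      |t - x| < ε → P s t) : P a b := by
  choose! ε hε hP using hloc
  obtain ⟨t, ht0, htm, ⟨k, hk⟩, hcov⟩ := exists_monotone_Icc_subset_open_cover_Icc hab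
    (c := fun x : Icc a b => Metric.ball x (ε x)) (fun _ => Metric.isOpen_ball)
    (fun x _ => mem_iUnion.2 ⟨x, Metric.mem_ball_self (hε x x.2)⟩)
  have hstep : ∀ n, P (t n) (t (n + 1)) := by
    intro n
    obtain ⟨x, hx⟩ := hcov n
    have h1 := hx (left_mem_Icc.2 (htm n.le_succ))
    have h2 := hx (right_mem_Icc.2 (htm n.le_succ))
    rw [Metric.mem_ball, Subtype.dist_eq, Real.dist_eq] at h1 h2
    exact hP x x.2 _ (t n).2 _ (t (n + 1)).2 (htm n.le_succ) h1 h2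
  have hind : ∀ n, P a (t n) := by
    intro n
    induction n with
    | zero => rw [ht0]; exact hrefl
    | succ n ih =>
      exact htrans a (t n) (t (n + 1)) (left_mem_Icc.2 hab) (t (n + 1)).2 (t n).2.1
        (htm n.le_succ) ih (hstep n)
  have := hind k
  rwa [hk k le_rfl] at this

variable {E : Type*} [NormedAddCommGroup E] [NormedSpace ℝ E] [FiniteDimensional ℝ E]
  {M : Type*} [TopologicalSpace M] [ChartedSpace E M] [IsManifold 𝓘(ℝ, E) ∞ M]
  {F : Type*} [NormedAddCommGroup F] [NormedSpace ℝ F] [FiniteDimensional ℝ F]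
  {V : M → Type*} [TopologicalSpace (TotalSpace F V)]
  [∀ x, AddCommGroup (V x)] [∀ x, Module ℝ (V x)] [∀ x, TopologicalSpace (V x)]
  [∀ x, IsTopologicalAddGroup (V x)] [∀ x, ContinuousSMul ℝ (V x)] [FiberBundle F V]
  [VectorBundle ℝ F V] [ContMDiffVectorBundle ∞ F V 𝓘(ℝ, E)]

/-- The section `w` along `γ` satisfies `∇w/dt + A w = η` on `s`, where `γ` is an integral curve
of `X` on `s`. -/
def SolvesOn (nabla : CovariantDerivative 𝓘(ℝ, E) F V)
    (X : Π x : M, TangentSpace 𝓘(ℝ, E) x) (A : Π x : M, V x →L[ℝ] V x) (γ : ℝ → M)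
    (η w : Π t, V (γ t)) (s : Set ℝ) : Prop :=
  ∀ t ∈ s, HasCovDerivAlong nabla γ w s t (X (γ t)) (η t - A (γ t) (w t))

theorem HasCovDerivAlong.mono_of_mem_nhdsWithin {nabla : CovariantDerivative 𝓘(ℝ, E) F V}
    {γ : ℝ → M} {w : Π t, V (γ t)} {s s' : Set ℝ} {t : ℝ} {ξ : TangentSpace 𝓘(ℝ, E) (γ t)}
    {w' : V (γ t)} (h : HasCovDerivAlong nabla γ w s t ξ w') (hs : s ∈ 𝓝[s'] t) :
    HasCovDerivAlong nabla γ w s' t ξ w' :=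
  ⟨h.1.mono_of_mem_nhdsWithin hs, h.2.mono_of_mem_nhdsWithin hs⟩

theorem HasCovDerivAlong.union {nabla : CovariantDerivative 𝓘(ℝ, E) F V}
    {γ : ℝ → M} {w : Π t, V (γ t)} {s s' : Set ℝ} {t : ℝ} {ξ : TangentSpace 𝓘(ℝ, E) (γ t)}
    {w' : V (γ t)} (h : HasCovDerivAlong nabla γ w s t ξ w')
    (h' : HasCovDerivAlong nabla γ w s' t ξ w') :
    HasCovDerivAlong nabla γ w (s ∪ s') t ξ w' :=
  ⟨h.1.union h'.1, h.2.union h'.2⟩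

theorem HasCovDerivAlong.congr_section {nabla : CovariantDerivative 𝓘(ℝ, E) F V}
    {γ : ℝ → M} {w₁ w₂ : Π t, V (γ t)} {s : Set ℝ} {t : ℝ} {ξ : TangentSpace 𝓘(ℝ, E) (γ t)}
    {w' : V (γ t)} (h : HasCovDerivAlong nabla γ w₁ s t ξ w') (hs : ∀ᶠ r in 𝓝[s] t, w₂ r = w₁ r)
    (ht : w₂ t = w₁ t) :
    HasCovDerivAlong nabla γ w₂ s t ξ w' := by
  refine ⟨h.1, ?_⟩
  have h2 := h.2
  simp only [ht]
  exact h2.congr_of_eventuallyEq (hs.mono fun r hr => by simp only [hr]) (by simp only [ht])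

theorem SolvesOn.mono {nabla : CovariantDerivative 𝓘(ℝ, E) F V}
    {X : Π x : M, TangentSpace 𝓘(ℝ, E) x} {A : Π x : M, V x →L[ℝ] V x} {γ : ℝ → M}
    {η w : Π t, V (γ t)} {s s' : Set ℝ} (h : SolvesOn nabla X A γ η w s) (hs : s' ⊆ s) :
    SolvesOn nabla X A γ η w s' :=
  fun t ht => (h t (hs ht)).mono_of_mem_nhdsWithin
    (mem_of_superset self_mem_nhdsWithin hs)

theorem SolvesOn.congr_section {nabla : CovariantDerivative 𝓘(ℝ, E) F V}
    {X : Π x : M, TangentSpace 𝓘(ℝ, E) x} {A : Π x : M, V x →L[ℝ] V x} {γ : ℝ → M}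
    {η w w' : Π t, V (γ t)} {s : Set ℝ} (h : SolvesOn nabla X A γ η w s)
    (hw : ∀ t ∈ s, w' t = w t) : SolvesOn nabla X A γ η w' s := by
  intro t ht
  have := (h t ht).congr_section (w₂ := w') (eventually_mem_nhdsWithin.mono fun r hr => hw r hr)
    (hw t ht)
  rwa [← hw t ht] at this

/-- Two solutions which agree at the common end point of their domains can be glued. -/
theorem SolvesOn.glue {nabla : CovariantDerivative 𝓘(ℝ, E) F V}
    {X : Π x : M, TangentSpace 𝓘(ℝ, E) x} {A : Π x : M, V x →L[ℝ] V x} {γ : ℝ → M}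
    {η w₁ w₂ : Π t, V (γ t)} {s₁ s₂ : Set ℝ} {b : ℝ} (h₁ : SolvesOn nabla X A γ η w₁ s₁)
    (h₂ : SolvesOn nabla X A γ η w₂ s₂) (hs₁ : s₁ ⊆ Iic b) (hs₂ : s₂ ⊆ Ici b) (hb₁ : b ∈ s₁)
    (hb₂ : b ∈ s₂) (hb : w₁ b = w₂ b) :
    SolvesOn nabla X A γ η (fun t => if t ≤ b then w₁ t else w₂ t) (s₁ ∪ s₂) := by
  set w : Π t, V (γ t) := fun t => if t ≤ b then w₁ t else w₂ t with hw
  have e₁ : ∀ t ∈ s₁, w t = w₁ t := fun t ht => by simp only [hw, if_pos (mem_Iic.1 (hs₁ ht))]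
  have e₂ : ∀ t ∈ s₂, w t = w₂ t := fun t ht => by
    rcases (mem_Ici.1 (hs₂ ht)).eq_or_lt with h | h
    · subst h; simp only [hw, le_refl, if_true, hb]
    · simp only [hw, if_neg (not_le.2 h)]
  have h₁' := h₁.congr_section e₁
  have h₂' := h₂.congr_section e₂
  intro t ht
  rcases lt_trichotomy t b with h | h | h
  · have ht₁ : t ∈ s₁ := ht.resolve_right fun h' => absurd (hs₂ h') (not_le.2 h)
    refine (h₁' t ht₁).mono_of_mem_nhdsWithin ?_
    filter_upwards [self_mem_nhdsWithin, mem_nhdsWithin_of_mem_nhds (Iio_mem_nhds h)] with r hr hr'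
    exact hr.resolve_right fun h' => absurd (mem_Ici.1 (hs₂ h')) (not_le.2 hr')
  · subst h
    exact (h₁' t hb₁).union (h₂' t hb₂)
  · have ht₂ : t ∈ s₂ := ht.resolve_left fun h' => absurd (hs₁ h') (not_le.2 h)
    refine (h₂' t ht₂).mono_of_mem_nhdsWithin ?_
    filter_upwards [self_mem_nhdsWithin, mem_nhdsWithin_of_mem_nhds (Ioi_mem_nhds h)] with r hr hr'
    exact hr.resolve_left fun h' => absurd (mem_Iic.1 (hs₁ h')) (not_le.2 hr')

theorem coord_add {x : M} {x₀ : M} (hx : x ∈ (trivializationAt F V x₀).baseSet) (a b : V x) :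
    (trivializationAt F V x₀ (TotalSpace.mk' F x (a + b))).2 =
      (trivializationAt F V x₀ (TotalSpace.mk' F x a)).2 +
        (trivializationAt F V x₀ (TotalSpace.mk' F x b)).2 :=
  ((trivializationAt F V x₀).linear ℝ hx).map_add a b

theorem coord_smul {x : M} {x₀ : M} (hx : x ∈ (trivializationAt F V x₀).baseSet) (c : ℝ) (a : V x) :
    (trivializationAt F V x₀ (TotalSpace.mk' F x (c • a))).2 =
      c • (trivializationAt F V x₀ (TotalSpace.mk' F x a)).2 :=
  ((trivializationAt F V x₀).linear ℝ hx).map_smul c a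

theorem coord_eq_zero_iff {x : M} {x₀ : M} (hx : x ∈ (trivializationAt F V x₀).baseSet) {a : V x} :
    (trivializationAt F V x₀ (TotalSpace.mk' F x a)).2 = 0 ↔ a = 0 := by
  rw [← Trivialization.continuousLinearMapAt_apply_of_mem ℝ _ hx,
    ← Trivialization.coe_continuousLinearEquivAt_eq (R := ℝ) _ hx]
  exact (Trivialization.continuousLinearEquivAt ℝ (trivializationAt F V x₀) x hx).map_eq_zero_iff

theorem coord_injective {x : M} {x₀ : M} (hx : x ∈ (trivializationAt F V x₀).baseSet) {a b : V x}
    (h : (trivializationAt F V x₀ (TotalSpace.mk' F x a)).2 =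
      (trivializationAt F V x₀ (TotalSpace.mk' F x b)).2) : a = b := by
  rw [← Trivialization.continuousLinearMapAt_apply_of_mem ℝ _ hx,
    ← Trivialization.continuousLinearMapAt_apply_of_mem ℝ _ hx,
    ← Trivialization.coe_continuousLinearEquivAt_eq (R := ℝ) _ hx] at h
  exact (Trivialization.continuousLinearEquivAt ℝ (trivializationAt F V x₀) x hx).injective h

theorem coord_symmL {x : M} {x₀ : M} (hx : x ∈ (trivializationAt F V x₀).baseSet) (f : F) :
    (trivializationAt F V x₀ (TotalSpace.mk' F x ((trivializationAt F V x₀).symmL ℝ x f))).2 = f := by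
  rw [← Trivialization.continuousLinearMapAt_apply_of_mem ℝ _ hx]
  exact Trivialization.continuousLinearMapAt_symmL _ hx f

variable {nabla : CovariantDerivative 𝓘(ℝ, E) F V}
  {X : Π x : M, TangentSpace 𝓘(ℝ, E) x} {A : Π x : M, V x →L[ℝ] V x}

theorem SolvesOn.lincomb (m : ∀ x₀, LocalModel nabla X A x₀) {γ : ℝ → M}
    {η₁ η₂ w₁ w₂ : Π t, V (γ t)} {s : Set ℝ} (h₁ : SolvesOn nabla X A γ η₁ w₁ s)
    (h₂ : SolvesOn nabla X A γ η₂ w₂ s) (a b : ℝ) :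
    SolvesOn nabla X A γ (fun t => a • η₁ t + b • η₂ t) (fun t => a • w₁ t + b • w₂ t) s := by
  intro t ht
  have hm := (m (γ t)).mem_nhd
  have h1 := ((m (γ t)).hasCovDerivAlong_iff hm).1 (h₁ t ht)
  have h2 := ((m (γ t)).hasCovDerivAlong_iff hm).1 (h₂ t ht)
  rw [(m (γ t)).hasCovDerivAlong_iff hm]
  refine ⟨h1.1, h1.2.1, ?_⟩
  have hev : ∀ᶠ r in 𝓝[s] t, γ r ∈ (trivializationAt F V (γ t)).baseSet :=
    h1.1.eventually ((trivializationAt F V (γ t)).open_baseSet.mem_nhds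
      ((m (γ t)).subset_baseSet hm))
  have hc : ∀ r, γ r ∈ (trivializationAt F V (γ t)).baseSet → ∀ w₁ w₂ : Π t, V (γ t),
      (trivializationAt F V (γ t) (TotalSpace.mk' F (γ r) (a • w₁ r + b • w₂ r))).2 =
      a • (trivializationAt F V (γ t) (TotalSpace.mk' F (γ r) (w₁ r))).2 +
        b • (trivializationAt F V (γ t) (TotalSpace.mk' F (γ r) (w₂ r))).2 := by
    intro r hr w₁ w₂
    rw [coord_add hr, coord_smul hr, coord_smul hr]
  have hb := (m (γ t)).subset_baseSet hm
  have hd := (h1.2.2.const_smul a).fun_add (h2.2.2.const_smul b)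
  refine (hd.congr_of_eventuallyEq (hev.mono fun r hr => hc r hr w₁ w₂) (hc t hb w₁ w₂)).congr_deriv
    ?_
  rw [hc t hb, hc t hb, map_add, map_smul, map_smul, smul_sub, smul_sub]
  abel

/-- Zeros of solutions of a linear equation along a curve propagate. -/
theorem SolvesOn.eq_zero (m : ∀ x₀, LocalModel nabla X A x₀) {γ : ℝ → M}
    {η w : Π t, V (γ t)} {s : Set ℝ} (hs : s.OrdConnected) (h : SolvesOn nabla X A γ η w s) {C : ℝ}
    (hη : ∀ x₀, ∀ t ∈ s, γ t ∈ (trivializationAt F V x₀).baseSet →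
      ‖(trivializationAt F V x₀ (TotalSpace.mk' F (γ t) (η t))).2‖ ≤
        C * ‖(trivializationAt F V x₀ (TotalSpace.mk' F (γ t) (w t))).2‖)
    {a b : ℝ} (ha : a ∈ s) (hb : b ∈ s) (hw : w a = 0) : w b = 0 := by
  revert hw
  -- Connectedness of `s` reduces the claim to nearby times. There a single chart suffices, and the
  -- two-sided Grönwall estimate carries zeros in both directions.
  refine hs.isPreconnected.induction₂' (fun a b => w a = 0 → w b = 0) ?_
    (fun x y z _ _ _ h1 h2 h3 => h2 (h1 h3)) ha hb
  intro x hx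
  set e := trivializationAt F V (γ x) with he
  set φ := extChartAt 𝓘(ℝ, E) (γ x) with hφ
  set K := ‖(m (γ x)).coeff (φ (γ x))‖ + 1 with hK
  have hcont : ContinuousWithinAt γ s x := (h x hx).1.continuousWithinAt
  have hK' : ∀ᶠ y in 𝓝 (γ x), ‖(m (γ x)).coeff (φ y)‖ < K := by
    have : ContinuousAt (fun y => ‖(m (γ x)).coeff (φ y)‖) (γ x) :=
      ((m (γ x)).contDiff_coeff.continuous.continuousAt.comp (continuousAt_extChartAt (γ x))).norm
    exact this.eventually_lt continuousAt_const (lt_add_one _)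
  have hev : ∀ᶠ r in 𝓝[s] x, γ r ∈ (m (γ x)).nhd ∧ ‖(m (γ x)).coeff (φ (γ r))‖ < K :=
    hcont.eventually (inter_mem ((m (γ x)).isOpen_nhd.mem_nhds (m (γ x)).mem_nhd) hK')
  obtain ⟨ε, hε, hball⟩ := Metric.mem_nhdsWithin_iff.1 hev
  have key : ∀ y ∈ Metric.ball x ε ∩ s, ∀ z ∈ Metric.ball x ε ∩ s, w y = 0 → w z = 0 := by
    intro y hy z hz hwy
    have hsub : Icc (min y z) (max y z) ⊆ Metric.ball x ε ∩ s := by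
      rw [← uIcc]
      refine subset_inter ?_ (hs.uIcc_subset hy.2 hz.2)
      rw [Real.ball_eq_Ioo] at hy hz ⊢
      exact ordConnected_Ioo.uIcc_subset hy.1 hz.1
    have hb := norm_le_mul_exp_abs (a := min y z) (b := max y z)
      (f := fun r => (e (TotalSpace.mk' F (γ r) (w r))).2)
      (f' := fun r => (e (TotalSpace.mk' F (γ r) (η r))).2 - (m (γ x)).coeff (φ (γ r))
        (e (TotalSpace.mk' F (γ r) (w r))).2) (K := C + K) (s := y) (t := z)
      (fun r hr => (((m (γ x)).hasCovDerivAlong_iff (hball (hsub hr)).1).1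
        (h r (hsub hr).2)).2.2.mono fun q hq => (hsub hq).2)
      (fun r hr => by
        refine (norm_sub_le _ _).trans ?_
        rw [add_mul]
        refine add_le_add (hη _ r (hsub hr).2 ((m (γ x)).subset_baseSet (hball (hsub hr)).1)) ?_
        exact ((m (γ x)).coeff (φ (γ r))).le_of_opNorm_le (hball (hsub hr)).2.le _)
      ⟨min_le_left _ _, le_max_left _ _⟩ ⟨min_le_right _ _, le_max_right _ _⟩
    have h0 : (e (TotalSpace.mk' F (γ y) (w y))).2 = 0 :=
      (coord_eq_zero_iff ((m (γ x)).subset_baseSet (hball hy).1)).2 hwy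
    simp only [h0, norm_zero, zero_mul] at hb
    exact (coord_eq_zero_iff ((m (γ x)).subset_baseSet (hball hz).1)).1
      (norm_le_zero_iff.1 hb)
  have hxs : x ∈ Metric.ball x ε ∩ s := ⟨Metric.mem_ball_self hε, hx⟩
  filter_upwards [inter_mem (mem_nhdsWithin_of_mem_nhds (Metric.ball_mem_nhds x hε))
    self_mem_nhdsWithin] with y hy
  exact ⟨key x hxs y hy, key y hy x hxs⟩

theorem SolvesOn.eqOn (m : ∀ x₀, LocalModel nabla X A x₀) {γ : ℝ → M}
    {η w₁ w₂ : Π t, V (γ t)} {s : Set ℝ} (hs : s.OrdConnected) (h₁ : SolvesOn nabla X A γ η w₁ s)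
    (h₂ : SolvesOn nabla X A γ η w₂ s) {a b : ℝ} (ha : a ∈ s) (hb : b ∈ s) (h : w₁ a = w₂ a) :
    w₁ b = w₂ b := by
  have h3 := h₁.lincomb m h₂ 1 (-1)
  have := SolvesOn.eq_zero m hs h3 (C := 0) (fun x₀ t _ hx => by
    have : (1 : ℝ) • η t + (-1 : ℝ) • η t = 0 := by simp
    rw [this, (coord_eq_zero_iff hx).2 rfl]
    simp) ha hb (by simp [h])
  rw [one_smul, neg_one_smul] at this
  exact sub_eq_zero.1 (by rw [sub_eq_add_neg]; exact this)

/-- Solvability, from the left end point, of the inhomogeneous linear equation along an integral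
curve. -/
theorem exists_solvesOn_Icc (m : ∀ x₀, LocalModel nabla X A x₀) {γ : ℝ → M} {η : Π t, V (γ t)}
    {a b : ℝ} (hab : a ≤ b) (hγ : IsMIntegralCurveOn γ X (Icc a b))
    (hη : ∀ x₀, ContinuousOn (fun t => (trivializationAt F V x₀ (TotalSpace.mk' F (γ t) (η t))).2)
      (Icc a b ∩ γ ⁻¹' (trivializationAt F V x₀).baseSet)) (c : V (γ a)) :
    ∃ w : Π t, V (γ t), w a = c ∧ SolvesOn nabla X A γ η w (Icc a b) := by
  classical
  have hcont := hγ.continuousOn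
  have hloc : ∀ x ∈ Icc a b, ∃ ε > 0, ∀ s ∈ Icc a b, ∀ t ∈ Icc a b, s ≤ t → |s - x| < ε →
      |t - x| < ε → ∀ c : V (γ s), ∃ w : Π r, V (γ r), w s = c ∧
        SolvesOn nabla X A γ η w (Icc s t) := by
    intro x hx
    obtain ⟨ε, hε, hball⟩ := Metric.mem_nhdsWithin_iff.1 ((hcont x hx).preimage_mem_nhdsWithin
      ((m (γ x)).isOpen_nhd.mem_nhds (m (γ x)).mem_nhd))
    refine ⟨ε, hε, fun s hs t ht hst hsx htx c => ?_⟩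
    have hsub : Icc s t ⊆ Icc a b := Icc_subset_Icc hs.1 ht.2
    have hN : ∀ r ∈ Icc s t, γ r ∈ (m (γ x)).nhd := by
      intro r hr
      refine hball ⟨?_, hsub hr⟩
      rw [abs_lt] at hsx htx
      rw [Metric.mem_ball, Real.dist_eq, abs_lt]
      exact ⟨by linarith [hr.1], by linarith [hr.2]⟩
    have hcN : ContinuousOn (fun r => (m (γ x)).coeff (extChartAt 𝓘(ℝ, E) (γ x) (γ r))) (Icc s t) :=
      (m (γ x)).contDiff_coeff.continuous.comp_continuousOn
        ((continuousOn_extChartAt (γ x)).comp (hcont.mono hsub)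
          fun r hr => (m (γ x)).subset_source (hN r hr))
    obtain ⟨y, hy0, hy⟩ := exists_linearODE_left hst (A := fun r =>
      -(m (γ x)).coeff (extChartAt 𝓘(ℝ, E) (γ x) (γ r))) (g := fun r =>
      (trivializationAt F V (γ x) (TotalSpace.mk' F (γ r) (η r))).2) hcN.neg
      ((hη (γ x)).mono fun r hr => ⟨hsub hr, (m (γ x)).subset_baseSet (hN r hr)⟩)
      (trivializationAt F V (γ x) (TotalSpace.mk' F (γ s) c)).2
    set w : Π r, V (γ r) := fun r => (trivializationAt F V (γ x)).symmL ℝ (γ r) (y r) with hw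
    have hwy : ∀ r ∈ Icc s t, (trivializationAt F V (γ x) (TotalSpace.mk' F (γ r) (w r))).2 = y r :=
      fun r hr => coord_symmL ((m (γ x)).subset_baseSet (hN r hr)) (y r)
    have hs' : s ∈ Icc s t := left_mem_Icc.2 hst
    refine ⟨w, ?_, fun r hr => ?_⟩
    · exact coord_injective ((m (γ x)).subset_baseSet (hN s hs')) ((hwy s hs').trans hy0)
    · rw [(m (γ x)).hasCovDerivAlong_iff (hN r hr)]
      have h1 := (hasMFDerivWithinAt_curve_iff ((m (γ x)).subset_source (hN r hr))).1
        ((hγ r (hsub hr)).mono hsub)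
      refine ⟨h1.1, ?_, ?_⟩
      · rw [(m (γ x)).field_eq _ (hN r hr)]
        exact h1.2
      · refine ((hy r hr).congr hwy (hwy r hr)).congr_deriv ?_
        rw [hwy r hr, neg_apply]
        abel
  refine Icc_chain_induction (P := fun s t => ∀ c : V (γ s), ∃ w : Π r, V (γ r), w s = c ∧
    SolvesOn nabla X A γ η w (Icc s t)) hab ?_ ?_ hloc c
  · obtain ⟨ε, hε, h⟩ := hloc a (left_mem_Icc.2 hab)
    exact h a (left_mem_Icc.2 hab) a (left_mem_Icc.2 hab) le_rfl (by simpa) (by simpa)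
  · intro x y z hx hz hxy hyz h1 h2 c
    obtain ⟨w₁, hw₁, hs₁⟩ := h1 c
    obtain ⟨w₂, hw₂, hs₂⟩ := h2 (w₁ y)
    refine ⟨_, ?_, (hs₁.glue hs₂ (fun t ht => ht.2) (fun t ht => ht.1) (right_mem_Icc.2 hxy)
      (left_mem_Icc.2 hyz) hw₂.symm).mono (Icc_union_Icc_eq_Icc hxy hyz).ge⟩
    simp only [hxy, if_true, hw₁]

end BundleODE

/-! ### Uniqueness of orbits and the fundamental solution -/

section Transport

variable {E : Type*} [NormedAddCommGroup E] [NormedSpace ℝ E] [FiniteDimensional ℝ E]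
  {M : Type*} [TopologicalSpace M] [ChartedSpace E M] [IsManifold 𝓘(ℝ, E) ∞ M]
  {F : Type*} [NormedAddCommGroup F] [NormedSpace ℝ F] [FiniteDimensional ℝ F]
  {V : M → Type*} [TopologicalSpace (TotalSpace F V)]
  [∀ x, AddCommGroup (V x)] [∀ x, Module ℝ (V x)] [∀ x, TopologicalSpace (V x)]
  [∀ x, IsTopologicalAddGroup (V x)] [∀ x, ContinuousSMul ℝ (V x)] [FiberBundle F V]
  [VectorBundle ℝ F V] [ContMDiffVectorBundle ∞ F V 𝓘(ℝ, E)]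
  {nabla : CovariantDerivative 𝓘(ℝ, E) F V}
  {X : Π x : M, TangentSpace 𝓘(ℝ, E) x} {A : Π x : M, V x →L[ℝ] V x}

/-- Uniqueness of integral curves on an interval (with or without its end points). -/
theorem eqOn_of_isMIntegralCurveOn [T2Space M] (m : ∀ x₀, LocalModel nabla X A x₀) {γ γ' : ℝ → M}
    {s : Set ℝ} (hs : s.OrdConnected) (hγ : IsMIntegralCurveOn γ X s)
    (hγ' : IsMIntegralCurveOn γ' X s) {a b : ℝ} (ha : a ∈ s) (hb : b ∈ s) (h : γ a = γ' a) :
    γ b = γ' b := by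
  revert h
  refine hs.isPreconnected.induction₂' (fun a b => γ a = γ' a → γ b = γ' b) ?_
    (fun x y z _ _ _ h1 h2 h3 => h2 (h1 h3)) ha hb
  intro x hx
  -- If the curves differ at `x`, Hausdorff separation keeps them apart nearby and both implications
  -- hold vacuously. If they agree, Grönwall applies in one chart.
  by_cases hxx : γ x = γ' x
  swap
  · obtain ⟨O, O', hO, hO', hxO, hxO', hd⟩ := t2_separation hxx
    filter_upwards [(hγ.continuousOn x hx).preimage_mem_nhdsWithin (hO.mem_nhds hxO),
      (hγ'.continuousOn x hx).preimage_mem_nhdsWithin (hO'.mem_nhds hxO')] with y hy hy'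
    refine ⟨fun h => absurd h hxx, fun h => ?_⟩
    rw [mem_preimage, ← h] at hy'
    exact (disjoint_left.1 hd hy hy').elim
  let mx := m (γ x)
  let φ := extChartAt 𝓘(ℝ, E) (γ x)
  obtain ⟨K, hK0, hK⟩ := exists_norm_sub_le_of_contDiff
    (f := mx.field) (mx.contDiff_field.of_le (by simp))
    (isCompact_closedBall (φ (γ x)) 1) (convex_closedBall _ _)
  have hN : ∀ᶠ y in 𝓝 (γ x), y ∈ mx.nhd ∧ φ y ∈ Metric.closedBall (φ (γ x)) 1 :=
    inter_mem (mx.isOpen_nhd.mem_nhds mx.mem_nhd)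
      ((continuousAt_extChartAt (γ x)).preimage_mem_nhds (Metric.closedBall_mem_nhds _ one_pos))
  have h1 := (hγ.continuousOn x hx).eventually hN
  have h2 := (hγ'.continuousOn x hx).eventually (by rw [← hxx]; exact hN)
  obtain ⟨ε, hε, hball⟩ := Metric.mem_nhdsWithin_iff.1 (h1.and h2)
  have key : ∀ y ∈ Metric.ball x ε ∩ s, γ y = γ' y := by
    intro y hy
    have hxs : x ∈ Metric.ball x ε ∩ s := ⟨Metric.mem_ball_self hε, hx⟩
    have hsub : Icc (min x y) (max x y) ⊆ Metric.ball x ε ∩ s := by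
      rw [← uIcc]
      refine subset_inter ?_ (hs.uIcc_subset hxs.2 hy.2)
      rw [Real.ball_eq_Ioo] at hy hxs ⊢
      exact ordConnected_Ioo.uIcc_subset hxs.1 hy.1
    have hder : ∀ γ : ℝ → M, IsMIntegralCurveOn γ X s → ∀ r ∈ s, γ r ∈ mx.nhd →
        HasDerivWithinAt (fun r => φ (γ r)) (mx.field (φ (γ r))) s r := by
      intro γ hγ r hr hrN
      rw [mx.field_eq _ hrN]
      exact ((hasMFDerivWithinAt_curve_iff (mx.subset_source hrN)).1 (hγ r hr)).2
    have hb := norm_le_mul_exp_abs (a := min x y) (b := max x y)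
      (f := fun r => φ (γ r) - φ (γ' r)) (f' := fun r => mx.field (φ (γ r)) - mx.field (φ (γ' r)))
      (K := K) (s := x) (t := y)
      (fun r hr => ((hder γ hγ r (hsub hr).2 (hball (hsub hr)).1.1).fun_sub
        (hder γ' hγ' r (hsub hr).2 (hball (hsub hr)).2.1)).mono fun q hq => (hsub hq).2)
      (fun r hr => hK _ (hball (hsub hr)).2.2 _ (hball (hsub hr)).1.2)
      ⟨min_le_left _ _, le_max_left _ _⟩ ⟨min_le_right _ _, le_max_right _ _⟩
    rw [hxx, sub_self, norm_zero, zero_mul] at hb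
    exact φ.injOn (mx.subset_source (hball hy).1.1) (mx.subset_source (hball hy).2.1)
      (sub_eq_zero.1 (norm_le_zero_iff.1 hb))
  filter_upwards [inter_mem (mem_nhdsWithin_of_mem_nhds (Metric.ball_mem_nhds x hε))
    self_mem_nhdsWithin] with y hy
  exact ⟨fun _ => key y hy, fun _ => hxx⟩

variable (F) in
/-- A fibre of a vector bundle is isomorphic to the model fibre. -/
def fibreEquiv (x : M) : V x ≃L[ℝ] F :=
  (trivializationAt F V x).continuousLinearEquivAt ℝ x (mem_baseSet_trivializationAt F V x)

variable (F V) in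
theorem finrank_fibre (x : M) : Module.finrank ℝ (V x) = Module.finrank ℝ F :=
  (fibreEquiv F (V := V) x).toLinearEquiv.finrank_eq

theorem SolvesOn.lincomb_zero (m : ∀ x₀, LocalModel nabla X A x₀) {γ : ℝ → M}
    {w₁ w₂ : Π t, V (γ t)} {s : Set ℝ} (h₁ : SolvesOn nabla X A γ 0 w₁ s)
    (h₂ : SolvesOn nabla X A γ 0 w₂ s) (a b : ℝ) :
    SolvesOn nabla X A γ 0 (fun t => a • w₁ t + b • w₂ t) s := by
  have := h₁.lincomb m h₂ a b
  simpa using! this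

theorem SolvesOn.eq_zero_of_homogeneous (m : ∀ x₀, LocalModel nabla X A x₀) {γ : ℝ → M}
    {w : Π t, V (γ t)} {s : Set ℝ} (hs : s.OrdConnected) (h : SolvesOn nabla X A γ 0 w s)
    {a b : ℝ} (ha : a ∈ s) (hb : b ∈ s) (hw : w a = 0) : w b = 0 :=
  SolvesOn.eq_zero m hs h (C := 0) (fun x₀ t _ hx => by
    rw [Pi.zero_apply, (coord_eq_zero_iff hx).2 rfl]; simp) ha hb hw

/-- The solution operator from the left end to the right end is linear, and injective because zeros
propagate. The two fibres have equal dimension, so it is onto and any final value can be prescribed.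
-/
theorem exists_solvesOn_Icc_right (m : ∀ x₀, LocalModel nabla X A x₀) {γ : ℝ → M}
    {a b : ℝ} (hab : a ≤ b) (hγ : IsMIntegralCurveOn γ X (Icc a b)) (d : V (γ b)) :
    ∃ w : Π t, V (γ t), w b = d ∧ SolvesOn nabla X A γ 0 w (Icc a b) := by
  have ha : a ∈ Icc a b := left_mem_Icc.2 hab
  have hb : b ∈ Icc a b := right_mem_Icc.2 hab
  have hex := exists_solvesOn_Icc m (η := 0) hab hγ (fun x₀ =>
    (continuousOn_const (c := (0 : F))).congr fun t ht => (coord_eq_zero_iff ht.2).2 rfl)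
  choose w hw hs using hex
  have hlin : ∀ (r₁ r₂ : ℝ) (c₁ c₂ : V (γ a)), w (r₁ • c₁ + r₂ • c₂) b =
      r₁ • w c₁ b + r₂ • w c₂ b := fun r₁ r₂ c₁ c₂ =>
    SolvesOn.eqOn m ordConnected_Icc (hs _) ((hs c₁).lincomb_zero m (hs c₂) r₁ r₂) ha hb
      (by simp only [hw])
  let R : V (γ a) →ₗ[ℝ] V (γ b) :=
    { toFun := fun c => w c b
      map_add' := fun x y => by simpa using hlin 1 1 x y
      map_smul' := fun r x => by simpa using hlin r 0 x 0 }
  have hinj : Function.Injective R := by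
    rw [← LinearMap.ker_eq_bot, LinearMap.ker_eq_bot']
    intro c hc
    rw [← hw c]
    exact SolvesOn.eq_zero_of_homogeneous m ordConnected_Icc (hs c) hb ha hc
  have := (fibreEquiv F (V := V) (γ a)).toLinearEquiv.symm.finiteDimensional
  have := (fibreEquiv F (V := V) (γ b)).toLinearEquiv.symm.finiteDimensional
  have hsurj : Function.Surjective R := (LinearMap.injective_iff_surjective_of_finrank_eq_finrank
    ((finrank_fibre F V (γ a)).trans (finrank_fibre F V (γ b)).symm)).1 hinj
  obtain ⟨c, hc⟩ := hsurj d
  exact ⟨w c, hc, hs c⟩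

theorem exists_solvesOn_Iic (m : ∀ x₀, LocalModel nabla X A x₀) {γ : ℝ → M}
    (hγ : IsBackwardOrbit X γ) (d : V (γ 0)) :
    ∃ w : Π t, V (γ t), w 0 = d ∧ SolvesOn nabla X A γ 0 w (Iic 0) := by
  have hex : ∀ a : ℝ, a ≤ 0 → ∃ w : Π t, V (γ t), w 0 = d ∧ SolvesOn nabla X A γ 0 w (Icc a 0) :=
    fun a ha => exists_solvesOn_Icc_right m ha (hγ.mono fun t ht => ht.2) d
  choose! w hw hs using hex
  have hagree : ∀ a b, a ≤ 0 → b ≤ 0 → ∀ t ∈ Icc a 0, t ∈ Icc b 0 → w a t = w b t := by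
    intro a b ha hb t hta htb
    have hm : max a b ≤ 0 := max_le ha hb
    exact SolvesOn.eqOn m ordConnected_Icc ((hs a ha).mono (Icc_subset_Icc_left (le_max_left a b)))
      ((hs b hb).mono (Icc_subset_Icc_left (le_max_right a b))) (right_mem_Icc.2 hm)
      ⟨max_le hta.1 htb.1, hta.2⟩ ((hw a ha).trans (hw b hb).symm)
  -- Starting at `t - 1` rather than `t` makes the interval a neighbourhood of `t` within the
  -- half-line.
  refine ⟨fun t => w (t - 1) t, hw _ (by norm_num), fun t ht => ?_⟩
  have ht : t ≤ 0 := ht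
  have h1 : t - 1 ≤ 0 := by linarith
  have htm : t ∈ Icc (t - 1) 0 := ⟨by linarith, ht⟩
  have hnh : Icc (t - 1) 0 ∈ 𝓝[Iic 0] t := by
    filter_upwards [self_mem_nhdsWithin,
      mem_nhdsWithin_of_mem_nhds (Ioi_mem_nhds (show t - 1 < t by linarith))] with r hr hr'
    exact ⟨(mem_Ioi.1 hr').le, hr⟩
  refine (((hs _ h1) t htm).mono_of_mem_nhdsWithin hnh).congr_section ?_ rfl
  filter_upwards [hnh] with r hr
  exact hagree _ _ (by linarith [hr.2]) h1 r ⟨by linarith, hr.2⟩ hr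

/-- Existence, uniqueness and invertibility of the fundamental solution along a backward orbit. -/
theorem exists_isFundamentalSolution (m : ∀ x₀, LocalModel nabla X A x₀) {γ : ℝ → M}
    (hγ : IsBackwardOrbit X γ) :
    ∃ T : Π t : ℝ, V (γ 0) →L[ℝ] V (γ t), IsFundamentalSolution nabla X A γ T ∧
      (∀ T' : Π t : ℝ, V (γ 0) →L[ℝ] V (γ t), IsFundamentalSolution nabla X A γ T' →
        ∀ t ≤ 0, T' t = T t) ∧ ∀ t ≤ 0, (T t).IsInvertible := by
  have h0 : (0 : ℝ) ∈ Iic (0 : ℝ) := mem_Iic.2 le_rfl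
  choose w hw hs using exists_solvesOn_Iic m hγ
  have hlin : ∀ (r₁ r₂ : ℝ) (c₁ c₂ : V (γ 0)), ∀ t ∈ Iic (0 : ℝ), w (r₁ • c₁ + r₂ • c₂) t =
      r₁ • w c₁ t + r₂ • w c₂ t := fun r₁ r₂ c₁ c₂ t ht =>
    SolvesOn.eqOn m ordConnected_Iic (hs _) ((hs c₁).lincomb_zero m (hs c₂) r₁ r₂) h0 ht
      (by simp only [hw])
  have hfd := fun x => (fibreEquiv F (V := V) x).toLinearEquiv.symm.finiteDimensional
  have ht2 := fun x => (fibreEquiv F (V := V) x).toHomeomorph.symm.t2Space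
  classical
  let R : Π t : ℝ, V (γ 0) →ₗ[ℝ] V (γ t) := fun t => if ht : t ≤ 0 then
    { toFun := fun c => w c t
      map_add' := fun x y => by simpa using hlin 1 1 x y t ht
      map_smul' := fun r x => by simpa using hlin r 0 x 0 t ht } else 0
  let T : Π t : ℝ, V (γ 0) →L[ℝ] V (γ t) := fun t => LinearMap.toContinuousLinearMap (R t)
  have hT : ∀ t ≤ 0, ∀ c, T t c = w c t := by
    intro t ht c
    change R t c = w c t
    simp only [R, dif_pos ht]
    rfl
  have hTs : ∀ c, SolvesOn nabla X A γ 0 (fun t => T t c) (Iic 0) :=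
    fun c => (hs c).congr_section fun t ht => hT t ht c
  refine ⟨T, ⟨?_, fun c t ht => ?_⟩, fun T' hT' t ht => ?_, fun t ht => ?_⟩
  · ext c
    rw [hT 0 le_rfl, hw]
    rfl
  · have := hTs c t ht
    rwa [Pi.zero_apply, zero_sub] at this
  · ext c
    refine SolvesOn.eqOn m ordConnected_Iic (η := 0) (w₁ := fun t => T' t c) (fun r hr => ?_)
      (hTs c) h0 ht ?_
    · rw [Pi.zero_apply, zero_sub]
      exact hT'.2 c r hr
    · simp only [hT'.1, hT 0 le_rfl, hw]
      rfl
  · have hinj : Function.Injective (R t) := by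
      rw [← LinearMap.ker_eq_bot, LinearMap.ker_eq_bot']
      intro c hc
      rw [← hw c, ← hT 0 le_rfl]
      exact SolvesOn.eq_zero_of_homogeneous m ordConnected_Iic (hTs c) ht h0 hc
    let L := (R t).linearEquivOfInjective hinj
      ((finrank_fibre F V (γ 0)).trans (finrank_fibre F V (γ t)).symm)
    refine ⟨L.toContinuousLinearEquiv, ?_⟩
    ext c
    rfl

end Transport

/-! ### Lifting the fibre so that its universe is unrestricted -/

section UniverseLift

variable {E : Type u} [NormedAddCommGroup E] [NormedSpace ℝ E] [FiniteDimensional ℝ E]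
  {F : Type w} [NormedAddCommGroup F] [NormedSpace ℝ F] [FiniteDimensional ℝ F]

/-- An operator on `F` as an operator on the lift of `F` to a larger universe. -/
def liftCoeff (B : E → F →L[ℝ] F) (z : E) : ULift.{u} F →L[ℝ] ULift.{u} F :=
  (ContinuousLinearEquiv.ulift (R₁ := ℝ) (M₁ := F)).symm.toContinuousLinearMap.comp
    ((B z).comp (ContinuousLinearEquiv.ulift (R₁ := ℝ) (M₁ := F)).toContinuousLinearMap)

theorem contDiff_liftCoeff {B : E → F →L[ℝ] F} (hB : ContDiff ℝ ∞ B) :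
    ContDiff ℝ ∞ (liftCoeff B) :=
  contDiff_const.clm_comp (hB.clm_comp contDiff_const)

theorem contDiff_up {v : E → F} {s : Set E} (hv : ContDiffOn ℝ ∞ v s) :
    ContDiffOn ℝ ∞ (fun z => ULift.up.{u} (v z)) s :=
  (ContinuousLinearEquiv.ulift (R₁ := ℝ) (M₁ := F)).symm.toContinuousLinearMap.contDiff.comp_contDiffOn
    hv

theorem contDiff_down {v : E → ULift.{u} F} {s : Set E} (hv : ContDiffOn ℝ ∞ v s) :
    ContDiffOn ℝ ∞ (fun z => (v z).down) s :=
  (ContinuousLinearEquiv.ulift (R₁ := ℝ) (M₁ := F)).toContinuousLinearMap.contDiff.comp_contDiffOn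
    hv

theorem SolvesAlong.up {B : E → F →L[ℝ] F} {v : E → F} {c : ℝ → E} {U : ℝ → F} {S : Set ℝ}
    (h : SolvesAlong B v c U S) :
    SolvesAlong (liftCoeff B) (fun z => ULift.up.{u} (v z)) c (fun t => ULift.up.{u} (U t)) S :=
  fun t ht =>
    (ContinuousLinearEquiv.ulift (R₁ := ℝ) (M₁ := F)).symm.toContinuousLinearMap.hasFDerivAt.comp_hasDerivWithinAt
      t (h t ht)

theorem SolvesAlong.down {B : E → F →L[ℝ] F} {v : E → F} {c : ℝ → E} {U : ℝ → ULift.{u} F}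
    {S : Set ℝ} (h : SolvesAlong (liftCoeff B) (fun z => ULift.up.{u} (v z)) c U S) :
    SolvesAlong B v c (fun t => (U t).down) S :=
  fun t ht =>
    (ContinuousLinearEquiv.ulift (R₁ := ℝ) (M₁ := F)).toContinuousLinearMap.hasFDerivAt.comp_hasDerivWithinAt
      t (h t ht)

/-- Solutions along orbits with smooth initial values depend smoothly on the end point. -/
theorem contDiffOn_of_solvesAlong_lift {X : E → E} {B : E → F →L[ℝ] F} {v : E → F}
    (hX : ContDiff ℝ ∞ X) (hB : ContDiff ℝ ∞ B) (hv : ContDiff ℝ ∞ v)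
    {K D O : Set E} (hK : IsCompact K) (hKc : Convex ℝ K) (hD : IsOpen D) {T : ℝ} (hT : 0 ≤ T)
    {γ : E → ℝ → E} (hγ : IsOrbitFamily X K D T γ) {U : E → ℝ → F}
    (hU : ∀ y ∈ D, SolvesAlong B v (γ y) (U y) (Icc (-T) 0)) {u₀ : E → F}
    (hO : IsOpen O) (hu₀ : ContDiffOn ℝ ∞ u₀ O) (hγO : ∀ y ∈ D, γ y (-T) ∈ O)
    (hU0 : ∀ y ∈ D, U y (-T) = u₀ (γ y (-T))) :
    ContDiffOn ℝ ∞ (fun y => U y 0) D :=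
  contDiff_down (contDiffOn_of_solvesAlong.{u, w} (F := ULift.{u} F) hX (contDiff_liftCoeff hB)
    (contDiffOn_univ.1 (contDiff_up hv.contDiffOn)) hK hKc hD hT hγ
    (U := fun y t => ULift.up (U y t)) (fun y hy => (hU y hy).up)
    (u₀ := fun y => ULift.up (u₀ y)) hO (contDiff_up hu₀) hγO
    (fun y hy => congrArg ULift.up (hU0 y hy)))

theorem iteratedFDeriv_comp_eq_zero {G H : Type*} [NormedAddCommGroup G] [NormedSpace ℝ G]
    [NormedAddCommGroup H] [NormedSpace ℝ H] (e : G ≃L[ℝ] H) {f : E → G} {z : E}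
    (h : ∀ k, iteratedFDeriv ℝ k f z = 0) (k : ℕ) : iteratedFDeriv ℝ k (e ∘ f) z = 0 := by
  rw [e.iteratedFDeriv_comp_left, h k]
  ext
  simp

theorem IsContractedFamily.exists_smooth_flat_solution_lift {X : E → E} {K D : Set E} {z₀ : E}
    {γ : E → ℝ → E} (h : IsContractedFamily X K D z₀ γ) (hX : ContDiff ℝ ∞ X)
    {B : E → F →L[ℝ] F} {v : E → F} (hB : ContDiff ℝ ∞ B) (hv : ContDiff ℝ ∞ v)
    (hflat : ∀ k, iteratedFDeriv ℝ k v z₀ = 0) :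
    ∃ u : E → F, ContDiffOn ℝ ∞ u D ∧ (∀ k, iteratedFDeriv ℝ k u z₀ = 0) ∧
      ∀ y ∈ D, SolvesAlong B v (γ y) (fun t => u (γ y t)) (Iic 0) := by
  obtain ⟨u, hu, huf, hus⟩ := IsContractedFamily.exists_smooth_flat_solution.{u, w}
    (F := ULift.{u} F) h hX (contDiff_liftCoeff hB) (contDiffOn_univ.1 (contDiff_up hv.contDiffOn))
    (iteratedFDeriv_comp_eq_zero (ContinuousLinearEquiv.ulift (R₁ := ℝ) (M₁ := F)).symm hflat)
  exact ⟨fun z => (u z).down, contDiff_down hu,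
    iteratedFDeriv_comp_eq_zero (ContinuousLinearEquiv.ulift (R₁ := ℝ) (M₁ := F)) huf,
    fun y hy => (hus y hy).down⟩

end UniverseLift

/-! ### The Lyapunov form for a nonlinear vector field -/

section LyapunovBall

variable {E : Type*} [NormedAddCommGroup E] [NormedSpace ℝ E] [FiniteDimensional ℝ E]

/-- Half of the linear rate is spent on the Taylor remainder of `f`; `δ` is chosen so that `‖b‖ * δ
≤ ε / 2 * c`. -/
theorem exists_lyapunov_ball {f : E → E} {z₀ : E} (hf : DifferentiableAt ℝ f z₀) (hz : f z₀ = 0)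
    (h : ∀ μ : ℂ, ((fderiv ℝ f z₀).toLinearMap.charpoly.map (algebraMap ℝ ℂ)).IsRoot μ → 0 < μ.re) :
    ∃ b : E →L[ℝ] E →L[ℝ] ℝ, (∀ x y, b x y = b y x) ∧ (∃ c > 0, ∀ z, c * ‖z‖ ^ 2 ≤ b z z) ∧
      ∃ ε > 0, ∃ r > 0, ∀ z ∈ Metric.ball z₀ r, ε * b (z - z₀) (z - z₀) ≤ b (f z) (z - z₀) := by
  obtain ⟨b, hsymm, ⟨c, hc, hcb⟩, ε, hε, hεb⟩ := exists_lyapunov (fderiv ℝ f z₀) h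
  refine ⟨b, hsymm, ⟨c, hc, hcb⟩, ε / 2, by positivity, ?_⟩
  set δ := ε * c / (2 * (‖b‖ + 1)) with hδ
  have hδ0 : 0 < δ := by positivity
  have h1 := hf.hasFDerivAt.isLittleO.def hδ0
  obtain ⟨r, hr, hball⟩ := Metric.mem_nhds_iff.1 h1
  refine ⟨r, hr, fun z hz' => ?_⟩
  have h2 : ‖f z - f z₀ - fderiv ℝ f z₀ (z - z₀)‖ ≤ δ * ‖z - z₀‖ := hball hz'
  rw [hz, sub_zero] at h2
  set y := z - z₀ with hy
  have h3 : b (f z) y = b (fderiv ℝ f z₀ y) y + b (f z - fderiv ℝ f z₀ y) y := by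
    rw [← add_apply, ← map_add, add_sub_cancel]
  have h4 : |b (f z - fderiv ℝ f z₀ y) y| ≤ ‖b‖ * (δ * ‖y‖) * ‖y‖ := by
    refine (b.le_opNorm₂ _ _).trans ?_
    gcongr
  have h5 : ‖b‖ * (δ * ‖y‖) * ‖y‖ ≤ ε / 2 * (c * ‖y‖ ^ 2) := by
    have : ‖b‖ * δ ≤ ε / 2 * c := by
      have hb : (‖b‖ + 1) * δ = ε / 2 * c := by rw [hδ]; field_simp
      nlinarith [norm_nonneg b]
    calc ‖b‖ * (δ * ‖y‖) * ‖y‖ = ‖b‖ * δ * ‖y‖ ^ 2 := by ring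
      _ ≤ ε / 2 * c * ‖y‖ ^ 2 := by gcongr
      _ = _ := by ring
  have h6 := neg_abs_le (b (f z - fderiv ℝ f z₀ y) y)
  have h7 := hεb y
  have h8 : ε / 2 * (c * ‖y‖ ^ 2) ≤ ε / 2 * b y y := by gcongr; exact hcb y
  rw [h3]
  linarith

/-- For `s + t = 1` and the quadratic form `q` of `b`, one has `s q(x) + t q(y) - q(s x + t y) = s t
q(x - y) ≥ 0`. -/
theorem convex_sublevel {b : E →L[ℝ] E →L[ℝ] ℝ} (hsymm : ∀ x y, b x y = b y x)
    (hpos : ∀ z, 0 ≤ b z z) (z₀ : E) (ρ : ℝ) : Convex ℝ {z | b (z - z₀) (z - z₀) ≤ ρ} := by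
  intro x hx y hy s t hs ht hst
  simp only [mem_ofPred_eq] at *
  have e : s • x + t • y - z₀ = s • (x - z₀) + t • (y - z₀) := by
    have : z₀ = s • z₀ + t • z₀ := by rw [← add_smul, hst, one_smul]
    nth_rewrite 1 [this]
    simp only [smul_sub]
    abel
  set X := x - z₀
  set Y := y - z₀
  have h1 := hpos (X - Y)
  have h2 : b (X - Y) (X - Y) = b X X - 2 * b X Y + b Y Y := by
    simp only [map_sub, sub_apply]
    rw [hsymm Y X]
    ring
  have h3 : b (s • X + t • Y) (s • X + t • Y) = s ^ 2 * b X X + 2 * (s * t) * b X Y + t ^ 2 * b Y Y := by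
    simp only [map_add, map_smul, add_apply, smul_apply, smul_eq_mul]
    rw [hsymm Y X]
    ring
  rw [e, h3]
  have hst' : t = 1 - s := by linarith
  subst hst'
  nlinarith [mul_nonneg hs ht]

end LyapunovBall

/-! ### Trapping of backward orbits near the source -/

section Trap

variable {E : Type*} [NormedAddCommGroup E] [NormedSpace ℝ E] [FiniteDimensional ℝ E]
  {M : Type*} [TopologicalSpace M] [ChartedSpace E M] [IsManifold 𝓘(ℝ, E) ∞ M]
  {F : Type*} [NormedAddCommGroup F] [NormedSpace ℝ F] [FiniteDimensional ℝ F]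
  {V : M → Type*} [TopologicalSpace (TotalSpace F V)]
  [∀ x, AddCommGroup (V x)] [∀ x, Module ℝ (V x)] [∀ x, TopologicalSpace (V x)]
  [∀ x, IsTopologicalAddGroup (V x)] [∀ x, ContinuousSMul ℝ (V x)] [FiberBundle F V]
  [VectorBundle ℝ F V] [ContMDiffVectorBundle ∞ F V 𝓘(ℝ, E)]
  {nabla : CovariantDerivative 𝓘(ℝ, E) F V}
  {X : Π x : M, TangentSpace 𝓘(ℝ, E) x} {A : Π x : M, V x →L[ℝ] V x} {p : M}

theorem LocalModel.eventually_symm_mem (m : LocalModel nabla X A p) :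
    ∀ᶠ z in 𝓝 (extChartAt 𝓘(ℝ, E) p p),
      z ∈ (extChartAt 𝓘(ℝ, E) p).target ∧ (extChartAt 𝓘(ℝ, E) p).symm z ∈ m.nhd :=
  (isOpen_extChartAt_target_inter m.isOpen_nhd p).mem_nhds
    ⟨mem_extChartAt_target p, by simpa using m.mem_nhd⟩

theorem LocalModel.linearization_eq (m : LocalModel nabla X A p) :
    linearization X p = fderiv ℝ m.field (extChartAt 𝓘(ℝ, E) p p) := by
  rw [linearization]
  refine Filter.EventuallyEq.fderiv_eq ?_
  filter_upwards [m.eventually_symm_mem] with z hz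
  rw [localRep, ← m.field_eq _ hz.2, (extChartAt 𝓘(ℝ, E) p).right_inv hz.1]

theorem LocalModel.field_eq_zero (m : LocalModel nabla X A p) (hX : X p = 0) :
    m.field (extChartAt 𝓘(ℝ, E) p p) = 0 := by
  rw [m.field_eq p m.mem_nhd, hX]
  exact (coord_eq_zero_iff (V := fun x : M => TangentSpace 𝓘(ℝ, E) x)
    (mem_baseSet_trivializationAt E (TangentSpace 𝓘(ℝ, E)) p)).2 rfl

theorem LocalModel.hasDerivWithinAt_curve (m : LocalModel nabla X A p) {γ : ℝ → M} {s : Set ℝ}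
    (hγ : IsMIntegralCurveOn γ X s) {t : ℝ} (ht : t ∈ s) (hN : γ t ∈ m.nhd) :
    HasDerivWithinAt (fun r => extChartAt 𝓘(ℝ, E) p (γ r))
      (m.field (extChartAt 𝓘(ℝ, E) p (γ t))) s t := by
  rw [m.field_eq _ hN]
  exact ((hasMFDerivWithinAt_curve_iff (m.subset_source hN)).1 (hγ t ht)).2

/-- Near a strictly positive source, backward orbits are trapped in small neighbourhoods, where
they converge exponentially to the source. -/
theorem LocalModel.exists_trap [T2Space M] (m : LocalModel nabla X A p)
    (hp : IsStrictlyPositiveSource X p) {W : Set M} (hW : IsOpen W) (hpW : p ∈ W) :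
    ∃ (K D : Set E) (C ε : ℝ), IsOpen D ∧ extChartAt 𝓘(ℝ, E) p p ∈ D ∧ D ⊆ K ∧ IsCompact K ∧
      Convex ℝ K ∧ K ⊆ (extChartAt 𝓘(ℝ, E) p).target ∧
      (∀ z ∈ K, (extChartAt 𝓘(ℝ, E) p).symm z ∈ W) ∧ 0 ≤ C ∧ 0 < ε ∧
      ∀ γ : ℝ → M, IsBackwardOrbit X γ → γ 0 ∈ (extChartAt 𝓘(ℝ, E) p).source →
        extChartAt 𝓘(ℝ, E) p (γ 0) ∈ D → ∀ t ≤ 0, γ t ∈ (extChartAt 𝓘(ℝ, E) p).source ∧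
          extChartAt 𝓘(ℝ, E) p (γ t) ∈ D ∧
          ‖extChartAt 𝓘(ℝ, E) p (γ t) - extChartAt 𝓘(ℝ, E) p p‖ ≤
            C * ‖extChartAt 𝓘(ℝ, E) p (γ 0) - extChartAt 𝓘(ℝ, E) p p‖ * Real.exp (ε * t) := by
  set φ := extChartAt 𝓘(ℝ, E) p with hφ
  set z₀ := φ p with hz₀
  obtain ⟨hXp, hspec⟩ := hp
  rw [m.linearization_eq] at hspec
  obtain ⟨b, hsymm, ⟨c, hc, hcb⟩, ε, hε, r, hr, hεb⟩ := exists_lyapunov_ball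
    ((m.contDiff_field.differentiable (by simp)) z₀) (m.field_eq_zero hXp) hspec
  have hpos : ∀ z, 0 ≤ b z z := fun z => (by positivity : 0 ≤ c * ‖z‖ ^ 2).trans (hcb z)
  set q : E → ℝ := fun z => b (z - z₀) (z - z₀) with hq
  have hqc : Continuous q := by fun_prop
  -- a small sublevel set
  have hnh : (φ.target ∩ φ.symm ⁻¹' (W ∩ m.nhd)) ∩ Metric.ball z₀ r ∈ 𝓝 z₀ :=
    inter_mem ((isOpen_extChartAt_target_inter (hW.inter m.isOpen_nhd) p).mem_nhds
      ⟨mem_extChartAt_target p, by simpa [hz₀, hφ] using ⟨hpW, m.mem_nhd⟩⟩)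
      (Metric.ball_mem_nhds z₀ hr)
  obtain ⟨r', hr', hball⟩ := Metric.mem_nhds_iff.1 hnh
  -- By coercivity this level confines the sublevel set to the closed ball of radius `r' / 2`, well
  -- inside the region where the chart, `W` and the Lyapunov estimate are available.
  set ρ := c * (r' / 2) ^ 2 with hρ
  have hρ0 : 0 < ρ := by positivity
  have hsub : {z | q z ≤ ρ} ⊆ Metric.closedBall z₀ (r' / 2) := by
    intro z hz
    have h1 := (hcb (z - z₀)).trans hz
    rw [hρ] at h1
    have h2 := le_of_mul_le_mul_left h1 hc
    rw [mem_closedBall_iff_norm]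
    exact le_of_sq_le_sq h2 (by positivity)
  have hsub' : {z | q z ≤ ρ} ⊆ (φ.target ∩ φ.symm ⁻¹' (W ∩ m.nhd)) ∩ Metric.ball z₀ r :=
    fun z hz => hball (Metric.closedBall_subset_ball (by linarith) (hsub hz))
  have hcompact : ∀ ρ' ≤ ρ, IsCompact {z | q z ≤ ρ'} := fun ρ' hρ' =>
    (isCompact_closedBall z₀ (r' / 2)).of_isClosed_subset (isClosed_le hqc continuous_const)
      fun z hz => hsub (hz.trans hρ')
  -- The constant `√(‖b‖ / c)` compares the form with the norm: `c ‖z‖² ≤ b z z ≤ ‖b‖ ‖z‖²`.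
  refine ⟨{z | q z ≤ ρ}, {z | q z < ρ}, Real.sqrt (‖b‖ / c), ε, isOpen_lt hqc continuous_const, ?_,
    fun z (hz : q z < ρ) => hz.le, hcompact ρ le_rfl, convex_sublevel hsymm hpos z₀ ρ,
    fun z hz => (hsub' hz).1.1, fun z hz => (hsub' hz).1.2.1, Real.sqrt_nonneg _, hε, ?_⟩
  · simpa [hq] using hρ0
  intro γ hγ h0s h0D
  have hcont : ContinuousOn γ (Iic 0) := IsMIntegralCurveOn.continuousOn hγ
  -- derivative of `q` along the orbit
  have hder : ∀ t ≤ 0, γ t ∈ φ.source → q (φ (γ t)) ≤ ρ →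
      HasDerivWithinAt (fun r => q (φ (γ r))) (2 * b (m.field (φ (γ t))) (φ (γ t) - z₀)) (Iic 0) t ∧
      ε * q (φ (γ t)) ≤ b (m.field (φ (γ t))) (φ (γ t) - z₀) := by
    intro t ht hts htq
    have hm := hsub' htq
    have hN : γ t ∈ m.nhd := by
      have := hm.1.2.2
      rwa [φ.left_inv hts] at this
    have h1 := (m.hasDerivWithinAt_curve hγ ht hN).sub_const z₀
    have h2 := (b.hasFDerivAt.comp_hasDerivWithinAt t h1).clm_apply h1
    refine ⟨h2.congr_deriv ?_, hεb _ hm.2⟩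
    simp only [Function.comp]
    rw [hsymm (φ (γ t) - z₀) (m.field (φ (γ t)))]
    ring
  set q₀ := q (φ (γ 0)) with hq₀
  have hq₀ρ : q₀ < ρ := h0D
  -- the orbit stays in a compact sublevel set
  set Cset : Set M := φ.symm '' {z | q z ≤ q₀} with hCset
  have hCc : IsClosed Cset := by
    refine ((hcompact q₀ hq₀ρ.le).image_of_continuousOn ?_).isClosed
    exact (continuousOn_extChartAt_symm p).mono fun z hz => (hsub' (le_trans hz hq₀ρ.le)).1.1
  have hCmem : ∀ x, x ∈ Cset ↔ x ∈ φ.source ∧ q (φ x) ≤ q₀ := by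
    intro x
    constructor
    · rintro ⟨z, hz, rfl⟩
      have hzt : z ∈ φ.target := (hsub' (le_trans hz hq₀ρ.le)).1.1
      exact ⟨φ.map_target hzt, by rw [φ.right_inv hzt]; exact hz⟩
    · rintro ⟨h1, h2⟩
      exact ⟨φ x, h2, φ.left_inv h1⟩
  have hstay : ∀ t ≤ 0, γ t ∈ Cset := by
    intro t ht
    -- Continuation in reversed time. The compact sublevel set has closed image in the Hausdorff
    -- space `M`, so the orbit cannot escape through the edge of the chart; monotonicity of `q` lets
    -- it continue.
    have hcl : IsClosed ({τ | γ (-τ) ∈ Cset} ∩ Icc 0 (-t)) := by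
      have : ContinuousOn (fun τ : ℝ => γ (-τ)) (Icc 0 (-t)) :=
        hcont.comp continuousOn_neg fun τ hτ => by simpa using hτ.1
      rw [inter_comm]
      exact this.preimage_isClosed_of_isClosed isClosed_Icc hCc
    have := hcl.Icc_subset_of_forall_exists_gt (a := 0) (b := -t)
      (by simpa using (hCmem _).2 ⟨h0s, le_rfl⟩) ?_ (right_mem_Icc.2 (by linarith : (0 : ℝ) ≤ -t))
    · simpa using this
    rintro τ ⟨hτC, hτ0, hτt⟩ y hy
    obtain ⟨hs, hqτ⟩ := (hCmem _).1 (show γ (-τ) ∈ Cset from hτC)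
    have hτ' : -τ ∈ Iic (0 : ℝ) := by simpa using hτ0
    have hev : ∀ᶠ r in 𝓝[Iic 0] (-τ), γ r ∈ φ.source ∩ φ ⁻¹' {z | q z < ρ} :=
      (hcont (-τ) hτ').preimage_mem_nhdsWithin ((isOpen_extChartAt_source_inter
        (isOpen_lt hqc continuous_const) p).mem_nhds ⟨hs, hqτ.trans_lt hq₀ρ⟩)
    obtain ⟨δ, hδ, hδball⟩ := Metric.mem_nhdsWithin_iff.1 hev
    set d := min (δ / 2) (y - τ) with hd
    have hd0 : 0 < d := lt_min (by positivity) (by linarith [mem_Ioi.1 hy])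
    refine ⟨τ + d, ?_, by linarith, by linarith [min_le_right (δ / 2) (y - τ)]⟩
    have hIcc : ∀ r ∈ Icc (-(τ + d)) (-τ), r ≤ 0 ∧ γ r ∈ φ.source ∧ q (φ (γ r)) < ρ := by
      intro r hr
      have hr0 : r ≤ 0 := hr.2.trans hτ'
      refine ⟨hr0, hδball ⟨?_, hr0⟩⟩
      rw [Metric.mem_ball, Real.dist_eq, abs_lt]
      constructor <;> linarith [hr.1, hr.2, min_le_left (δ / 2) (y - τ)]
    have hmono : MonotoneOn (fun r => q (φ (γ r))) (Icc (-(τ + d)) (-τ)) := by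
      refine monotoneOn_of_hasDerivWithinAt_nonneg (convex_Icc _ _)
        (f' := fun r => 2 * b (m.field (φ (γ r))) (φ (γ r) - z₀))
        (fun r hr => ?_) (fun r hr => ?_) (fun r hr => ?_)
      · obtain ⟨h1, h2, h3⟩ := hIcc r hr
        exact ((hder r h1 h2 h3.le).1.mono fun x hx => (hIcc x hx).1).continuousWithinAt
      · obtain ⟨h1, h2, h3⟩ := hIcc r (interior_subset hr)
        exact (hder r h1 h2 h3.le).1.mono fun x hx => (hIcc x (interior_subset hx)).1
      · obtain ⟨h1, h2, h3⟩ := hIcc r (interior_subset hr)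
        have := (hder r h1 h2 h3.le).2
        have h4 : 0 ≤ ε * q (φ (γ r)) := mul_nonneg hε.le (hpos _)
        linarith
    have hl : -(τ + d) ∈ Icc (-(τ + d)) (-τ) := ⟨le_rfl, by linarith⟩
    have hr' : -τ ∈ Icc (-(τ + d)) (-τ) := ⟨by linarith, le_rfl⟩
    exact (hCmem _).2 ⟨(hIcc _ hl).2.1, (hmono hl hr' (by linarith)).trans hqτ⟩
  have hall : ∀ t ≤ 0, γ t ∈ φ.source ∧ q (φ (γ t)) ≤ q₀ := fun t ht => (hCmem _).1 (hstay t ht)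
  -- exponential decay
  have hmono : MonotoneOn (fun t => q (φ (γ t)) * Real.exp (-(2 * ε) * t)) (Iic 0) := by
    have hd : ∀ t ≤ 0, HasDerivWithinAt (fun t => q (φ (γ t)) * Real.exp (-(2 * ε) * t))
        (2 * b (m.field (φ (γ t))) (φ (γ t) - z₀) * Real.exp (-(2 * ε) * t) +
          q (φ (γ t)) * (Real.exp (-(2 * ε) * t) * (-(2 * ε) * 1))) (Iic 0) t := by
      intro t ht
      obtain ⟨h1, h2⟩ := hall t ht
      exact (hder t ht h1 (h2.trans hq₀ρ.le)).1.fun_mul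
        (((hasDerivAt_id t).const_mul (-(2 * ε))).exp.hasDerivWithinAt)
    refine monotoneOn_of_hasDerivWithinAt_nonneg (convex_Iic 0) (fun t ht =>
      (hd t ht).continuousWithinAt) (fun t ht => (hd t (mem_Iic.1 (interior_subset ht))).mono interior_subset)
      (fun t ht => ?_)
    have ht : t ≤ 0 := mem_Iic.1 (interior_subset ht)
    obtain ⟨h1, h2⟩ := hall t ht
    have h3 := (hder t ht h1 (h2.trans hq₀ρ.le)).2
    have h4 := Real.exp_pos (-(2 * ε) * t)
    nlinarith
  intro t ht
  obtain ⟨h1, h2⟩ := hall t ht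
  refine ⟨h1, h2.trans_lt hq₀ρ, ?_⟩
  have h3 := hmono ht (mem_Iic.2 (le_refl (0 : ℝ))) ht
  simp only [mul_zero, Real.exp_zero, mul_one] at h3
  have h4 : q (φ (γ t)) ≤ q₀ * Real.exp (ε * t) ^ 2 := by
    have e : Real.exp (-(2 * ε) * t) * Real.exp (ε * t) ^ 2 = 1 := by
      rw [← Real.exp_nat_mul, ← Real.exp_add]
      have : -(2 * ε) * t + ((2 : ℕ) : ℝ) * (ε * t) = 0 := by push_cast; ring
      rw [this, Real.exp_zero]
    calc q (φ (γ t)) = q (φ (γ t)) * (Real.exp (-(2 * ε) * t) * Real.exp (ε * t) ^ 2) := by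
          rw [e, mul_one]
      _ = q (φ (γ t)) * Real.exp (-(2 * ε) * t) * Real.exp (ε * t) ^ 2 := by ring
      _ ≤ q₀ * Real.exp (ε * t) ^ 2 := by gcongr
  have h5 : q₀ ≤ ‖b‖ * ‖φ (γ 0) - z₀‖ ^ 2 := by
    refine (le_abs_self _).trans ((b.le_opNorm₂ _ _).trans (le_of_eq ?_))
    ring
  have h6 : ‖φ (γ t) - z₀‖ ^ 2 ≤
      (Real.sqrt (‖b‖ / c) * ‖φ (γ 0) - z₀‖ * Real.exp (ε * t)) ^ 2 := by
    rw [mul_pow, mul_pow, Real.sq_sqrt (by positivity)]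
    have h7 := (hcb (φ (γ t) - z₀)).trans h4
    rw [div_mul_eq_mul_div, div_mul_eq_mul_div, le_div_iff₀ hc, mul_comm]
    exact h7.trans (by gcongr)
  exact le_of_sq_le_sq h6 (by positivity)

end Trap

/-! ### Solving the equation near the source -/

section NearSource

variable {E : Type*} [NormedAddCommGroup E] [NormedSpace ℝ E] [FiniteDimensional ℝ E]
  {M : Type*} [TopologicalSpace M] [ChartedSpace E M] [IsManifold 𝓘(ℝ, E) ∞ M]
  {F : Type*} [NormedAddCommGroup F] [NormedSpace ℝ F] [FiniteDimensional ℝ F]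
  {V : M → Type*} [TopologicalSpace (TotalSpace F V)]
  [∀ x, AddCommGroup (V x)] [∀ x, Module ℝ (V x)] [∀ x, TopologicalSpace (V x)]
  [∀ x, IsTopologicalAddGroup (V x)] [∀ x, ContinuousSMul ℝ (V x)] [FiberBundle F V]
  [VectorBundle ℝ F V] [ContMDiffVectorBundle ∞ F V 𝓘(ℝ, E)]
  {nabla : CovariantDerivative 𝓘(ℝ, E) F V}
  {X : Π x : M, TangentSpace 𝓘(ℝ, E) x} {A : Π x : M, V x →L[ℝ] V x} {p : M} {U : Set M}

/-- Reparametrization by (a map which coincides with) a translation. -/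
theorem SolvesOn.comp_reparam (m : ∀ x₀, LocalModel nabla X A x₀) {γ : ℝ → M}
    {η w : Π t, V (γ t)} {s s' : Set ℝ} (h : SolvesOn nabla X A γ η w s) {g : ℝ → ℝ}
    (hg : ∀ t ∈ s', HasDerivWithinAt g 1 s' t) (hm : MapsTo g s' s) :
    SolvesOn nabla X A (fun t => γ (g t)) (fun t => η (g t)) (fun t => w (g t)) s' := by
  intro t ht
  have hN := (m (γ (g t))).mem_nhd
  obtain ⟨h1, h2, h3⟩ := ((m (γ (g t))).hasCovDerivAlong_iff hN).1 (h (g t) (hm ht))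
  refine ((m (γ (g t))).hasCovDerivAlong_iff (γ := fun t => γ (g t)) hN).2 ⟨?_, ?_, ?_⟩
  · exact h1.comp (hg t ht).continuousWithinAt hm
  · simpa [Function.comp_def] using h2.scomp t (hg t ht) hm
  · simpa [Function.comp_def] using h3.scomp t (hg t ht) hm

theorem IsMIntegralCurveOn.comp_reparam {γ : ℝ → M} {s s' : Set ℝ}
    (h : IsMIntegralCurveOn γ X s) {g : ℝ → ℝ}
    (hg : ∀ t ∈ s', HasDerivWithinAt g 1 s' t) (hm : MapsTo g s' s) :
    IsMIntegralCurveOn (fun t => γ (g t)) X s' := by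
  intro t ht
  have hN : γ (g t) ∈ (extChartAt 𝓘(ℝ, E) (γ (g t))).source := mem_extChartAt_source _
  obtain ⟨h1, h2⟩ := (hasMFDerivWithinAt_curve_iff hN).1 (h (g t) (hm ht))
  refine (hasMFDerivWithinAt_curve_iff (γ := fun t => γ (g t)) hN).2 ⟨?_, ?_⟩
  · exact h1.comp (hg t ht).continuousWithinAt hm
  · simpa [Function.comp_def] using h2.scomp t (hg t ht) hm

/-- Truncating by `min t 0` freezes the shifted curve for positive times. Orbits normalized in this
way are equal as functions once their backward parts agree, as `IsTransported.unique` needs. -/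
theorem hasDerivWithinAt_min_add (a : ℝ) {t : ℝ} (ht : t ∈ Iic (0 : ℝ)) :
    HasDerivWithinAt (fun t : ℝ => min t 0 + a) 1 (Iic 0) t :=
  ((hasDerivWithinAt_id t (Iic 0)).add_const a).congr
    (fun r hr => by simp [min_eq_left (mem_Iic.1 hr)]) (by simp [min_eq_left (mem_Iic.1 ht)])

theorem mapsTo_min_add {a : ℝ} (ha : a ≤ 0) :
    MapsTo (fun t : ℝ => min t 0 + a) (Iic 0) (Iic 0) :=
  fun t _ => by
    have : min t 0 ≤ 0 := min_le_right _ _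
    simp only [mem_Iic]; linarith

theorem IsBackwardOrbit.shift {γ : ℝ → M} (h : IsBackwardOrbit X γ) {a : ℝ} (ha : a ≤ 0) :
    IsBackwardOrbit X (fun t => γ (min t 0 + a)) :=
  IsMIntegralCurveOn.comp_reparam h (fun _ ht => hasDerivWithinAt_min_add a ht) (mapsTo_min_add ha)

/-- In a star-shaped set, backward orbits are determined by their end point, stay in the set and
converge to the centre. -/
theorem IsStarShaped.orbit [T2Space M] (m : ∀ x₀, LocalModel nabla X A x₀)
    (hU : IsStarShaped X p U) {γ : ℝ → M} (hγ : IsBackwardOrbit X γ) (h0 : γ 0 ∈ U) :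
    Tendsto γ atBot (𝓝 p) ∧ ∀ t ≤ 0, γ t ∈ U := by
  obtain ⟨γ', hγ'0, hγ', hlim, hmem⟩ := hU.2.2 _ h0
  have heq : ∀ t ≤ 0, γ' t = γ t := fun t ht =>
    eqOn_of_isMIntegralCurveOn m ordConnected_Iic hγ' hγ (mem_Iic.2 le_rfl) ht hγ'0
  refine ⟨hlim.congr' ?_, fun t ht => heq t ht ▸ hmem t ht⟩
  filter_upwards [Iic_mem_atBot 0] with t ht using heq t ht

/-- A smooth section in local coordinates, extended to the whole model space. -/
theorem exists_contDiff_coord {σ : Π x : M, V x} (hU : IsOpen U)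
    (hσ : IsSmoothSectionOn (E := E) F U σ) {x₀ : M} (hx₀ : x₀ ∈ U) :
    ∃ g : E → F, ContDiff ℝ ∞ g ∧ ∃ N, IsOpen N ∧ x₀ ∈ N ∧ N ⊆ U ∧
      N ⊆ (extChartAt 𝓘(ℝ, E) x₀).source ∧
      ∀ x ∈ N, g (extChartAt 𝓘(ℝ, E) x₀ x) =
        (trivializationAt F V x₀ (TotalSpace.mk' F x (σ x))).2 := by
  obtain ⟨g, hg, N, hN, hNo, hxN, hgN⟩ := exists_contDiff_extChartAt_eq
    (hU.inter (trivializationAt F V x₀).open_baseSet) (contMDiffOn_coord x₀ hσ hU)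
    ⟨hx₀, mem_baseSet_trivializationAt F V x₀⟩
  exact ⟨g, hg, N, hNo, hxN, fun x hx => (hN hx).1.1, fun x hx => (hN hx).2, hgN⟩

theorem localRep_eventuallyEq {σ : Π x : M, V x} {g : E → F} {N : Set M} (hN : IsOpen N)
    (hp : p ∈ N) (h : ∀ x ∈ N, g (extChartAt 𝓘(ℝ, E) p x) =
      (trivializationAt F V p (TotalSpace.mk' F x (σ x))).2) :
    localRep (E := E) F p σ =ᶠ[𝓝 (extChartAt 𝓘(ℝ, E) p p)] g := by
  filter_upwards [(isOpen_extChartAt_target_inter hN p).mem_nhds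
    ⟨mem_extChartAt_target p, by simpa using hp⟩] with z hz
  rw [localRep, ← h _ hz.2, (extChartAt 𝓘(ℝ, E) p).right_inv hz.1]

theorem isFlatAt_iff {σ : Π x : M, V x} {g : E → F} {N : Set M} (hN : IsOpen N)
    (hp : p ∈ N) (h : ∀ x ∈ N, g (extChartAt 𝓘(ℝ, E) p x) =
      (trivializationAt F V p (TotalSpace.mk' F x (σ x))).2) :
    IsFlatAt (E := E) F p σ ↔ ∀ k, iteratedFDeriv ℝ k g (extChartAt 𝓘(ℝ, E) p p) = 0 := by
  have := localRep_eventuallyEq hN hp h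
  refine forall_congr' fun k => ?_
  rw [(this.iteratedFDeriv ℝ k).self_of_nhds]

/-- The equation can be solved near the source by a section which is flat at the source. -/
theorem exists_local_solution [T2Space M] (m : ∀ x₀, LocalModel nabla X A x₀)
    (hp : IsStrictlyPositiveSource X p) (hU : IsStarShaped X p U) {v : Π x : M, V x}
    (hv : IsSmoothSectionOn (E := E) F U v) (hflat : IsFlatAt (E := E) F p v) :
    ∃ (S : Set M) (u : Π x : M, V x), IsOpen S ∧ p ∈ S ∧ S ⊆ U ∧
      IsSmoothSectionOn (E := E) F S u ∧ IsFlatAt (E := E) F p u ∧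
      ∀ γ : ℝ → M, IsBackwardOrbit X γ → γ 0 ∈ S → (∀ t ≤ 0, γ t ∈ S) ∧
        SolvesOn nabla X A γ (fun t => v (γ t)) (fun t => u (γ t)) (Iic 0) := by
  obtain ⟨vh, hvh, Nv, hNvo, hpNv, hNvU, -, hvN⟩ := exists_contDiff_coord hU.1 hv hU.2.1
  have hvflat := (isFlatAt_iff hNvo hpNv hvN).1 hflat
  have hWo : IsOpen (Nv ∩ (m p).nhd) := hNvo.inter (m p).isOpen_nhd
  have hpW : p ∈ Nv ∩ (m p).nhd := ⟨hpNv, (m p).mem_nhd⟩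
  set φ := extChartAt 𝓘(ℝ, E) p with hφ
  set z₀ := φ p with hz₀
  obtain ⟨K, D, C, ε, hDo, hz₀D, hDK, hKc, hKconv, hKt, hKW, hC, hε, htrap⟩ :=
    (m p).exists_trap hp hWo hpW
  set S : Set M := φ.source ∩ φ ⁻¹' D with hS
  have hSo : IsOpen S := isOpen_extChartAt_source_inter hDo p
  have hSW : S ⊆ Nv ∩ (m p).nhd := fun x hx => by
    have := hKW _ (hDK hx.2)
    rwa [φ.left_inv hx.1] at this
  have hSU : S ⊆ U := fun x hx => hNvU (hSW hx).1
  have hSb : S ⊆ (trivializationAt F V p).baseSet := fun x hx => (m p).subset_baseSet (hSW hx).2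
  have hDS : ∀ z ∈ D, φ.symm z ∈ S := fun z hz =>
    ⟨φ.map_target (hKt (hDK hz)), by rw [mem_preimage, φ.right_inv (hKt (hDK hz))]; exact hz⟩
  choose! orb horb0 horb horblim horbU using hU.2.2
  have hstay : ∀ γ : ℝ → M, IsBackwardOrbit X γ → γ 0 ∈ S → ∀ t ≤ 0, γ t ∈ S :=
    fun γ hγ h0 t ht => ⟨(htrap γ hγ h0.1 h0.2 t ht).1, (htrap γ hγ h0.1 h0.2 t ht).2.1⟩
  have horbeq : ∀ γ : ℝ → M, IsBackwardOrbit X γ → γ 0 ∈ S → ∀ t ≤ 0, orb (γ 0) t = γ t :=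
    fun γ hγ h0 t ht => eqOn_of_isMIntegralCurveOn m ordConnected_Iic (horb _ (hSU h0)) hγ
      (mem_Iic.2 le_rfl) ht (horb0 _ (hSU h0))
  have horbS : ∀ z ∈ D, orb (φ.symm z) 0 ∈ S := fun z hz => by
    rw [horb0 _ (hSU (hDS z hz))]; exact hDS z hz
  -- Backward orbits read in the chart. Trapping gives invariance and contraction, and uniqueness of
  -- orbits gives the semigroup law.
  have hfam : IsContractedFamily (m p).field K D z₀ (fun z t => φ (orb (φ.symm z) t)) :=
    { isOpen := hDo
      mem := hz₀D
      subset := hDK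
      isCompact := hKc
      convex := hKconv
      apply_zero := fun z hz => by
        rw [horb0 _ (hSU (hDS z hz)), φ.right_inv (hKt (hDK hz))]
      mapsTo := fun z hz t ht =>
        (hstay _ (horb _ (hSU (hDS z hz))) (horbS z hz) t ht).2
      hasDeriv := fun z hz t ht => (m p).hasDerivWithinAt_curve (horb _ (hSU (hDS z hz))) ht
        (hSW (hstay _ (horb _ (hSU (hDS z hz))) (horbS z hz) t ht)).2
      semigroup := fun z hz t ht s hs => by
        have h1 := hstay _ (horb _ (hSU (hDS z hz))) (horbS z hz) t ht
        rw [φ.left_inv h1.1]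
        have h2 := IsBackwardOrbit.shift (horb _ (hSU (hDS z hz))) ht
        have h3 := horbeq _ h2 (by simpa using h1) s hs
        simp only [min_self, zero_add, min_eq_left hs] at h3
        rw [h3, add_comm]
      contract := ⟨C, ε, hC, hε, fun z hz t ht => by
        have := (htrap _ (horb _ (hSU (hDS z hz))) (horbS z hz).1 (horbS z hz).2 t ht).2.2
        rwa [horb0 _ (hSU (hDS z hz)), φ.right_inv (hKt (hDK hz))] at this⟩ }
  obtain ⟨uh, huh, huflat, husol⟩ := hfam.exists_smooth_flat_solution_lift (m p).contDiff_field
    (m p).contDiff_coeff hvh hvflat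
  let u : Π x : M, V x := fun x => (trivializationAt F V p).symmL ℝ x (uh (φ x))
  have hu : ∀ x ∈ S, uh (φ x) = (trivializationAt F V p (TotalSpace.mk' F x (u x))).2 :=
    fun x hx => (coord_symmL (hSb hx) _).symm
  have hpS : p ∈ S := ⟨mem_extChartAt_source p, hz₀D⟩
  refine ⟨S, u, hSo, hpS, hSU, ?_, (isFlatAt_iff hSo hpS hu).2 huflat, fun γ hγ h0 =>
    ⟨hstay γ hγ h0, fun t ht => ?_⟩⟩
  · refine ((trivializationAt F V p).contMDiffOn_section_iff hSo hSb).2 ?_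
    refine ContMDiffOn.congr (f := fun x => uh (φ x)) ?_ fun x hx => (hu x hx).symm
    exact huh.contMDiffOn.comp ((contMDiffOn_extChartAt (I := 𝓘(ℝ, E)) (n := ∞)).mono
      fun x hx => by have := hx.1; rwa [hφ, extChartAt_source] at this) fun x hx => hx.2
  · have ht' : t ≤ 0 := ht
    have hγS := hstay γ hγ h0
    refine ((m p).hasCovDerivAlong_iff (hSW (hγS t ht)).2).2
      ⟨(hγ t ht).continuousWithinAt, (m p).hasDerivWithinAt_curve hγ ht (hSW (hγS t ht)).2, ?_⟩
    have h1 := husol (φ (γ 0)) h0.2 t ht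
    simp only [φ.left_inv h0.1] at h1
    have heq : ∀ r ≤ 0, orb (γ 0) r = γ r := fun r hr => horbeq γ hγ h0 r hr
    rw [heq t ht'] at h1
    have h2 : HasDerivWithinAt
        (fun r => (trivializationAt F V p (TotalSpace.mk' F (γ r) (u (γ r)))).2) _ (Iic 0) t :=
      h1.congr (fun r hr => by rw [heq r hr, hu _ (hγS r hr)]) (by rw [heq t ht', hu _ (hγS t ht)])
    refine h2.congr_deriv ?_
    rw [hvN _ (hSW (hγS t ht)).1, hu _ (hγS t ht)]
    abel

end NearSource

/-! ### Flat solutions of homogeneous equations vanish -/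

section Uniqueness

variable {E : Type*} [NormedAddCommGroup E] [NormedSpace ℝ E] [FiniteDimensional ℝ E]
  {M : Type*} [TopologicalSpace M] [ChartedSpace E M] [IsManifold 𝓘(ℝ, E) ∞ M]
  {F : Type*} [NormedAddCommGroup F] [NormedSpace ℝ F] [FiniteDimensional ℝ F]
  {V : M → Type*} [TopologicalSpace (TotalSpace F V)]
  [∀ x, AddCommGroup (V x)] [∀ x, Module ℝ (V x)] [∀ x, TopologicalSpace (V x)]
  [∀ x, IsTopologicalAddGroup (V x)] [∀ x, ContinuousSMul ℝ (V x)] [FiberBundle F V]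
  [VectorBundle ℝ F V] [ContMDiffVectorBundle ∞ F V 𝓘(ℝ, E)]
  {nabla : CovariantDerivative 𝓘(ℝ, E) F V}
  {X : Π x : M, TangentSpace 𝓘(ℝ, E) x} {A : Π x : M, V x →L[ℝ] V x} {p : M} {U : Set M}

theorem IsSmoothSectionOn.mdifferentiableAt {σ : Π x : M, V x} (hU : IsOpen U)
    (hσ : IsSmoothSectionOn (E := E) F U σ) {x : M} (hx : x ∈ U) :
    MDifferentiableAt 𝓘(ℝ, E) (𝓘(ℝ, E).prod 𝓘(ℝ, F)) (fun y => TotalSpace.mk' F y (σ y)) x :=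
  (ContMDiffOn.contMDiffAt hσ (hU.mem_nhds hx)).mdifferentiableAt (by simp)

/-- A section along an integral curve. -/
theorem solvesOn_section {σ : Π x : M, V x} (hU : IsOpen U)
    (hσ : IsSmoothSectionOn (E := E) F U σ) {γ : ℝ → M} {s : Set ℝ} (hγ : IsMIntegralCurveOn γ X s)
    (hγU : ∀ t ∈ s, γ t ∈ U) :
    SolvesOn nabla X A γ (fun t => nablaAdd nabla X A σ (γ t)) (fun t => σ (γ t)) s :=
  fun t ht => hasCovDerivAlong_section A (hσ.mdifferentiableAt hU (hγU t ht)) (hγ t ht)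

/-- Flat sections decay faster than any exponential along backward orbits. -/
theorem exists_coord_decay [T2Space M] (m : ∀ x₀, LocalModel nabla X A x₀)
    (hp : IsStrictlyPositiveSource X p) (hU : IsStarShaped X p U) {σ : Π x : M, V x}
    (hσ : IsSmoothSectionOn (E := E) F U σ) (hflat : IsFlatAt (E := E) F p σ) {γ : ℝ → M}
    (hγ : IsBackwardOrbit X γ) (h0 : γ 0 ∈ U) (N : ℝ) :
    ∃ C, 0 ≤ C ∧ ∀ᶠ t in atBot,
      ‖(trivializationAt F V p (TotalSpace.mk' F (γ t) (σ (γ t)))).2‖ ≤ C * Real.exp (N * t) := by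
  obtain ⟨g, hg, Nσ, hNo, hpN, -, -, hgN⟩ := exists_contDiff_coord hU.1 hσ hU.2.1
  have hgflat := (isFlatAt_iff hNo hpN hgN).1 hflat
  set φ := extChartAt 𝓘(ℝ, E) p with hφ
  set z₀ := φ p with hz₀
  obtain ⟨K, D, C, ε, hDo, hz₀D, hDK, hKc, -, -, hKW, hC, hε, htrap⟩ := (m p).exists_trap hp hNo hpN
  obtain ⟨hlim, -⟩ := hU.orbit m hγ h0
  have hSo : IsOpen (φ.source ∩ φ ⁻¹' D) := isOpen_extChartAt_source_inter hDo p
  -- The trap only applies to orbits ending inside it, so the orbit is shifted to a time `a` when it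
  -- has entered. The factor `exp (-(ε * a))` goes into the constant.
  obtain ⟨a, haS, ha0⟩ := ((hlim.eventually (hSo.mem_nhds ⟨mem_extChartAt_source p, hz₀D⟩)).and
    (Iic_mem_atBot (0 : ℝ))).exists
  have ha0 : a ≤ 0 := ha0
  obtain ⟨R, hR⟩ := hKc.isBounded.subset_closedBall z₀
  obtain ⟨k, hk⟩ := exists_nat_ge (N / ε)
  have hk' : N ≤ ε * k := by rwa [div_le_iff₀ hε, mul_comm] at hk
  obtain ⟨C', hC', hflatC⟩ := exists_norm_le_pow_of_flat hg hgflat R k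
  set d := ‖φ (γ a) - z₀‖ with hd
  refine ⟨C' * (C * d * Real.exp (-(ε * a))) ^ k, by positivity, ?_⟩
  filter_upwards [Iic_mem_atBot a] with t hta
  have hta : t ≤ a := hta
  have ht0 : t - a ≤ 0 := by linarith
  obtain ⟨h1, h2, h3⟩ := htrap _ (hγ.shift ha0) (by simp only [min_self, zero_add]; exact haS.1)
    (by simp only [min_self, zero_add]; exact haS.2) (t - a) ht0
  simp only [min_eq_left ht0, sub_add_cancel, min_self, zero_add] at h1 h2 h3
  have hN : γ t ∈ Nσ := by
    have := hKW _ (hDK h2)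
    rwa [φ.left_inv h1] at this
  rw [← hgN _ hN]
  have h4 : Real.exp (ε * (t - a)) = Real.exp (-(ε * a)) * Real.exp (ε * t) := by
    rw [← Real.exp_add]; ring_nf
  rw [h4, ← mul_assoc] at h3
  calc ‖g (φ (γ t))‖ ≤ C' * ‖φ (γ t) - z₀‖ ^ k := hflatC _ (hR (hDK h2))
    _ ≤ C' * (C * d * Real.exp (-(ε * a)) * Real.exp (ε * t)) ^ k := by gcongr
    _ = C' * (C * d * Real.exp (-(ε * a))) ^ k * Real.exp (ε * k * t) := by
        rw [mul_pow _ (Real.exp (ε * t)), ← Real.exp_nat_mul, ← mul_assoc,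
          show (k : ℝ) * (ε * t) = ε * k * t by ring]
    _ ≤ C' * (C * d * Real.exp (-(ε * a))) ^ k * Real.exp (N * t) := by
        gcongr ?_ * Real.exp ?_
        nlinarith

theorem eventually_norm_coeff_le (m : LocalModel nabla X A p) {γ : ℝ → M}
    (hlim : Tendsto γ atBot (𝓝 p)) :
    ∀ᶠ t in atBot, γ t ∈ m.nhd ∧ ‖m.coeff (extChartAt 𝓘(ℝ, E) p (γ t))‖ ≤
      ‖m.coeff (extChartAt 𝓘(ℝ, E) p p)‖ + 1 := by
  have hK' : ∀ᶠ y in 𝓝 p, ‖m.coeff (extChartAt 𝓘(ℝ, E) p y)‖ <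
      ‖m.coeff (extChartAt 𝓘(ℝ, E) p p)‖ + 1 := by
    have : ContinuousAt (fun y => ‖m.coeff (extChartAt 𝓘(ℝ, E) p y)‖) p :=
      (m.contDiff_coeff.continuous.continuousAt.comp (continuousAt_extChartAt p)).norm
    exact this.eventually_lt continuousAt_const (lt_add_one _)
  filter_upwards [hlim.eventually (inter_mem (m.isOpen_nhd.mem_nhds m.mem_nhd) hK')] with t ht
  exact ⟨ht.1, le_of_lt ht.2⟩

/-- A flat section satisfying a homogeneous linear equation vanishes. -/
theorem eq_zero_of_flat [T2Space M] (m : ∀ x₀, LocalModel nabla X A x₀)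
    (hp : IsStrictlyPositiveSource X p) (hU : IsStarShaped X p U) {σ η : Π x : M, V x}
    (hσ : IsSmoothSectionOn (E := E) F U σ) (hflat : IsFlatAt (E := E) F p σ)
    (heq : ∀ x ∈ U, nablaAdd nabla X A σ x = η x) {C : ℝ}
    (hη : ∀ x₀, ∀ x ∈ U, x ∈ (trivializationAt F V x₀).baseSet →
      ‖(trivializationAt F V x₀ (TotalSpace.mk' F x (η x))).2‖ ≤
        C * ‖(trivializationAt F V x₀ (TotalSpace.mk' F x (σ x))).2‖) :
    ∀ x ∈ U, σ x = 0 := by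
  intro x hx
  obtain ⟨γ, rfl, hγ, hlim, hγU⟩ := hU.2.2 x hx
  have hsol : SolvesOn nabla X A γ (fun t => η (γ t)) (fun t => σ (γ t)) (Iic 0) := by
    intro t ht
    have := solvesOn_section (nabla := nabla) (A := A) hU.1 hσ hγ hγU t ht
    simp only [heq _ (hγU t ht)] at this
    exact this
  set K := ‖(m p).coeff (extChartAt 𝓘(ℝ, E) p p)‖ + 1 with hK
  -- Near `-∞` the source contributes at most `C` and the coefficient at most `K` to the growth
  -- rate, and the decay beats their sum by one. The section vanishes there, and zeros propagate to
  -- time zero.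
  obtain ⟨C', hC', hdec⟩ := exists_coord_decay m hp hU hσ hflat hγ hx (C + K + 1)
  obtain ⟨b, hb⟩ := ((hdec.and (eventually_norm_coeff_le (m p) hlim)).and
    (Iic_mem_atBot (0 : ℝ))).exists_forall_of_atBot
  have hb0 : b ≤ 0 := (hb b le_rfl).2
  have hzero := eq_zero_of_decaying (b := b) (K := C + K) (C := C')
    (f := fun t => (trivializationAt F V p (TotalSpace.mk' F (γ t) (σ (γ t)))).2)
    (f' := fun t => (trivializationAt F V p (TotalSpace.mk' F (γ t) (η (γ t)))).2 -
      (m p).coeff (extChartAt 𝓘(ℝ, E) p (γ t))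
        (trivializationAt F V p (TotalSpace.mk' F (γ t) (σ (γ t)))).2)
    (fun t ht => (((m p).hasCovDerivAlong_iff (hb t ht).1.2.1).1
      (hsol t (hb t ht).2)).2.2.mono (Iic_subset_Iic.2 hb0))
    (fun t ht => by
      refine (norm_sub_le _ _).trans ?_
      rw [add_mul]
      exact add_le_add (hη p _ (hγU t (hb t ht).2) ((m p).subset_baseSet (hb t ht).1.2.1))
        (((m p).coeff _).le_of_opNorm_le (hb t ht).1.2.2 _))
    (fun t ht => (hb t ht).1.1) (le_refl b)
  exact SolvesOn.eq_zero m ordConnected_Iic hsol (C := C) (fun x₀ t ht hb => hη x₀ _ (hγU t ht) hb)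
    (mem_Iic.2 hb0) (mem_Iic.2 le_rfl)
    ((coord_eq_zero_iff ((m p).subset_baseSet (hb b le_rfl).1.2.1)).1 hzero)

end Uniqueness

/-! ### Extension of the solution along orbits -/

section Transport

variable {E : Type*} [NormedAddCommGroup E] [NormedSpace ℝ E] [FiniteDimensional ℝ E]
  {M : Type*} [TopologicalSpace M] [ChartedSpace E M] [IsManifold 𝓘(ℝ, E) ∞ M]
  {F : Type*} [NormedAddCommGroup F] [NormedSpace ℝ F] [FiniteDimensional ℝ F]
  {V : M → Type*} [TopologicalSpace (TotalSpace F V)]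
  [∀ x, AddCommGroup (V x)] [∀ x, Module ℝ (V x)] [∀ x, TopologicalSpace (V x)]
  [∀ x, IsTopologicalAddGroup (V x)] [∀ x, ContinuousSMul ℝ (V x)] [FiberBundle F V]
  [VectorBundle ℝ F V] [ContMDiffVectorBundle ∞ F V 𝓘(ℝ, E)]
  {nabla : CovariantDerivative 𝓘(ℝ, E) F V}
  {X : Π x : M, TangentSpace 𝓘(ℝ, E) x} {A : Π x : M, V x →L[ℝ] V x} {p : M} {U : Set M}

/-- The equation and the chain rule both compute the one-sided derivative of the fibre coordinates
at the end point, and such a derivative is unique. -/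
theorem nablaAdd_eq_of_solvesOn (m : ∀ x₀, LocalModel nabla X A x₀) {σ v : Π x : M, V x}
    {O : Set M} (hO : IsOpen O) (hσ : IsSmoothSectionOn (E := E) F O σ) {γ : ℝ → M}
    (hγ : IsBackwardOrbit X γ) (h0 : γ 0 ∈ O)
    (h : SolvesOn nabla X A γ (fun t => v (γ t)) (fun t => σ (γ t)) (Iic 0)) :
    nablaAdd nabla X A σ (γ 0) = v (γ 0) := by
  have h0' : (0 : ℝ) ∈ Iic (0 : ℝ) := mem_Iic.2 le_rfl
  have hm := (m (γ 0)).mem_nhd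
  have h1 := (((m (γ 0)).hasCovDerivAlong_iff hm).1 (h 0 h0')).2.2
  have h2 := (((m (γ 0)).hasCovDerivAlong_iff hm).1
    (hasCovDerivAlong_section A (hσ.mdifferentiableAt hO h0) (hγ 0 h0'))).2.2
  exact coord_injective ((m (γ 0)).subset_baseSet hm)
    (sub_left_injective ((uniqueDiffOn_Iic 0 0 h0').eq_deriv _ h2 h1))

/-- The values of solutions along backward orbits which coincide with `u₀` near `-∞`. -/
def IsTransported (nabla : CovariantDerivative 𝓘(ℝ, E) F V)
    (X : Π x : M, TangentSpace 𝓘(ℝ, E) x) (A : Π x : M, V x →L[ℝ] V x) (v u₀ : Π x : M, V x)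
    (a : TotalSpace F V) : Prop :=
  ∃ (γ : ℝ → M) (w : Π t, V (γ t)), (∀ t, γ t = γ (min t 0)) ∧ IsBackwardOrbit X γ ∧
    SolvesOn nabla X A γ (fun t => v (γ t)) w (Iic 0) ∧ (∀ᶠ t in atBot, w t = u₀ (γ t)) ∧
    TotalSpace.mk' F (γ 0) (w 0) = a

theorem isTransported_of_solvesOn (m : ∀ x₀, LocalModel nabla X A x₀) {v u₀ : Π x : M, V x}
    {γ : ℝ → M} {w : Π t, V (γ t)} (hγ : IsBackwardOrbit X γ)
    (hw : SolvesOn nabla X A γ (fun t => v (γ t)) w (Iic 0)) (hev : ∀ᶠ t in atBot, w t = u₀ (γ t))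
    {t : ℝ} (ht : t ≤ 0) :
    IsTransported nabla X A v u₀ (TotalSpace.mk' F (γ t) (w t)) := by
  refine ⟨fun s => γ (min s 0 + t), fun s => w (min s 0 + t), fun s => by simp, hγ.shift ht,
    hw.comp_reparam m (fun _ h => hasDerivWithinAt_min_add t h) (mapsTo_min_add ht), ?_, ?_⟩
  · have : Tendsto (fun s : ℝ => min s 0 + t) atBot atBot :=
      tendsto_atBot_add_const_right _ _ (tendsto_id.congr' (by
        filter_upwards [Iic_mem_atBot (0 : ℝ)] with s hs using (min_eq_left (mem_Iic.1 hs)).symm))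
    exact this.eventually hev
  · have h : min (0 : ℝ) 0 + t = t := by simp
    exact congrArg (fun r => TotalSpace.mk' F (γ r) (w r)) h

/-- The normalization for positive times makes the two orbits literally equal, so both solutions
live along one curve. They agree at some early time, hence at the end. -/
theorem IsTransported.unique [T2Space M] (m : ∀ x₀, LocalModel nabla X A x₀)
    {v u₀ : Π x : M, V x} {x : M} {a b : V x}
    (ha : IsTransported nabla X A v u₀ (TotalSpace.mk' F x a))
    (hb : IsTransported nabla X A v u₀ (TotalSpace.mk' F x b)) : a = b := by
  obtain ⟨γ₁, w₁, hn₁, hγ₁, hw₁, hev₁, he₁⟩ := ha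
  obtain ⟨γ₂, w₂, hn₂, hγ₂, hw₂, hev₂, he₂⟩ := hb
  have h0' : (0 : ℝ) ∈ Iic (0 : ℝ) := mem_Iic.2 le_rfl
  have h0 : γ₁ 0 = γ₂ 0 :=
    (congrArg TotalSpace.proj he₁).trans (congrArg TotalSpace.proj he₂).symm
  have hγ : γ₁ = γ₂ := by
    funext t
    rw [hn₁, hn₂]
    exact eqOn_of_isMIntegralCurveOn m ordConnected_Iic hγ₁ hγ₂ h0' (mem_Iic.2 (min_le_right _ _)) h0
  subst hγ
  obtain ⟨t, ⟨h1, h2⟩, ht⟩ := ((hev₁.and hev₂).and (Iic_mem_atBot (0 : ℝ))).exists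
  have := hw₁.eqOn m ordConnected_Iic hw₂ ht h0' (h1.trans h2.symm)
  rw [this] at he₁
  exact TotalSpace.mk_inj.1 (he₁.symm.trans he₂)

/-- A solution near the centre of a star-shaped set extends to a solution along all backward
orbits. -/
theorem exists_solution_along_orbits [T2Space M] (m : ∀ x₀, LocalModel nabla X A x₀)
    (hU : IsStarShaped X p U) {v : Π x : M, V x} (hv : IsSmoothSectionOn (E := E) F U v)
    {S : Set M} {u₀ : Π x : M, V x} (hSo : IsOpen S) (hpS : p ∈ S) (hSU : S ⊆ U)
    (hu₀ : IsSmoothSectionOn (E := E) F S u₀)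
    (h₀ : ∀ γ : ℝ → M, IsBackwardOrbit X γ → γ 0 ∈ S → (∀ t ≤ 0, γ t ∈ S) ∧
      SolvesOn nabla X A γ (fun t => v (γ t)) (fun t => u₀ (γ t)) (Iic 0)) :
    ∃ u : Π x : M, V x, (∀ x ∈ S, u x = u₀ x) ∧ ∀ γ : ℝ → M, IsBackwardOrbit X γ → γ 0 ∈ U →
      SolvesOn nabla X A γ (fun t => v (γ t)) (fun t => u (γ t)) (Iic 0) := by
  classical
  have hpde : ∀ x ∈ S, nablaAdd nabla X A u₀ x = v x := by
    intro x hx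
    obtain ⟨γ, rfl, hγ, -, -⟩ := hU.2.2 x (hSU hx)
    exact nablaAdd_eq_of_solvesOn m hSo hu₀ hγ hx (h₀ γ hγ hx).2
  have hex : ∀ γ : ℝ → M, IsBackwardOrbit X γ → γ 0 ∈ U → ∃ w : Π t, V (γ t),
      SolvesOn nabla X A γ (fun t => v (γ t)) w (Iic 0) ∧ ∀ᶠ t in atBot, w t = u₀ (γ t) := by
    intro γ hγ hγ0
    obtain ⟨hlim, hγU⟩ := hU.orbit m hγ hγ0
    obtain ⟨a, haS, ha0⟩ := ((hlim.eventually (hSo.mem_nhds hpS)).and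
      (Iic_mem_atBot (0 : ℝ))).exists
    have ha0 : a ≤ 0 := ha0
    have haS' : ∀ t ≤ a, γ t ∈ S := by
      intro t hta
      have ht0 : t - a ≤ 0 := by linarith
      have := (h₀ _ (hγ.shift ha0) (by simp only [min_self, zero_add]; exact haS)).1 (t - a) ht0
      simpa only [min_eq_left ht0, sub_add_cancel] using this
    have hs₁ : SolvesOn nabla X A γ (fun t => v (γ t)) (fun t => u₀ (γ t)) (Iic a) := by
      intro t ht
      have := solvesOn_section (nabla := nabla) (A := A) hSo hu₀
        (IsMIntegralCurveOn.mono hγ (Iic_subset_Iic.2 ha0)) haS' t ht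
      simp only [hpde _ (haS' t ht)] at this
      exact this
    obtain ⟨w, hwa, hw⟩ := exists_solvesOn_Icc m (η := fun t => v (γ t)) ha0
      (IsMIntegralCurveOn.mono hγ fun t ht => ht.2) (fun x₀ =>
        (contMDiffOn_coord x₀ hv hU.1).continuousOn.comp
          ((IsMIntegralCurveOn.continuousOn hγ).mono fun t ht => ht.1.2)
          fun t ht => ⟨hγU t ht.1.2, ht.2⟩) (u₀ (γ a))
    refine ⟨_, (hs₁.glue hw Subset.rfl (fun t ht => ht.1) (mem_Iic.2 le_rfl)
      (left_mem_Icc.2 ha0) hwa.symm).mono fun t ht => ?_, ?_⟩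
    · rcases le_total t a with h | h
      · exact Or.inl h
      · exact Or.inr ⟨h, ht⟩
    · filter_upwards [Iic_mem_atBot a] with t ht
      simp only [if_pos (mem_Iic.1 ht)]
  -- The default value zero is never used on `U`, where `hex` supplies a transported value.
  let u : Π x : M, V x := fun x =>
    if h : ∃ a : V x, IsTransported nabla X A v u₀ (TotalSpace.mk' F x a) then h.choose else 0
  have hu : ∀ (x : M) (a : V x), IsTransported nabla X A v u₀ (TotalSpace.mk' F x a) → u x = a := by
    intro x a ha
    have h : ∃ a : V x, IsTransported nabla X A v u₀ (TotalSpace.mk' F x a) := ⟨a, ha⟩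
    simp only [u, dif_pos h]
    exact h.choose_spec.unique m ha
  refine ⟨u, fun x hx => ?_, fun γ hγ hγ0 => ?_⟩
  · obtain ⟨γ, rfl, hγ, -, -⟩ := hU.2.2 x (hSU hx)
    exact hu _ _ (isTransported_of_solvesOn m (w := fun t => u₀ (γ t)) hγ (h₀ γ hγ hx).2
      (Eventually.of_forall fun _ => rfl) le_rfl)
  · obtain ⟨w, hw, hev⟩ := hex γ hγ hγ0
    exact hw.congr_section fun t ht => hu _ _ (isTransported_of_solvesOn m hγ hw hev ht)

end Transport

/-! ### Propagation of smoothness to the whole star-shaped set -/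

section Smoothness

variable {E : Type*} [NormedAddCommGroup E] [NormedSpace ℝ E] [FiniteDimensional ℝ E]
  {M : Type*} [TopologicalSpace M] [ChartedSpace E M] [IsManifold 𝓘(ℝ, E) ∞ M]
  {F : Type*} [NormedAddCommGroup F] [NormedSpace ℝ F] [FiniteDimensional ℝ F]
  {V : M → Type*} [TopologicalSpace (TotalSpace F V)]
  [∀ x, AddCommGroup (V x)] [∀ x, Module ℝ (V x)] [∀ x, TopologicalSpace (V x)]
  [∀ x, IsTopologicalAddGroup (V x)] [∀ x, ContinuousSMul ℝ (V x)] [FiberBundle F V]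
  [VectorBundle ℝ F V] [ContMDiffVectorBundle ∞ F V 𝓘(ℝ, E)]
  {nabla : CovariantDerivative 𝓘(ℝ, E) F V}
  {X : Π x : M, TangentSpace 𝓘(ℝ, E) x} {A : Π x : M, V x →L[ℝ] V x} {p : M} {U : Set M}

/-- Backward orbits starting near `x₀` stay near `x₀` for a short time. -/
theorem LocalModel.exists_stay [T2Space M] {x₀ : M} (m : LocalModel nabla X A x₀) {W : Set M}
    (hW : IsOpen W) (hx₀ : x₀ ∈ W) :
    ∃ R T : ℝ, 0 < R ∧ 0 < T ∧
      (∀ z ∈ Metric.closedBall (extChartAt 𝓘(ℝ, E) x₀ x₀) R, z ∈ (extChartAt 𝓘(ℝ, E) x₀).target ∧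
        (extChartAt 𝓘(ℝ, E) x₀).symm z ∈ W ∩ m.nhd) ∧
      ∀ γ : ℝ → M, IsBackwardOrbit X γ → γ 0 ∈ (extChartAt 𝓘(ℝ, E) x₀).source →
        extChartAt 𝓘(ℝ, E) x₀ (γ 0) ∈ Metric.ball (extChartAt 𝓘(ℝ, E) x₀ x₀) (R / 2) →
        ∀ t ∈ Icc (-T) 0, γ t ∈ (extChartAt 𝓘(ℝ, E) x₀).source ∧
          extChartAt 𝓘(ℝ, E) x₀ (γ t) ∈ Metric.closedBall (extChartAt 𝓘(ℝ, E) x₀ x₀) R := by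
  set φ := extChartAt 𝓘(ℝ, E) x₀ with hφ
  set z₀ := φ x₀ with hz₀
  obtain ⟨R', hR', hball⟩ := Metric.mem_nhds_iff.1
    ((isOpen_extChartAt_target_inter (E := E) (hW.inter m.isOpen_nhd) x₀).mem_nhds
      ⟨mem_extChartAt_target x₀, by simpa using ⟨hx₀, m.mem_nhd⟩⟩)
  set R := R' / 2 with hR
  have hR0 : 0 < R := by positivity
  have hK : ∀ z ∈ Metric.closedBall z₀ R, z ∈ φ.target ∧ φ.symm z ∈ W ∩ m.nhd :=
    fun z hz => hball (Metric.closedBall_subset_ball (by linarith) hz)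
  obtain ⟨B', hB'⟩ := (isCompact_closedBall z₀ R).exists_bound_of_continuousOn
    m.contDiff_field.continuous.continuousOn
  set B := max B' 1 with hBdef
  have hB0 : 0 < B := lt_of_lt_of_le one_pos (le_max_right _ _)
  have hB : ∀ z ∈ Metric.closedBall z₀ R, ‖m.field z‖ ≤ B :=
    fun z hz => (hB' z hz).trans (le_max_left _ _)
  -- At speed at most `B` an orbit travels at most `R / 2` in this time, and it starts within `R /
  -- 2` of the centre.
  refine ⟨R, R / (2 * B), hR0, by positivity, hK, fun γ hγ h0s h0 t ht => ?_⟩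
  set T := R / (2 * B) with hT
  have hBT : B * T = R / 2 := by rw [hT]; field_simp
  have hcont : ContinuousOn γ (Iic 0) := IsMIntegralCurveOn.continuousOn hγ
  set C : Set M := φ.symm '' Metric.closedBall z₀ R with hC
  have hCc : IsClosed C := ((isCompact_closedBall z₀ R).image_of_continuousOn
    ((continuousOn_extChartAt_symm x₀).mono fun z hz => (hK z hz).1)).isClosed
  have hCmem : ∀ x, x ∈ C ↔ x ∈ φ.source ∧ φ x ∈ Metric.closedBall z₀ R := by
    intro x
    constructor
    · rintro ⟨z, hz, rfl⟩
      exact ⟨φ.map_target (hK z hz).1, by rw [φ.right_inv (hK z hz).1]; exact hz⟩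
    · rintro ⟨h1, h2⟩
      exact ⟨φ x, h2, φ.left_inv h1⟩
  set y := φ (γ 0) with hy
  have hcontneg : ContinuousOn (fun τ : ℝ => γ (-τ)) (Icc 0 T) :=
    hcont.comp continuousOn_neg fun τ hτ => by simpa using hτ.1
  have hA : IsClosed (Icc 0 T ∩ (fun τ : ℝ => γ (-τ)) ⁻¹' C) :=
    hcontneg.preimage_isClosed_of_isClosed isClosed_Icc hCc
  have hψ : ContinuousOn (fun τ : ℝ => ‖φ (γ (-τ)) - y‖ - B * τ)
      (Icc 0 T ∩ (fun τ : ℝ => γ (-τ)) ⁻¹' C) := by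
    have : ContinuousOn (fun τ : ℝ => φ (γ (-τ))) (Icc 0 T ∩ (fun τ : ℝ => γ (-τ)) ⁻¹' C) :=
      (continuousOn_extChartAt x₀).comp (hcontneg.mono inter_subset_left)
        fun τ hτ => ((hCmem _).1 hτ.2).1
    exact (this.sub continuousOn_const).norm.sub (continuousOn_const.mul continuousOn_id)
  have hcl := hψ.preimage_isClosed_of_isClosed hA isClosed_Iic (t := Iic 0)
  -- Recording the distance travelled, and not just membership in the closed ball, puts the current
  -- point strictly inside the ball, from where the orbit can be continued.
  set Z : Set ℝ := {τ | γ (-τ) ∈ C ∧ ‖φ (γ (-τ)) - y‖ ≤ B * τ} with hZ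
  have hZeq : Z ∩ Icc 0 T = Icc 0 T ∩ (fun τ : ℝ => γ (-τ)) ⁻¹' C ∩
      (fun τ : ℝ => ‖φ (γ (-τ)) - y‖ - B * τ) ⁻¹' Iic 0 := by
    ext τ
    simp only [hZ, mem_inter_iff, mem_ofPred_eq, mem_preimage, mem_Iic, sub_nonpos]
    tauto
  rw [← hZeq] at hcl
  have hyR : ‖y - z₀‖ < R / 2 := by rwa [mem_ball_iff_norm] at h0
  have := hcl.Icc_subset_of_forall_exists_gt (a := 0) (b := T) ?_ ?_
    (⟨by linarith [ht.2], by linarith [ht.1]⟩ : -t ∈ Icc 0 T)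
  · have h := this.1
    rw [neg_neg] at h
    exact (hCmem _).1 h
  · refine ⟨?_, ?_⟩
    · rw [neg_zero]
      exact (hCmem _).2 ⟨h0s, Metric.ball_subset_closedBall
        (Metric.ball_subset_ball (by linarith) h0)⟩
    · rw [neg_zero, mul_zero, ← hy, sub_self, norm_zero]
  rintro τ ⟨⟨hτC, hτB⟩, hτ0, hτT⟩ r hr
  have hr : τ < r := hr
  obtain ⟨hs, -⟩ := (hCmem _).1 hτC
  have hτ' : -τ ∈ Iic (0 : ℝ) := by simpa using hτ0
  have hτball : φ (γ (-τ)) ∈ Metric.ball z₀ R := by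
    rw [mem_ball_iff_norm]
    have h1 : B * τ ≤ R / 2 := by rw [← hBT]; gcongr
    calc ‖φ (γ (-τ)) - z₀‖ ≤ ‖φ (γ (-τ)) - y‖ + ‖y - z₀‖ := norm_sub_le_norm_sub_add_norm_sub _ _ _
      _ < R / 2 + R / 2 := by linarith
      _ = R := by ring
  have hev : ∀ᶠ r in 𝓝[Iic 0] (-τ), γ r ∈ φ.source ∩ φ ⁻¹' Metric.ball z₀ R :=
    (hcont (-τ) hτ').preimage_mem_nhdsWithin
      ((isOpen_extChartAt_source_inter Metric.isOpen_ball x₀).mem_nhds ⟨hs, hτball⟩)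
  obtain ⟨δ, hδ, hδball⟩ := Metric.mem_nhdsWithin_iff.1 hev
  set τ' := min (τ + δ / 2) r with hτ'def
  have hττ' : τ < τ' := lt_min (by linarith) hr
  have hin : ∀ σ ∈ Icc (-τ') (-τ), γ σ ∈ φ.source ∧ φ (γ σ) ∈ Metric.ball z₀ R := by
    intro σ hσ
    have h1 : τ' ≤ τ + δ / 2 := min_le_left _ _
    refine hδball ⟨?_, mem_Iic.2 (hσ.2.trans hτ')⟩
    rw [Metric.mem_ball, Real.dist_eq, abs_lt]
    exact ⟨by linarith [hσ.1], by linarith [hσ.2]⟩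
  have hmv := (convex_Icc (-τ') (-τ)).norm_image_sub_le_of_norm_hasDerivWithin_le
    (f := fun σ => φ (γ σ)) (f' := fun σ => m.field (φ (γ σ))) (C := B)
    (fun σ hσ => by
      have hN : γ σ ∈ m.nhd := by
        have := (hK _ (Metric.ball_subset_closedBall (hin σ hσ).2)).2.2
        rwa [φ.left_inv (hin σ hσ).1] at this
      exact (m.hasDerivWithinAt_curve hγ (mem_Iic.2 (hσ.2.trans hτ')) hN).mono
        fun x hx => mem_Iic.2 (hx.2.trans hτ'))
    (fun σ hσ => hB _ (Metric.ball_subset_closedBall (hin σ hσ).2))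
    (right_mem_Icc.2 (by linarith)) (left_mem_Icc.2 (by linarith : -τ' ≤ -τ))
  have hmem := hin (-τ') (left_mem_Icc.2 (by linarith))
  refine ⟨τ', ⟨(hCmem _).2 ⟨hmem.1, Metric.ball_subset_closedBall hmem.2⟩, ?_⟩, hττ',
    min_le_right _ _⟩
  have h1 : ‖-τ' - -τ‖ = τ' - τ := by
    rw [Real.norm_eq_abs, abs_of_nonpos (by linarith)]; ring
  rw [h1] at hmv
  calc ‖φ (γ (-τ')) - y‖ ≤ ‖φ (γ (-τ')) - φ (γ (-τ))‖ + ‖φ (γ (-τ)) - y‖ :=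
        norm_sub_le_norm_sub_add_norm_sub _ _ _
    _ ≤ B * (τ' - τ) + B * τ := add_le_add hmv hτB
    _ = B * τ' := by ring

/-- Smoothness of a solution propagates along backward orbits, locally. -/
theorem exists_smooth_propagation [T2Space M] (m : ∀ x₀, LocalModel nabla X A x₀)
    (hU : IsStarShaped X p U) {u v : Π x : M, V x} (hv : IsSmoothSectionOn (E := E) F U v)
    (hu : ∀ γ : ℝ → M, IsBackwardOrbit X γ → γ 0 ∈ U →
      SolvesOn nabla X A γ (fun t => v (γ t)) (fun t => u (γ t)) (Iic 0)) {x₀ : M} (hx₀ : x₀ ∈ U) :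
    ∃ N ∈ 𝓝 x₀, ∃ T > 0, ∀ γ : ℝ → M, IsBackwardOrbit X γ → γ 0 ∈ N → ∀ s ∈ Icc (-T) 0,
      (∃ O, IsOpen O ∧ γ s ∈ O ∧ IsSmoothSectionOn (E := E) F O u) →
      ∃ O, IsOpen O ∧ γ 0 ∈ O ∧ IsSmoothSectionOn (E := E) F O u := by
  obtain ⟨vh, hvh, Nv, hNvo, hxNv, hNvU, -, hvN⟩ := exists_contDiff_coord hU.1 hv hx₀
  set φ := extChartAt 𝓘(ℝ, E) x₀ with hφ
  set z₀ := φ x₀ with hz₀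
  obtain ⟨R, T, hR, hT, hK, hstay⟩ := (m x₀).exists_stay hNvo hxNv
  refine ⟨φ.source ∩ φ ⁻¹' Metric.ball z₀ (R / 2),
    (isOpen_extChartAt_source_inter Metric.isOpen_ball x₀).mem_nhds
      ⟨mem_extChartAt_source x₀, Metric.mem_ball_self (by positivity)⟩, T, hT, ?_⟩
  rintro γ hγ ⟨h0s, h0⟩ s hs ⟨O, hO, hsO, huO⟩
  choose! orb horb0 horb horblim horbU using hU.2.2
  set D₀ := Metric.ball z₀ (R / 2) with hD₀
  have hD₀K : D₀ ⊆ Metric.closedBall z₀ R := fun z hz =>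
    Metric.ball_subset_closedBall (Metric.ball_subset_ball (by linarith) hz)
  have hD₀U : ∀ z ∈ D₀, φ.symm z ∈ U := fun z hz => hNvU (hK z (hD₀K hz)).2.1
  have hst : ∀ z ∈ D₀, ∀ t ∈ Icc (-(-s)) 0, orb (φ.symm z) t ∈ φ.source ∧
      φ (orb (φ.symm z) t) ∈ Metric.closedBall z₀ R := by
    intro z hz t ht
    refine hstay _ (horb _ (hD₀U z hz)) ?_ ?_ t ⟨by linarith [hs.1, ht.1], ht.2⟩
    · rw [horb0 _ (hD₀U z hz)]; exact φ.map_target (hK z (hD₀K hz)).1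
    · rw [horb0 _ (hD₀U z hz), φ.right_inv (hK z (hD₀K hz)).1]; exact hz
  have hN : ∀ z ∈ D₀, ∀ t ∈ Icc (-(-s)) 0, orb (φ.symm z) t ∈ Nv ∩ (m x₀).nhd := by
    intro z hz t ht
    have := (hK _ (hst z hz t ht).2).2
    rwa [φ.left_inv (hst z hz t ht).1] at this
  have hfam : IsOrbitFamily (m x₀).field (Metric.closedBall z₀ R) D₀ (-s)
      (fun z t => φ (orb (φ.symm z) t)) := by
    intro z hz
    refine ⟨by simp only [horb0 _ (hD₀U z hz), φ.right_inv (hK z (hD₀K hz)).1], fun t ht =>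
      ⟨(hst z hz t ht).2, ?_⟩⟩
    exact ((m x₀).hasDerivWithinAt_curve (horb _ (hD₀U z hz)) (mem_Iic.2 ht.2) (hN z hz t ht).2).mono
      fun x hx => mem_Iic.2 hx.2
  have hs0 : (0 : ℝ) ≤ -s := by linarith [hs.2]
  obtain ⟨C, hC0, hC⟩ := hfam.exists_dist_le (m x₀).contDiff_field (isCompact_closedBall _ _)
    (convex_closedBall _ _) hs0
  set y := φ (γ 0) with hy
  have hsymmy : φ.symm y = γ 0 := φ.left_inv h0s
  have horby : ∀ t ≤ 0, orb (φ.symm y) t = γ t := fun t ht =>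
    eqOn_of_isMIntegralCurveOn m ordConnected_Iic (horb _ (hD₀U y h0)) hγ (mem_Iic.2 le_rfl) ht
      (by rw [horb0 _ (hD₀U y h0), hsymmy])
  have hsIcc : s ∈ Icc (-(-s)) 0 := ⟨by simp, hs.2⟩
  set b := (trivializationAt F V x₀).baseSet with hb
  set O' := φ.target ∩ φ.symm ⁻¹' (O ∩ b) with hO'
  have hO'o : IsOpen O' :=
    isOpen_extChartAt_target_inter (hO.inter (trivializationAt F V x₀).open_baseSet) x₀
  have hsO' : φ (γ s) ∈ O' := by
    have h1 := hst y h0 s hsIcc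
    have h2 := hN y h0 s hsIcc
    rw [horby s hs.2] at h1 h2
    refine ⟨φ.map_source h1.1, ?_⟩
    rw [mem_preimage, φ.left_inv h1.1]
    exact ⟨hsO, (m x₀).subset_baseSet h2.2⟩
  obtain ⟨ε, hε, hεO⟩ := Metric.isOpen_iff.1 hO'o _ hsO'
  -- Orbits depend on their end points with Lipschitz constant `C`, so this radius sends time-`s`
  -- points into `O'`; adding one avoids division by zero.
  set D := D₀ ∩ Metric.ball y (ε / (C + 1)) with hD
  have hDo : IsOpen D := Metric.isOpen_ball.inter Metric.isOpen_ball
  have hDO' : ∀ z ∈ D, φ (orb (φ.symm z) s) ∈ O' := by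
    intro z hz
    refine hεO (mem_ball_iff_norm.2 ?_)
    have h1 := hC y h0 z hz.1 s hsIcc
    simp only [horby s hs.2] at h1
    have h2 : ‖z - y‖ < ε / (C + 1) := mem_ball_iff_norm.1 hz.2
    rw [lt_div_iff₀ (by positivity)] at h2
    refine h1.trans_lt (lt_of_le_of_lt ?_ h2)
    nlinarith [norm_nonneg (z - y)]
  set Uf : E → ℝ → F := fun z t =>
    (trivializationAt F V x₀ (TotalSpace.mk' F (orb (φ.symm z) t) (u (orb (φ.symm z) t)))).2 with hUf
  have hsmooth := contDiffOn_of_solvesAlong_lift (m x₀).contDiff_field (m x₀).contDiff_coeff hvh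
    (isCompact_closedBall z₀ R) (convex_closedBall _ _) hDo hs0
    (γ := fun z t => φ (orb (φ.symm z) t)) (fun z hz => hfam z hz.1) (U := Uf)
    (fun z hz t ht => by
      have hsol := hu _ (horb _ (hD₀U z hz.1)) (by
        rw [horb0 _ (hD₀U z hz.1)]; exact hD₀U z hz.1) t (mem_Iic.2 ht.2)
      have h1 := (((m x₀).hasCovDerivAlong_iff (hN z hz.1 t ht).2).1 hsol).2.2
      refine (h1.mono fun x hx => mem_Iic.2 hx.2).congr_deriv ?_
      rw [hvN _ (hN z hz.1 t ht).1]
      abel)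
    (u₀ := fun z => (trivializationAt F V x₀ (TotalSpace.mk' F (φ.symm z) (u (φ.symm z)))).2) hO'o
    (contDiffOn_comp_extChartAt_symm (contMDiffOn_coord x₀ huO hO) x₀)
    (fun z hz => by simp only [neg_neg]; exact hDO' z hz)
    (fun z hz => by
      have h2 : orb (φ.symm z) (- -s) = orb (φ.symm z) s := by rw [neg_neg]
      simp only [hUf]
      rw [h2, φ.left_inv (hst z hz.1 s hsIcc).1])
  refine ⟨φ.source ∩ φ ⁻¹' D, isOpen_extChartAt_source_inter hDo x₀,
    ⟨h0s, h0, Metric.mem_ball_self (by positivity)⟩, ?_⟩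
  have hbase : φ.source ∩ φ ⁻¹' D ⊆ b := fun x hx => by
    have := (hK _ (hD₀K hx.2.1)).2.2
    rw [φ.left_inv hx.1] at this
    exact (m x₀).subset_baseSet this
  refine ((trivializationAt F V x₀).contMDiffOn_section_iff
    (isOpen_extChartAt_source_inter hDo x₀) hbase).2 ?_
  refine ContMDiffOn.congr (f := fun x => Uf (φ x) 0) ?_ fun x hx => ?_
  · exact hsmooth.contMDiffOn.comp ((contMDiffOn_extChartAt (I := 𝓘(ℝ, E)) (n := ∞)).mono
      fun x hx => by have := hx.1; rwa [extChartAt_source] at this) fun x hx => hx.2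
  · simp only [hUf]
    rw [horb0 _ (hD₀U _ hx.2.1), φ.left_inv hx.1]

/-- A solution along all backward orbits which is smooth near the centre is smooth. -/
theorem isSmoothSectionOn_of_solvesOn [T2Space M] (m : ∀ x₀, LocalModel nabla X A x₀)
    (hU : IsStarShaped X p U) {u v : Π x : M, V x} (hv : IsSmoothSectionOn (E := E) F U v)
    (hu : ∀ γ : ℝ → M, IsBackwardOrbit X γ → γ 0 ∈ U →
      SolvesOn nabla X A γ (fun t => v (γ t)) (fun t => u (γ t)) (Iic 0))
    {S : Set M} (hSo : IsOpen S) (hpS : p ∈ S) (huS : IsSmoothSectionOn (E := E) F S u) :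
    IsSmoothSectionOn (E := E) F U u := by
  intro x hx
  obtain ⟨γ, rfl, hγ, hlim, hγU⟩ := hU.2.2 x hx
  set Q : ℝ → Prop := fun t => ∃ O, IsOpen O ∧ γ t ∈ O ∧ IsSmoothSectionOn (E := E) F O u with hQ
  suffices hQ0 : Q 0 by
    obtain ⟨O, hO, h0O, huO⟩ := hQ0
    exact (ContMDiffOn.contMDiffAt huO (hO.mem_nhds h0O)).contMDiffWithinAt
  obtain ⟨b, hb⟩ := ((hlim.eventually (hSo.mem_nhds hpS)).and
    (Iic_mem_atBot (0 : ℝ))).exists_forall_of_atBot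
  have hbQ : ∀ r ≤ b, Q r := fun r hr => ⟨S, hSo, (hb r hr).1, huS⟩
  -- Smoothness at all times up to `a` is compared with smoothness at all times up to `c`. In this
  -- form the relation is transitive and trivial towards earlier times; only the forward direction
  -- needs `exists_smooth_propagation`.
  refine ordConnected_Iic.isPreconnected.induction₂' (s := Iic (0 : ℝ))
    (fun a c => (∀ r ≤ a, Q r) → ∀ r ≤ c, Q r) ?_ (fun _ _ _ _ _ _ h1 h2 h3 => h2 (h1 h3))
    (show b ∈ Iic 0 from (hb b le_rfl).2) (mem_Iic.2 le_rfl) hbQ 0 le_rfl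
  intro x hx
  obtain ⟨N, hN, T, hT, hprop⟩ := exists_smooth_propagation m hU hv hu (hγU x hx)
  obtain ⟨ε, hε, hball⟩ := Metric.mem_nhdsWithin_iff.1
    ((IsMIntegralCurveOn.continuousOn hγ x hx).preimage_mem_nhdsWithin hN)
  -- Two times within `T / 2` of `x` differ by less than `T`, the reach of the local propagation.
  set δ := min ε (T / 2) with hδ
  have hδ0 : 0 < δ := lt_min hε (by positivity)
  have key : ∀ a ∈ Metric.ball x δ ∩ Iic 0, ∀ c ∈ Metric.ball x δ ∩ Iic 0,
      (∀ r ≤ a, Q r) → ∀ r ≤ c, Q r := by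
    intro a ha c hc hQa r hrc
    rcases le_or_gt r a with h | h
    · exact hQa r h
    have hr0 : r ≤ 0 := hrc.trans hc.2
    have ha' := ha.1
    have hc' := hc.1
    rw [Metric.mem_ball, Real.dist_eq, abs_lt] at ha' hc'
    have h1 : δ ≤ ε := min_le_left _ _
    have h2 : δ ≤ T / 2 := min_le_right _ _
    have hrN : γ r ∈ N := hball ⟨by
      rw [Metric.mem_ball, Real.dist_eq, abs_lt]
      exact ⟨by linarith, by linarith⟩, mem_Iic.2 hr0⟩
    have har : a - r ≤ 0 := by linarith
    have := hprop _ (IsBackwardOrbit.shift hγ hr0) (by simpa only [min_self, zero_add] using hrN)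
      (a - r) ⟨by linarith, har⟩ (by
        simpa only [min_eq_left har, sub_add_cancel] using hQa a le_rfl)
    simpa only [min_self, zero_add] using this
  have hxs : x ∈ Metric.ball x δ ∩ Iic 0 := ⟨Metric.mem_ball_self hδ0, hx⟩
  filter_upwards [inter_mem (mem_nhdsWithin_of_mem_nhds (Metric.ball_mem_nhds x hδ0))
    self_mem_nhdsWithin] with y hy
  exact ⟨key x hxs y hy, key y hy x hxs⟩

end Smoothness

/-! ### Limits and derivatives under inverse operators -/

section Inverse

variable {F : Type*} [NormedAddCommGroup F] [NormedSpace ℝ F] [FiniteDimensional ℝ F]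

/-- Invertible operators form an open set on which inversion is continuous, so eventually `y` is the
inverse of `Φ` applied to `c`. -/
theorem tendsto_of_clm_apply_eq {α : Type*} {l : Filter α} {Φ : α → F →L[ℝ] F} {L : F ≃L[ℝ] F}
    (hΦ : Tendsto Φ l (𝓝 (L : F →L[ℝ] F))) {c y : α → F} (hy : ∀ᶠ s in l, Φ s (y s) = c s) {c₀ : F}
    (hc : Tendsto c l (𝓝 (L c₀))) : Tendsto y l (𝓝 c₀) := by
  have : CompleteSpace F := FiniteDimensional.complete ℝ F
  let Lu : (F →L[ℝ] F)ˣ := ContinuousLinearEquiv.toUnit L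
  have h1 : Tendsto (fun s => Ring.inverse (Φ s)) l (𝓝 (Ring.inverse (Lu : F →L[ℝ] F))) :=
    (NormedRing.inverse_continuousAt Lu).tendsto.comp hΦ
  have h2 : ∀ᶠ s in l, IsUnit (Φ s) := hΦ.eventually (Units.isOpen.mem_nhds ⟨Lu, rfl⟩)
  have h3 : Tendsto (fun s => Ring.inverse (Φ s) (c s)) l
      (𝓝 (Ring.inverse (Lu : F →L[ℝ] F) (L c₀))) :=
    ((isBoundedBilinearMap_apply (𝕜 := ℝ) (E := F) (F := F)).continuous.tendsto (_, _)).comp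
      (h1.prodMk_nhds hc)
  have h4 : Ring.inverse (Lu : F →L[ℝ] F) (L c₀) = c₀ :=
    congrArg (fun f : F →L[ℝ] F => f c₀) (Ring.inverse_mul_cancel _ Lu.isUnit)
  rw [h4] at h3
  refine h3.congr' ?_
  filter_upwards [hy, h2] with s hs hs'
  rw [← hs]
  exact congrArg (fun f : F →L[ℝ] F => f (y s)) (Ring.inverse_mul_cancel _ hs')

/-- The difference quotients of `y` are mapped by `Φ s` to those of `c s - Φ s (y s₀)`, so the
preceding lemma applies to them. No derivative of the inverse operator is needed. -/
theorem hasDerivWithinAt_of_clm_apply_eq {Φ : ℝ → F →L[ℝ] F} {S : Set ℝ} {s₀ : ℝ}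
    {L : F ≃L[ℝ] F} (hΦ : ContinuousWithinAt Φ S s₀) (hL : Φ s₀ = L) {c y : ℝ → F}
    (hy : ∀ᶠ s in 𝓝[S] s₀, Φ s (y s) = c s) (hy₀ : Φ s₀ (y s₀) = c s₀) {g : F}
    (hd : HasDerivWithinAt (fun s => c s - Φ s (y s₀)) (Φ s₀ g) S s₀) :
    HasDerivWithinAt y g S s₀ := by
  rw [hasDerivWithinAt_iff_tendsto_slope] at hd ⊢
  have hmono : 𝓝[S \ {s₀}] s₀ ≤ 𝓝[S] s₀ := nhdsWithin_mono _ sdiff_subset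
  rw [hL] at hd
  refine tendsto_of_clm_apply_eq (hL ▸ hΦ.tendsto.mono_left hmono) ?_ hd
  filter_upwards [hmono hy] with s hs
  have hs : Φ s (y s) = c s := hs
  rw [slope_def_module, slope_def_module, map_smul, map_sub, hs, hy₀, sub_self, sub_zero]

end Inverse

/-! ### Variation of constants and the integral formula -/

section Integral
variable {E : Type*} [NormedAddCommGroup E] [NormedSpace ℝ E] [FiniteDimensional ℝ E]
  {M : Type*} [TopologicalSpace M] [ChartedSpace E M] [IsManifold 𝓘(ℝ, E) ∞ M]
  {F : Type*} [NormedAddCommGroup F] [NormedSpace ℝ F] [FiniteDimensional ℝ F]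
  {V : M → Type*} [TopologicalSpace (TotalSpace F V)]
  [∀ x, AddCommGroup (V x)] [∀ x, Module ℝ (V x)] [∀ x, TopologicalSpace (V x)]
  [∀ x, IsTopologicalAddGroup (V x)] [∀ x, ContinuousSMul ℝ (V x)] [FiberBundle F V]
  [VectorBundle ℝ F V] [ContMDiffVectorBundle ∞ F V 𝓘(ℝ, E)]
  {nabla : CovariantDerivative 𝓘(ℝ, E) F V}
  {X : Π x : M, TangentSpace 𝓘(ℝ, E) x} {A : Π x : M, V x →L[ℝ] V x} {p : M} {U : Set M}

/-- A linear map along a curve, read in the trivialization at `x₀`. -/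
def framed {γ : ℝ → M} (T : Π t : ℝ, V (γ 0) →L[ℝ] V (γ t)) (x₀ : M) (s : ℝ) : F →L[ℝ] F :=
  (trivializationAt F V x₀).continuousLinearMapAt ℝ (γ s) ∘L
    (T s ∘L ((fibreEquiv F (V := V) (γ 0)).symm : F →L[ℝ] V (γ 0)))

theorem framed_apply {γ : ℝ → M} (T : Π t : ℝ, V (γ 0) →L[ℝ] V (γ t)) {x₀ : M} {s : ℝ}
    (hs : γ s ∈ (trivializationAt F V x₀).baseSet) (f : F) :
    framed T x₀ s f = (trivializationAt F V x₀
      (TotalSpace.mk' F (γ s) (T s ((fibreEquiv F (V := V) (γ 0)).symm f)))).2 :=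
  Trivialization.continuousLinearMapAt_apply_of_mem ℝ _ hs _

theorem framed_inverse {γ : ℝ → M} {T : Π t : ℝ, V (γ 0) →L[ℝ] V (γ t)} {x₀ : M} {s : ℝ}
    (hs : γ s ∈ (trivializationAt F V x₀).baseSet) (hT : (T s).IsInvertible) (a : V (γ s)) :
    framed T x₀ s (fibreEquiv F (V := V) (γ 0) ((T s).inverse a)) =
      (trivializationAt F V x₀ (TotalSpace.mk' F (γ s) a)).2 := by
  rw [framed_apply T hs, ContinuousLinearEquiv.symm_apply_apply, hT.self_apply_inverse]

theorem exists_framed_eq {γ : ℝ → M} {T : Π t : ℝ, V (γ 0) →L[ℝ] V (γ t)} {x₀ : M} {s : ℝ}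
    (hs : γ s ∈ (trivializationAt F V x₀).baseSet) (hT : (T s).IsInvertible) :
    ∃ L : F ≃L[ℝ] F, framed (F := F) T x₀ s = L := by
  obtain ⟨Te, hTe⟩ := hT
  refine ⟨(fibreEquiv F (V := V) (γ 0)).symm.trans (Te.trans
    ((trivializationAt F V x₀).continuousLinearEquivAt ℝ (γ s) hs)), ?_⟩
  ext f
  rw [framed_apply T hs, ← hTe]
  rfl

theorem IsFundamentalSolution.hasDerivWithinAt_framed {γ : ℝ → M}
    {T : Π t : ℝ, V (γ 0) →L[ℝ] V (γ t)} (hT : IsFundamentalSolution nabla X A γ T) {x₀ : M}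
    (m : LocalModel nabla X A x₀) {s : ℝ} (hs : s ≤ 0) (hN : γ s ∈ m.nhd) (f : F) :
    HasDerivWithinAt (fun r => framed T x₀ r f)
      (-(m.coeff (extChartAt 𝓘(ℝ, E) x₀ (γ s)) (framed T x₀ s f))) (Iic 0) s := by
  have h := hT.2 ((fibreEquiv F (V := V) (γ 0)).symm f) s hs
  rw [← zero_sub] at h
  obtain ⟨h1, -, h3⟩ := (m.hasCovDerivAlong_iff hN).1 h
  have hb := m.subset_baseSet hN
  rw [(coord_eq_zero_iff hb).2 rfl, zero_sub, ← framed_apply T hb] at h3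
  refine h3.congr_of_eventuallyEq ?_ (framed_apply T hb f)
  filter_upwards [h1.eventually ((trivializationAt F V x₀).open_baseSet.mem_nhds hb)] with r hr
  exact framed_apply T hr f

theorem IsFundamentalSolution.continuousWithinAt_framed {γ : ℝ → M}
    {T : Π t : ℝ, V (γ 0) →L[ℝ] V (γ t)} (hT : IsFundamentalSolution nabla X A γ T) {x₀ : M}
    (m : LocalModel nabla X A x₀) {s : ℝ} (hs : s ≤ 0) (hN : γ s ∈ m.nhd) :
    ContinuousWithinAt (framed (F := F) T x₀) (Iic 0) s :=
  continuousWithinAt_clm_apply.2 fun f => (hT.hasDerivWithinAt_framed m hs hN f).continuousWithinAt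

/-- Variation of constants. -/
theorem IsFundamentalSolution.hasDerivWithinAt_inverse (m : ∀ x₀, LocalModel nabla X A x₀)
    {γ : ℝ → M} {T : Π t : ℝ, V (γ 0) →L[ℝ] V (γ t)} (hT : IsFundamentalSolution nabla X A γ T)
    (hinv : ∀ t ≤ 0, (T t).IsInvertible) {η w : Π t, V (γ t)}
    (h : SolvesOn nabla X A γ η w (Iic 0)) {s : ℝ} (hs : s ≤ 0) :
    HasDerivWithinAt (fun r => fibreEquiv F (V := V) (γ 0) ((T r).inverse (w r)))
      (fibreEquiv F (V := V) (γ 0) ((T s).inverse (η s))) (Iic 0) s := by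
  have hN := (m (γ s)).mem_nhd
  have hb := (m (γ s)).subset_baseSet hN
  obtain ⟨L, hL⟩ := exists_framed_eq hb (hinv s hs)
  obtain ⟨h1, -, h3⟩ := ((m (γ s)).hasCovDerivAlong_iff hN).1 (h s hs)
  refine hasDerivWithinAt_of_clm_apply_eq (hT.continuousWithinAt_framed (m (γ s)) hs hN) hL
    (c := fun r => (trivializationAt F V (γ s) (TotalSpace.mk' F (γ r) (w r))).2) ?_
    (framed_inverse hb (hinv s hs) _) ?_
  · filter_upwards [h1.eventually ((trivializationAt F V (γ s)).open_baseSet.mem_nhds hb),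
      self_mem_nhdsWithin] with r hr hr0
    exact framed_inverse hr (hinv r hr0) _
  -- Both terms contribute the same coefficient term with opposite signs; only the source `η`
  -- remains.
  · refine (h3.fun_sub (hT.hasDerivWithinAt_framed (m (γ s)) hs hN _)).congr_deriv ?_
    rw [framed_inverse hb (hinv s hs), framed_inverse hb (hinv s hs)]
    abel

theorem IsFundamentalSolution.continuousOn_inverse (m : ∀ x₀, LocalModel nabla X A x₀)
    {γ : ℝ → M} (hγ : IsBackwardOrbit X γ) {T : Π t : ℝ, V (γ 0) →L[ℝ] V (γ t)}
    (hT : IsFundamentalSolution nabla X A γ T) (hinv : ∀ t ≤ 0, (T t).IsInvertible)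
    {v : Π x : M, V x} (hU : IsOpen U) (hv : IsSmoothSectionOn (E := E) F U v)
    (hγU : ∀ t ≤ 0, γ t ∈ U) :
    ContinuousOn (fun r => fibreEquiv F (V := V) (γ 0) ((T r).inverse (v (γ r)))) (Iic 0) := by
  intro s hs
  have hN := (m (γ s)).mem_nhd
  have hb := (m (γ s)).subset_baseSet hN
  have hc : ContinuousWithinAt γ (Iic 0) s := IsMIntegralCurveOn.continuousOn hγ s hs
  obtain ⟨L, hL⟩ := exists_framed_eq hb (hinv s hs)
  refine tendsto_of_clm_apply_eq (L := L)
    (hL ▸ (hT.continuousWithinAt_framed (m (γ s)) hs hN).tendsto)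
    (c := fun r => (trivializationAt F V (γ s) (TotalSpace.mk' F (γ r) (v (γ r)))).2) ?_ ?_
  · filter_upwards [hc.eventually ((trivializationAt F V (γ s)).open_baseSet.mem_nhds hb),
      self_mem_nhdsWithin] with r hr hr0
    exact framed_inverse hr (hinv r hr0) _
  · have h1 : L (fibreEquiv F (V := V) (γ 0) ((T s).inverse (v (γ s)))) =
        (trivializationAt F V (γ s) (TotalSpace.mk' F (γ s) (v (γ s)))).2 := by
      rw [← framed_inverse hb (hinv s hs), hL]
      rfl
    rw [h1]
    have h2 := (contMDiffOn_coord (γ s) hv hU).continuousOn.continuousAt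
      ((hU.inter (trivializationAt F V (γ s)).open_baseSet).mem_nhds ⟨hγU s hs, hb⟩)
    exact h2.tendsto.comp hc.tendsto

/-- The inverse of the fundamental solution grows at most exponentially at `-∞`. -/
theorem IsFundamentalSolution.exists_norm_inverse_le (m : LocalModel nabla X A p)
    {γ : ℝ → M} (hlim : Tendsto γ atBot (𝓝 p)) {T : Π t : ℝ, V (γ 0) →L[ℝ] V (γ t)}
    (hT : IsFundamentalSolution nabla X A γ T) (hinv : ∀ t ≤ 0, (T t).IsInvertible) :
    ∃ C K : ℝ, 0 ≤ C ∧ ∀ᶠ s in atBot, ∀ a : V (γ s),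
      ‖fibreEquiv F (V := V) (γ 0) ((T s).inverse a)‖ ≤
        C * Real.exp (-(K * s)) * ‖(trivializationAt F V p (TotalSpace.mk' F (γ s) a)).2‖ := by
  set K := ‖m.coeff (extChartAt 𝓘(ℝ, E) p p)‖ + 1 with hK
  obtain ⟨b, hb⟩ := ((eventually_norm_coeff_le m hlim).and
    (Iic_mem_atBot (0 : ℝ))).exists_forall_of_atBot
  have hb0 : b ≤ 0 := (hb b le_rfl).2
  obtain ⟨L, hL⟩ := exists_framed_eq (m.subset_baseSet (hb b le_rfl).1.1) (hinv b hb0)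
  refine ⟨‖(L.symm : F →L[ℝ] F)‖ * Real.exp (K * b), K, by positivity, ?_⟩
  filter_upwards [Iic_mem_atBot b] with s hs a
  have hs : s ≤ b := hs
  have hs0 : s ≤ 0 := hs.trans hb0
  set f := fibreEquiv F (V := V) (γ 0) ((T s).inverse a) with hf
  -- With `f` fixed, the framed solution equals the coordinates of `a` at time `s` and `L f` at time
  -- `b`. Grönwall from `s` to `b` therefore bounds `f`.
  have h1 := norm_le_mul_exp_abs (a := s) (b := b) (K := K) (f := fun r => framed T p r f)
    (f' := fun r => -(m.coeff (extChartAt 𝓘(ℝ, E) p (γ r)) (framed T p r f)))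
    (fun r hr => (hT.hasDerivWithinAt_framed m (hr.2.trans hb0) (hb r hr.2).1.1 f).mono
      fun x hx => mem_Iic.2 (hx.2.trans hb0))
    (fun r hr => by
      rw [norm_neg]
      exact (m.coeff _).le_of_opNorm_le (hb r hr.2).1.2 _)
    (left_mem_Icc.2 hs) (right_mem_Icc.2 hs)
  rw [framed_inverse (m.subset_baseSet (hb s hs).1.1) (hinv s hs0), abs_of_nonneg (by linarith)]
    at h1
  have h2 : f = (L.symm : F →L[ℝ] F) (framed T p b f) := by
    rw [hL]
    exact (L.symm_apply_apply f).symm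
  have h3 : Real.exp (K * (b - s)) = Real.exp (K * b) * Real.exp (-(K * s)) := by
    rw [← Real.exp_add]; ring_nf
  calc ‖f‖ ≤ ‖(L.symm : F →L[ℝ] F)‖ * ‖framed T p b f‖ := by
        conv_lhs => rw [h2]
        exact ContinuousLinearMap.le_opNorm _ _
    _ ≤ ‖(L.symm : F →L[ℝ] F)‖ * (‖(trivializationAt F V p (TotalSpace.mk' F (γ s) a)).2‖ *
          (Real.exp (K * b) * Real.exp (-(K * s)))) := by
        rw [← h3]
        gcongr
    _ = _ := by ring

/-- The inverse grows at most like `exp (-(K * s))`. Flatness permits decay at rate `K + 1`, leaving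
the integrable `exp s`. -/
theorem IsFundamentalSolution.exists_norm_inverse_flat_le [T2Space M]
    (m : ∀ x₀, LocalModel nabla X A x₀) (hp : IsStrictlyPositiveSource X p)
    (hU : IsStarShaped X p U) {γ : ℝ → M} (hγ : IsBackwardOrbit X γ) (h0 : γ 0 ∈ U)
    {T : Π t : ℝ, V (γ 0) →L[ℝ] V (γ t)} (hT : IsFundamentalSolution nabla X A γ T)
    (hinv : ∀ t ≤ 0, (T t).IsInvertible) {σ : Π x : M, V x}
    (hσ : IsSmoothSectionOn (E := E) F U σ) (hflat : IsFlatAt (E := E) F p σ) :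
    ∃ C : ℝ, ∀ᶠ s in atBot,
      ‖fibreEquiv F (V := V) (γ 0) ((T s).inverse (σ (γ s)))‖ ≤ C * Real.exp s := by
  obtain ⟨C, K, hC, h1⟩ := hT.exists_norm_inverse_le (m p) (hU.orbit m hγ h0).1 hinv
  obtain ⟨C', hC', h2⟩ := exists_coord_decay m hp hU hσ hflat hγ h0 (K + 1)
  refine ⟨C * C', ?_⟩
  filter_upwards [h1, h2] with s h1 h2
  calc _ ≤ _ := h1 _
    _ ≤ C * Real.exp (-(K * s)) * (C' * Real.exp ((K + 1) * s)) := by gcongr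
    _ = C * C' * (Real.exp (-(K * s)) * Real.exp ((K + 1) * s)) := by ring
    _ = C * C' * Real.exp s := by rw [← Real.exp_add]; ring_nf

/-- The integral formula for flat solutions. -/
theorem IsFundamentalSolution.hasIntegralIic [T2Space M]
    (m : ∀ x₀, LocalModel nabla X A x₀) (hp : IsStrictlyPositiveSource X p)
    (hU : IsStarShaped X p U) {γ : ℝ → M} (hγ : IsBackwardOrbit X γ) (h0 : γ 0 ∈ U)
    {T : Π t : ℝ, V (γ 0) →L[ℝ] V (γ t)} (hT : IsFundamentalSolution nabla X A γ T)
    (hinv : ∀ t ≤ 0, (T t).IsInvertible) {u v : Π x : M, V x}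
    (hu : IsSmoothSectionOn (E := E) F U u) (huflat : IsFlatAt (E := E) F p u)
    (hv : IsSmoothSectionOn (E := E) F U v) (hvflat : IsFlatAt (E := E) F p v)
    (hsol : SolvesOn nabla X A γ (fun t => v (γ t)) (fun t => u (γ t)) (Iic 0)) :
    HasIntegralIic (fun s => (T s).inverse (v (γ s))) (u (γ 0)) := by
  have : CompleteSpace F := FiniteDimensional.complete ℝ F
  set ι := fibreEquiv F (V := V) (γ 0) with hι
  have hcont := hT.continuousOn_inverse m hγ hinv hU.1 hv (hU.orbit m hγ h0).2
  have hderiv := fun s (hs : s ≤ 0) => hT.hasDerivWithinAt_inverse m hinv hsol hs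
  obtain ⟨C, hC⟩ := hT.exists_norm_inverse_flat_le m hp hU hγ h0 hinv hu huflat
  obtain ⟨C', hC'⟩ := hT.exists_norm_inverse_flat_le m hp hU hγ h0 hinv hv hvflat
  -- The antiderivative of the integrand given by variation of constants has no contribution from
  -- `-∞`; at time zero it is the value of `u`.
  have hlim : Tendsto (fun s => ι ((T s).inverse (u (γ s)))) atBot (𝓝 0) := by
    refine squeeze_zero_norm' hC ?_
    simpa using Real.tendsto_exp_atBot.const_mul C
  have hint : IntegrableOn (fun s => ι ((T s).inverse (v (γ s)))) (Iic 0) := by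
    obtain ⟨b, hb⟩ := (hC'.and (Iic_mem_atBot (0 : ℝ))).exists_forall_of_atBot
    have hb0 : b ≤ 0 := (hb b le_rfl).2
    rw [← Iic_union_Icc_eq_Iic hb0]
    refine IntegrableOn.union ?_ ((hcont.mono fun t ht => ht.2).integrableOn_Icc)
    refine Integrable.mono' ((integrableOn_exp_Iic b).const_mul C')
      ((hcont.mono (Iic_subset_Iic.2 hb0)).aestronglyMeasurable measurableSet_Iic) ?_
    exact (ae_restrict_mem measurableSet_Iic).mono fun s hs => (hb s hs).1
  have hval := integral_Iic_of_hasDerivAt_of_tendsto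
    (hderiv 0 le_rfl).continuousWithinAt
    (fun s hs => (hderiv s (le_of_lt hs)).hasDerivAt (Iic_mem_nhds hs)) hint hlim
  have hT0 : (T 0).inverse (u (γ 0)) = u (γ 0) := by
    rw [hT.1, ContinuousLinearMap.inverse_id]
    rfl
  rw [sub_zero, hT0] at hval
  intro l
  set l' : F →L[ℝ] ℝ := l ∘L (ι.symm : F →L[ℝ] V (γ 0)) with hl'
  have hll' : ∀ a, l a = l' (ι a) := fun a => by
    simp only [hl', ContinuousLinearMap.comp_apply, ContinuousLinearEquiv.coe_coe,
      ContinuousLinearEquiv.symm_apply_apply]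
  simp only [hll']
  refine ⟨l'.integrable_comp hint, ?_⟩
  rw [l'.integral_comp_comm hint, hval]

end Integral

/-! ### Existence and uniqueness of flat solutions -/

section Conclusion

variable {E : Type*} [NormedAddCommGroup E] [NormedSpace ℝ E] [FiniteDimensional ℝ E]
  {M : Type*} [TopologicalSpace M] [ChartedSpace E M] [IsManifold 𝓘(ℝ, E) ∞ M]
  {F : Type*} [NormedAddCommGroup F] [NormedSpace ℝ F] [FiniteDimensional ℝ F]
  {V : M → Type*} [TopologicalSpace (TotalSpace F V)]
  [∀ x, AddCommGroup (V x)] [∀ x, Module ℝ (V x)] [∀ x, TopologicalSpace (V x)]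
  [∀ x, IsTopologicalAddGroup (V x)] [∀ x, ContinuousSMul ℝ (V x)] [FiberBundle F V]
  [VectorBundle ℝ F V] [ContMDiffVectorBundle ∞ F V 𝓘(ℝ, E)]
  {nabla : CovariantDerivative 𝓘(ℝ, E) F V}
  {X : Π x : M, TangentSpace 𝓘(ℝ, E) x} {A : Π x : M, V x →L[ℝ] V x} {p : M} {U : Set M}

theorem nablaAdd_sub {σ τ : Π x : M, V x} {x : M}
    (hσ : MDifferentiableAt 𝓘(ℝ, E) (𝓘(ℝ, E).prod 𝓘(ℝ, F)) (fun y => TotalSpace.mk' F y (σ y)) x)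
    (hτ : MDifferentiableAt 𝓘(ℝ, E) (𝓘(ℝ, E).prod 𝓘(ℝ, F)) (fun y => TotalSpace.mk' F y (τ y)) x) :
    nablaAdd nabla X A (fun y => σ y - τ y) x = nablaAdd nabla X A σ x - nablaAdd nabla X A τ x := by
  have : ContMDiffVectorBundle 1 F V 𝓘(ℝ, E) := ContMDiffVectorBundle.of_le (n := ∞) (by simp)
  have h := nabla.isCovariantDerivativeOnUniv.add (σ := fun y => σ y - τ y) (σ' := τ)
    (mdifferentiableAt_sub_section hσ hτ) hτ
  have h1 : (fun y => σ y - τ y) + τ = σ := by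
    funext y
    exact sub_add_cancel _ _
  rw [h1] at h
  have h2 : nabla σ x (X x) = nabla (fun y => σ y - τ y) x (X x) + nabla τ x (X x) :=
    congrArg (fun L => L (X x)) h
  simp only [nablaAdd, map_sub]
  rw [h2]
  abel

theorem IsFlatAt.sub {σ τ : Π x : M, V x} (hU : IsOpen U) (hpU : p ∈ U)
    (hσ : IsSmoothSectionOn (E := E) F U σ) (hτ : IsSmoothSectionOn (E := E) F U τ)
    (hσ' : IsFlatAt (E := E) F p σ) (hτ' : IsFlatAt (E := E) F p τ) :
    IsFlatAt (E := E) F p (fun x => σ x - τ x) := by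
  obtain ⟨g, hg, N, hN, hpN, -, -, hgN⟩ := exists_contDiff_coord hU hσ hpU
  obtain ⟨g', hg', N', hN', hpN', -, -, hgN'⟩ := exists_contDiff_coord hU hτ hpU
  have h1 := (isFlatAt_iff hN hpN hgN).1 hσ'
  have h2 := (isFlatAt_iff hN' hpN' hgN').1 hτ'
  refine (isFlatAt_iff (g := g - g')
    ((hN.inter hN').inter (trivializationAt F V p).open_baseSet)
    ⟨⟨hpN, hpN'⟩, mem_baseSet_trivializationAt F V p⟩ fun x hx => ?_).2 fun k => ?_
  · rw [Pi.sub_apply, hgN x hx.1.1, hgN' x hx.1.2]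
    exact (((trivializationAt F V p).linear ℝ hx.2).mk' _).map_sub (σ x) (τ x) |>.symm
  · rw [iteratedFDeriv_sub_apply (hg.of_le (by exact_mod_cast le_top)).contDiffAt
      (hg'.of_le (by exact_mod_cast le_top)).contDiffAt, h1, h2, sub_zero]

/-- Flat solutions are unique. -/
theorem eqOn_of_flat [T2Space M] (m : ∀ x₀, LocalModel nabla X A x₀)
    (hp : IsStrictlyPositiveSource X p) (hU : IsStarShaped X p U) {σ τ v : Π x : M, V x}
    (hσ : IsSmoothSectionOn (E := E) F U σ) (hσ' : IsFlatAt (E := E) F p σ)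
    (hσv : ∀ x ∈ U, nablaAdd nabla X A σ x = v x)
    (hτ : IsSmoothSectionOn (E := E) F U τ) (hτ' : IsFlatAt (E := E) F p τ)
    (hτv : ∀ x ∈ U, nablaAdd nabla X A τ x = v x) :
    ∀ x ∈ U, σ x = τ x := by
  intro x hx
  refine sub_eq_zero.1 (eq_zero_of_flat m hp hU (σ := fun x => σ x - τ x) (η := fun _ => 0)
    (C := 0) (ContMDiffOn.sub_section hσ hτ) (hσ'.sub hU.1 hU.2.1 hσ hτ hτ') (fun x hx => ?_)
    (fun x₀ x _ hb => ?_) x hx)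
  · rw [nablaAdd_sub (hσ.mdifferentiableAt hU.1 hx) (hτ.mdifferentiableAt hU.1 hx), hσv x hx,
      hτv x hx, sub_self]
  · rw [(coord_eq_zero_iff hb).2 rfl, norm_zero, zero_mul]

/-- Existence of flat solutions, together with the equation along backward orbits. -/
theorem exists_flat_solution [T2Space M] (m : ∀ x₀, LocalModel nabla X A x₀)
    (hp : IsStrictlyPositiveSource X p) (hU : IsStarShaped X p U) {v : Π x : M, V x}
    (hv : IsSmoothSectionOn (E := E) F U v) (hvflat : IsFlatAt (E := E) F p v) :
    ∃ u : Π x : M, V x, IsSmoothSectionOn (E := E) F U u ∧ IsFlatAt (E := E) F p u ∧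
      (∀ x ∈ U, nablaAdd nabla X A u x = v x) ∧
      ∀ γ : ℝ → M, IsBackwardOrbit X γ → γ 0 ∈ U →
        SolvesOn nabla X A γ (fun t => v (γ t)) (fun t => u (γ t)) (Iic 0) := by
  obtain ⟨S, u₀, hSo, hpS, hSU, hu₀, hflat, h₀⟩ := exists_local_solution m hp hU hv hvflat
  obtain ⟨u, huS, hu⟩ := exists_solution_along_orbits m hU hv hSo hpS hSU hu₀ h₀
  have huS' : IsSmoothSectionOn (E := E) F S u :=
    ContMDiffOn.congr hu₀ fun x hx => by rw [huS x hx]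
  have husmooth := isSmoothSectionOn_of_solvesOn m hU hv hu hSo hpS huS'
  refine ⟨u, husmooth, ?_, fun x hx => ?_, hu⟩
  · obtain ⟨g, -, N, hN, hpN, hNS, -, hgN⟩ := exists_contDiff_coord hSo hu₀ hpS
    refine (isFlatAt_iff hN hpN fun x hx => ?_).2 ((isFlatAt_iff hN hpN hgN).1 hflat)
    rw [hgN x hx, huS x (hNS hx)]
  · obtain ⟨γ, rfl, hγ, -, -⟩ := hU.2.2 x hx
    exact nablaAdd_eq_of_solvesOn m hU.1 husmooth hγ hx (hu γ hγ hx)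

end Conclusion
end FlatSol
end

/-- `M` is a smooth Hausdorff manifold modelled on `E`, and `V` is a smooth vector bundle over `M`
with scalars `𝕜 = ℝ` or `ℂ`, with a smooth `𝕜`-linear connection `nabla` and a smooth field `A` of
`𝕜`-linear endomorphisms. -/
theorem mainTheorem4
    {E : Type*} [NormedAddCommGroup E] [NormedSpace ℝ E] [FiniteDimensional ℝ E]
    {M : Type*} [TopologicalSpace M] [T2Space M] [ChartedSpace E M] [IsManifold 𝓘(ℝ, E) ∞ M]
    {𝕜 : Type*} [RCLike 𝕜]
    {F : Type*} [NormedAddCommGroup F] [NormedSpace ℝ F] [NormedSpace 𝕜 F] [IsScalarTower ℝ 𝕜 F]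
    [FiniteDimensional ℝ F]
    {V : M → Type*} [TopologicalSpace (TotalSpace F V)]
    [∀ x, AddCommGroup (V x)] [∀ x, Module ℝ (V x)] [∀ x, Module 𝕜 (V x)]
    [∀ x, IsScalarTower ℝ 𝕜 (V x)] [∀ x, TopologicalSpace (V x)]
    [∀ x, IsTopologicalAddGroup (V x)] [∀ x, ContinuousSMul ℝ (V x)]
    [FiberBundle F V] [VectorBundle ℝ F V] [VectorBundle 𝕜 F V]
    [ContMDiffVectorBundle ∞ F V 𝓘(ℝ, E)]
    (nabla : CovariantDerivative 𝓘(ℝ, E) F V)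
    (hnabla : nabla.ContMDiffCovariantDerivative ∞)
    (hnabla_lin : ∀ (c : 𝕜) (σ : Π x : M, V x) (x : M) (ξ : TangentSpace 𝓘(ℝ, E) x),
      MDifferentiableAt 𝓘(ℝ, E) (𝓘(ℝ, E).prod 𝓘(ℝ, F)) (fun y => TotalSpace.mk' F y (σ y)) x →
      nabla (fun y => c • σ y) x ξ = c • nabla σ x ξ)
    (A : Π x : M, V x →L[ℝ] V x)
    (hA : ContMDiff 𝓘(ℝ, E) (𝓘(ℝ, E).prod 𝓘(ℝ, F →L[ℝ] F)) ∞
      (fun x => TotalSpace.mk' (F →L[ℝ] F) (E := fun x => V x →L[ℝ] V x) x (A x)))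
    (hA_lin : ∀ (c : 𝕜) (x : M) (a : V x), A x (c • a) = c • A x a)
    (X : Π x : M, TangentSpace 𝓘(ℝ, E) x)
    (hX : ContMDiff 𝓘(ℝ, E) (𝓘(ℝ, E).prod 𝓘(ℝ, E)) ∞
      (fun x => (TotalSpace.mk' E x (X x) : TangentBundle 𝓘(ℝ, E) M)))
    (p : M)
    (hp : FlatSol.IsStrictlyPositiveSource X p)
    (U : Set M) (hU : FlatSol.IsStarShaped X p U) :
    (∀ v : Π x : M, V x,
      FlatSol.IsSmoothSectionOn (E := E) F U v → FlatSol.IsFlatAt (E := E) F p v →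
      ∃ u : Π x : M, V x,
        (FlatSol.IsSmoothSectionOn (E := E) F U u ∧ FlatSol.IsFlatAt (E := E) F p u ∧
          ∀ x ∈ U, FlatSol.nablaAdd nabla X A u x = v x) ∧
        (∀ u' : Π x : M, V x,
          FlatSol.IsSmoothSectionOn (E := E) F U u' → FlatSol.IsFlatAt (E := E) F p u' →
          (∀ x ∈ U, FlatSol.nablaAdd nabla X A u' x = v x) → ∀ x ∈ U, u' x = u x) ∧
        (∀ γ : ℝ → M, γ 0 ∈ U → FlatSol.IsBackwardOrbit X γ →
          ∃ T : Π t : ℝ, V (γ 0) →L[ℝ] V (γ t),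
            FlatSol.IsFundamentalSolution nabla X A γ T ∧
            (∀ T' : Π t : ℝ, V (γ 0) →L[ℝ] V (γ t),
              FlatSol.IsFundamentalSolution nabla X A γ T' → ∀ t ≤ 0, T' t = T t) ∧
            (∀ t ≤ 0, (T t).IsInvertible) ∧
            FlatSol.HasIntegralIic (fun s => (T s).inverse (v (γ s))) (u (γ 0)))) ∧
    (∀ (lam : 𝕜) (w : Π x : M, V x),
      FlatSol.IsSmoothSectionOn (E := E) F U w → FlatSol.IsFlatAt (E := E) F p w →
      (∀ x ∈ U, FlatSol.nablaAdd nabla X A w x = lam • w x) → ∀ x ∈ U, w x = 0) := by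
  let m : ∀ x₀, FlatSol.LocalModel nabla X A x₀ := fun x₀ =>
    (FlatSol.nonempty_localModel hnabla hA hX x₀).some
  refine ⟨fun v hv hvflat => ?_, fun lam w hw hwflat heq => ?_⟩
  · obtain ⟨u, hu, huflat, hpde, hsol⟩ := FlatSol.exists_flat_solution m hp hU hv hvflat
    refine ⟨u, ⟨hu, huflat, hpde⟩, fun u' hu' hu'flat hu'v =>
      FlatSol.eqOn_of_flat m hp hU hu' hu'flat hu'v hu huflat hpde, fun γ h0 hγ => ?_⟩
    obtain ⟨T, hT, huniq, hinv⟩ := FlatSol.exists_isFundamentalSolution m hγ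
    exact ⟨T, hT, huniq, hinv,
      hT.hasIntegralIic m hp hU hγ h0 hinv hu huflat hv hvflat (hsol γ hγ h0)⟩
  -- The eigenvalue term is kept as a source. The trivializations are `𝕜`-linear, so in each of them
  -- its norm is `‖lam‖` times that of `w`, as the vanishing theorem allows.
  · refine FlatSol.eq_zero_of_flat m hp hU (η := fun x => lam • w x) (C := ‖lam‖) hw hwflat heq
      fun x₀ x _ hx => ?_
    rw [show (trivializationAt F V x₀ (TotalSpace.mk' F x (lam • w x))).2 =
      lam • (trivializationAt F V x₀ (TotalSpace.mk' F x (w x))).2 from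
      ((trivializationAt F V x₀).linear 𝕜 hx).map_smul lam (w x), norm_smul]
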